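/- **Setting.** For $i=1,2$ let $(X_i,\rho_i,\mu_i)$ be a space of homogeneous type in the sense of Coifman and Weiss: $\rho_i$ is a quasi-metric ($\rho_i(x,y)\le A_0[\rho_i(x,z)+\rho_i(z,y)]$), $X_i$ carries the topology induced by $\rho_i$, and $\mu_i$ is a nonzero Borel measure with $\mu_i(B(x,2r))\le C_{\mu_i}\mu_i(B(x,r))<\infty$ for all $x\in X_i$, $r>0$. Let $\mu=\mu_1\times\mu_2$. Let $\mathcal D_i=\bigcup_{k\in\mathbb Z}\mathcal D_{i,k}$ be a system of dyadic cubes on $X_i$ with parameters $\delta_i\in(0,1)$ and $0<c_i\le C_i<\infty$ (countable nested Borel partitions $\mathcal D_{i,k}$ of $X_i$ such that each $Q\in\mathcal D_{i,k}$ has a center $x_Q$ with $B(x_Q,c_i\delta_i^k)\subseteq Q\subseteq B(x_Q,C_i\delta_i^k)$ and is the union of its children $R\in\mathcal D_{i,k+1}$, $R\subseteq Q$, whose number $M_Q\geq 1$ is bounded; $B(x_P,C_i\delta_i^l)\subseteq B(x_Q,C_i\delta_i^k)$ whenever $P\in\mathcal D_{i,l}$, $Q\in\mathcal D_{i,k}$,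 $l\ge k$, $P\subseteq Q$; and some fixed point is a center of a cube of every generation). Number the children $Q_1,\dots,Q_{M_Q}$ of each cube $Q$ so that $\sum_{j\ge u}\mu_i(Q_j)\ge(1-\frac{u-1}{M_Q})\mu_i(Q)$ for all $u$, put $E_u=\bigcup_{j\ge u}Q_j$, and define the Haar functions, for $u=1,\dots,M_Q-1$, $$h_Q^u=\frac{\mu_i(E_{u+1})^{1/2}}{\mu_i(Q_u)^{1/2}\mu_i(E_u)^{1/2}}1_{Q_u}-\frac{\mu_i(Q_u)^{1/2}}{\mu_i(E_u)^{1/2}\mu_i(E_{u+1})^{1/2}}1_{E_{u+1}} .$$ Functions are real- or complex-valued. Write $\langle f,h_{Q_1}^{u_1}h_{Q_2}^{u_2}\rangle=\int f(x_1,x_2)h_{Q_1}^{u_1}(x_1)h_{Q_2}^{u_2}(x_2)\,d\mu_1(x_1)d\mu_2(x_2)$, and let $$S_{d,d}(f)(x_1,x_2)=\Big\{\sum_{Q_1\in\mathcal D_1}\sum_{Q_2\in\mathcal D_2}\sum_{u_1=1}^{M_{Q_1}-1}\sum_{u_2=1}^{M_{Q_2}-1}\big|\langle f,h_{Q_1}^{u_1}h_{Q_2}^{u_2}\rangle\big|^2\frac{1_{Q_1}(x_1)}{\mu_1(Q_1)}\frac{1_{Q_2}(x_2)}{\mu_2(Q_2)}\Big\}^{1/2},$$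 $$H^1_{d,d}=\{f\in L^1(X_1\times X_2): S_{d,d}(f)\in L^1\},\qquad \|f\|_{H^1_{d,d}}=\|S_{d,d}(f)\|_{L^1},$$ $$\mathcal C_1^d(\varphi)=\sup_\Omega\Big\{\frac1{\mu(\Omega)}\sum_{Q_1\times Q_2\subseteq\Omega}\sum_{u_1,u_2}\big|\langle\varphi,h_{Q_1}^{u_1}h_{Q_2}^{u_2}\rangle\big|^2\Big\}^{1/2}$$ (supremum over all open $\Omega\subseteq X_1\times X_2$ of finite measure, the sum running over $Q_i\in\mathcal D_i$), and let $\mathrm{BMO}_{d,d}$ be the set of all $\varphi$ that are integrable on products of balls and satisfy $\mathcal C_1^d(\varphi)<\infty$. For $\varphi\in\mathrm{BMO}_{d,d}$ and $f\in H^1_{d,d}\cap L^2$ set $$\langle\varphi,f\rangle=\sum_{Q_1,Q_2,u_1,u_2}\langle\varphi,h_{Q_1}^{u_1}h_{Q_2}^{u_2}\rangle\,\langle f,h_{Q_1}^{u_1}h_{Q_2}^{u_2}\rangle .$$ Call the pair $(\varphi,f)$ *admissible* if (i) $\varphi\in L^2$, or $f$ is essentially bounded and vanishes a.e. outside a product of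 balls; and (ii) if $\mu_1(X_1)<\infty$ then $\int f(x_1,x_2)\,d\mu_1(x_1)=0$ for a.e. $x_2$, and if $\mu_2(X_2)<\infty$ then $\int f(x_1,x_2)\,d\mu_2(x_2)=0$ for a.e. $x_1$. **Theorem.** There is an absolute constant $C$ such that the following holds. (1) Let $\varphi\in\mathrm{BMO}_{d,d}(X_1\times X_2)$. For every $f\in H^1_{d,d}\cap L^2$ the series $\langle\varphi,f\rangle$ converges absolutely, and if $(\varphi,f)$ is admissible then $\varphi f$ is integrable and $\langle\varphi,f\rangle=\int\varphi f\,d\mu_1d\mu_2$. The linear functional $\ell(f)=\langle\varphi,f\rangle$, initially defined on $H^1_{d,d}\cap L^2$, has a unique bounded linear extension to $H^1_{d,d}$, and this extension satisfies $\|\ell\|\le C\,\mathcal C_1^d(\varphi)$. It is even the only bounded linear functional on $H^1_{d,d}$ that equals $\int\varphi f\,d\mu_1d\mu_2$ for all $f\in H^1_{d,d}\cap L^2$ for which $(\varphi,f)$ is admissible. (2) Conversely, for every linear functional $\ell$ on $H^1_{d,d}\cap L^2$ that is bounded with respect to $\|\cdot\|_{H^1_{d,d}}$ there is $\varphi\in\mathrm{BMO}_{d,d}(X_1\times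 X_2)$ with $\mathcal C_1^d(\varphi)\le C\|\ell\|$ such that, for all $f\in H^1_{d,d}\cap L^2$, the series $\langle\varphi,f\rangle$ converges absolutely and $\ell(f)=\langle\varphi,f\rangle$; if moreover $(\varphi,f)$ is admissible, then $\varphi f$ is integrable and $\ell(f)=\int\varphi f\,d\mu_1d\mu_2$. -/

import Mathlib

open MeasureTheory Set
open scoped ENNReal NNReal

noncomputable section

namespace ProductDyadic

/-! ### Spaces of homogeneous type -/

/-- `ρ` is a quasi-metric on `X` with quasi-triangle constant `A₀`. -/
structure IsQuasiMetric {X : Type*} (ρ : X → X → ℝ) (A₀ : ℝ) : Prop where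
  one_le : 1 ≤ A₀
  nonneg : ∀ x y, 0 ≤ ρ x y
  symm : ∀ x y, ρ x y = ρ y x
  eq_zero_iff : ∀ x y, ρ x y = 0 ↔ x = y
  quasi_triangle : ∀ x y z, ρ x y ≤ A₀ * (ρ x z + ρ z y)

/-- The ball `B(x, r) = {y : ρ(x, y) < r}`. -/
def qball {X : Type*} (ρ : X → X → ℝ) (x : X) (r : ℝ) : Set X := {y | ρ x y < r}

/-- `(X, ρ, μ)` is a space of homogeneous type in the sense of Coifman and Weiss: `ρ` is a
quasi-metric, the topology of `X` is the one induced by `ρ`, and `μ` is a nonzero Borel measure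
satisfying the doubling condition. -/
structure IsHomogeneousType {X : Type*} [TopologicalSpace X] [MeasurableSpace X]
    (ρ : X → X → ℝ) (μ : Measure X) : Prop where
  borel : BorelSpace X
  quasiMetric : ∃ A₀ : ℝ, IsQuasiMetric ρ A₀
  isOpen_iff : ∀ U : Set X, IsOpen U ↔ ∀ x ∈ U, ∃ ε : ℝ, 0 < ε ∧ qball ρ x ε ⊆ U
  ne_zero : μ ≠ 0
  doubling : ∃ K : ℝ≥0, ∀ (x : X) (r : ℝ), 0 < r →
    μ (qball ρ x (2 * r)) ≤ K * μ (qball ρ x r) ∧ μ (qball ρ x r) < ∞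

/-! ### Dyadic cubes -/

/-- A system of dyadic cubes on `(X, ρ)`, with parameters `δ ∈ (0,1)` and `0 < c ≤ C < ∞`, with
at most `M` children for each cube, and with a distinguished center point. The set `cubes k`
consists of the cubes of generation `k`; since these are nonempty and disjoint, they are in
bijection with their indices. `center k Q` is the center point of the cube `Q` of generation `k`
(its values at sets `Q ∉ cubes k` play no role). -/
structure DyadicSystem {X : Type*} [MeasurableSpace X] (ρ : X → X → ℝ) where
  δ : ℝ
  c : ℝ
  C : ℝ
  M : ℕ
  cubes : ℤ → Set (Set X)
  center : ℤ → Set X → X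
  δ_pos : 0 < δ
  δ_lt_one : δ < 1
  c_pos : 0 < c
  c_le_C : c ≤ C
  countable_cubes : ∀ k, (cubes k).Countable
  measurableSet_cube : ∀ k, ∀ Q ∈ cubes k, MeasurableSet Q
  /-- the cubes of each generation form a partition of the space -/
  sUnion_cubes : ∀ k, ⋃₀ cubes k = univ
  disjoint_cubes : ∀ k, (cubes k).PairwiseDisjoint id
  nested : ∀ k l, k ≤ l → ∀ Q ∈ cubes k, ∀ P ∈ cubes l, P ⊆ Q ∨ Disjoint Q P
  parent : ∀ k l, l ≤ k → ∀ Q ∈ cubes k, ∃! P, P ∈ cubes l ∧ Q ⊆ P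
  one_le_children : ∀ k, ∀ Q ∈ cubes k, 1 ≤ {R | R ∈ cubes (k + 1) ∧ R ⊆ Q}.encard
  children_le : ∀ k, ∀ Q ∈ cubes k, {R | R ∈ cubes (k + 1) ∧ R ⊆ Q}.encard ≤ M
  sUnion_children : ∀ k, ∀ Q ∈ cubes k, ⋃₀ {R | R ∈ cubes (k + 1) ∧ R ⊆ Q} = Q
  ball_subset : ∀ k, ∀ Q ∈ cubes k, qball ρ (center k Q) (c * δ ^ k) ⊆ Q
  subset_ball : ∀ k, ∀ Q ∈ cubes k, Q ⊆ qball ρ (center k Q) (C * δ ^ k)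
  ball_mono : ∀ k l, k ≤ l → ∀ Q ∈ cubes k, ∀ P ∈ cubes l, P ⊆ Q →
    qball ρ (center l P) (C * δ ^ l) ⊆ qball ρ (center k Q) (C * δ ^ k)
  /-- distinguished center point: some point is a center in all generations -/
  distinguished : ∃ x₀ : X, ∀ k, ∃ Q ∈ cubes k, center k Q = x₀

/-- The set `ch(Q)` of children of a cube `Q` of generation `k`. -/
def DyadicSystem.children {X : Type*} [MeasurableSpace X] {ρ : X → X → ℝ} (D : DyadicSystem ρ)
    (k : ℤ) (Q : Set X) : Set (Set X) := {R | R ∈ D.cubes (k + 1) ∧ R ⊆ Q}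

/-- The number `M_Q` of children of a cube `Q` of generation `k`. -/
def DyadicSystem.numChildren {X : Type*} [MeasurableSpace X] {ρ : X → X → ℝ}
    (D : DyadicSystem ρ) (k : ℤ) (Q : Set X) : ℕ := (D.children k Q).ncard

/-- A system of dyadic cubes together with the choices that determine its Haar functions: an
enumeration `Q_1, …, Q_{M_Q}` of the children of each cube `Q` such that
`∑_{j ≥ u} μ(Q_j) ≥ (1 - (u - 1) / M_Q) μ(Q)` for `u = 1, …, M_Q`. In the code the children are
numbered from `0`. -/
structure HaarSystem {X : Type*} [MeasurableSpace X] (ρ : X → X → ℝ) (μ : Measure X)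
    extends DyadicSystem ρ where
  child : ∀ (k : ℤ) (Q : cubes k),
    Fin (toDyadicSystem.numChildren k Q) ≃ toDyadicSystem.children k Q
  child_tail : ∀ (k : ℤ) (Q : cubes k) (u : Fin (toDyadicSystem.numChildren k Q)),
    (1 - (u : ℝ) / toDyadicSystem.numChildren k Q) * μ.real Q ≤
      ∑ j ∈ Finset.Ici u, μ.real (child k Q j : Set X)

/-! ### Haar functions -/

section Haar

variable {X : Type*} [MeasurableSpace X] {ρ : X → X → ℝ} {μ : Measure X}

/-- The index set of the cancellative Haar functions: a generation `k`, a cube `Q` of generation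
`k` and one of `M_Q - 1` labels. -/
abbrev HaarSystem.Index (H : HaarSystem ρ μ) : Type _ :=
  Σ k : ℤ, Σ Q : H.cubes k, Fin (H.numChildren k Q - 1)

/-- The cube `Q` to which a Haar function belongs. -/
def HaarSystem.cube (H : HaarSystem ρ μ) (i : H.Index) : Set X := (i.2.1 : Set X)

/-- The child `Q_u`. -/
def HaarSystem.head (H : HaarSystem ρ μ) (i : H.Index) : Set X :=
  H.child i.1 i.2.1 ⟨(i.2.2 : ℕ), lt_of_lt_of_le i.2.2.isLt (Nat.sub_le _ _)⟩

/-- The set `E_u = ⋃_{j ≥ u} Q_j`. -/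
def HaarSystem.tail (H : HaarSystem ρ μ) (k : ℤ) (Q : H.cubes k) (u : ℕ) : Set X :=
  ⋃ j : Fin (H.numChildren k Q), ⋃ _ : u ≤ (j : ℕ), (H.child k Q j : Set X)

/-- The Haar function `h^Q_u = a_u 1_{Q_u} - b_u 1_{E_{u+1}}`, where
`a_u = μ(E_{u+1})^{1/2} / (μ(Q_u)^{1/2} μ(E_u)^{1/2})` and
`b_u = μ(Q_u)^{1/2} / (μ(E_u)^{1/2} μ(E_{u+1})^{1/2})`. (If `μ(Q_u) = 0`, then both coefficients
are zero, in accordance with the convention `h^Q_u = 0`.) -/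
def HaarSystem.haar (H : HaarSystem ρ μ) (i : H.Index) (x : X) : ℝ :=
  (H.head i).indicator (fun _ => √(μ.real (H.tail i.1 i.2.1 (i.2.2 + 1))) /
      (√(μ.real (H.head i)) * √(μ.real (H.tail i.1 i.2.1 i.2.2)))) x
    - (H.tail i.1 i.2.1 (i.2.2 + 1)).indicator (fun _ => √(μ.real (H.head i)) /
      (√(μ.real (H.tail i.1 i.2.1 i.2.2)) * √(μ.real (H.tail i.1 i.2.1 (i.2.2 + 1))))) x

/-- The normalized characteristic function `χ_Q μ(Q)^{-1/2}` of the cube of a Haar function. -/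
def HaarSystem.normChar (H : HaarSystem ρ μ) (i : H.Index) (x : X) : ℝ≥0∞ :=
  (H.cube i).indicator (fun _ => μ (H.cube i) ^ (-(1 / 2) : ℝ)) x

lemma HaarSystem.measurableSet_child (H : HaarSystem ρ μ) (k : ℤ) (Q : H.cubes k)
    (j : Fin (H.numChildren k Q)) : MeasurableSet (H.child k Q j : Set X) :=
  H.measurableSet_cube (k + 1) _ (H.child k Q j).2.1

lemma HaarSystem.measurable_haar (H : HaarSystem ρ μ) (i : H.Index) : Measurable (H.haar i) := by
  refine (measurable_const.indicator (H.measurableSet_child _ _ _)).sub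
    (measurable_const.indicator ?_)
  exact MeasurableSet.iUnion fun j => MeasurableSet.iUnion fun _ => H.measurableSet_child _ _ j

lemma HaarSystem.exists_bound_haar (H : HaarSystem ρ μ) (i : H.Index) :
    ∃ B : ℝ, ∀ x, ‖H.haar i x‖ ≤ B := by
  refine ⟨_, fun x => (norm_sub_le _ _).trans
    (add_le_add (norm_indicator_le_norm_self _ _) (norm_indicator_le_norm_self _ _))⟩

end Haar

/-! ### The dyadic product Hardy space and the dyadic product BMO space -/

section Product

variable {𝕜 : Type*} [RCLike 𝕜] {X₁ X₂ : Type*} [MeasurableSpace X₁] [MeasurableSpace X₂]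
  {ρ₁ : X₁ → X₁ → ℝ} {ρ₂ : X₂ → X₂ → ℝ} {μ₁ : Measure X₁} {μ₂ : Measure X₂}

/-- The Haar coefficient `⟨f, h_{Q_1}^{u_1} h_{Q_2}^{u_2}⟩`. -/
def haarCoeff (H₁ : HaarSystem ρ₁ μ₁) (H₂ : HaarSystem ρ₂ μ₂) (f : X₁ × X₂ → 𝕜)
    (i : H₁.Index × H₂.Index) : 𝕜 :=
  ∫ x, (H₁.haar i.1 x.1 * H₂.haar i.2 x.2) • f x ∂(μ₁.prod μ₂)

/-- The dyadic square function `S_{d,d}(f)`. -/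
def squareFn (H₁ : HaarSystem ρ₁ μ₁) (H₂ : HaarSystem ρ₂ μ₂) (f : X₁ × X₂ → 𝕜)
    (x : X₁ × X₂) : ℝ≥0∞ :=
  (∑' i : H₁.Index × H₂.Index,
    (‖haarCoeff H₁ H₂ f i‖ₑ * H₁.normChar i.1 x.1 * H₂.normChar i.2 x.2) ^ 2) ^ (1 / 2 : ℝ)

/-- The norm `‖f‖_{H¹_{d,d}} = ‖S_{d,d}(f)‖_{L¹}`. -/
def h1Norm (H₁ : HaarSystem ρ₁ μ₁) (H₂ : HaarSystem ρ₂ μ₂) (f : X₁ × X₂ → 𝕜) : ℝ≥0∞ :=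
  ∫⁻ x, squareFn H₁ H₂ f x ∂(μ₁.prod μ₂)

/-- The functional `𝒞₁ᵈ(φ)`, the supremum being over all open sets of finite measure. -/
def bmoNorm [TopologicalSpace X₁] [TopologicalSpace X₂]
    (H₁ : HaarSystem ρ₁ μ₁) (H₂ : HaarSystem ρ₂ μ₂) (φ : X₁ × X₂ → 𝕜) : ℝ≥0∞ :=
  ⨆ (Ω : Set (X₁ × X₂)) (_ : IsOpen Ω) (_ : μ₁.prod μ₂ Ω < ∞),
    ((μ₁.prod μ₂ Ω)⁻¹ * ∑' i : {i : H₁.Index × H₂.Index // H₁.cube i.1 ×ˢ H₂.cube i.2 ⊆ Ω},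
      ‖haarCoeff H₁ H₂ φ i‖ₑ ^ 2) ^ (1 / 2 : ℝ)

/-- `φ ∈ BMO_{d,d}(X₁ × X₂)`: the function `φ` is locally integrable, that is, integrable on
products of balls, and `𝒞₁ᵈ(φ)` is finite. -/
structure IsBMO [TopologicalSpace X₁] [TopologicalSpace X₂]
    (H₁ : HaarSystem ρ₁ μ₁) (H₂ : HaarSystem ρ₂ μ₂) (φ : X₁ × X₂ → 𝕜) : Prop where
  locallyIntegrable : ∀ (x₁ : X₁) (r₁ : ℝ) (x₂ : X₂) (r₂ : ℝ),
    IntegrableOn φ (qball ρ₁ x₁ r₁ ×ˢ qball ρ₂ x₂ r₂) (μ₁.prod μ₂)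
  bmoNorm_lt_top : bmoNorm H₁ H₂ φ < ∞

section aux

variable (H₁ : HaarSystem ρ₁ μ₁) (H₂ : HaarSystem ρ₂ μ₂)

lemma integrable_haar_smul {f : X₁ × X₂ → 𝕜} (hf : Integrable f (μ₁.prod μ₂))
    (i : H₁.Index × H₂.Index) :
    Integrable (fun x => (H₁.haar i.1 x.1 * H₂.haar i.2 x.2) • f x) (μ₁.prod μ₂) := by
  obtain ⟨B₁, hB₁⟩ := H₁.exists_bound_haar i.1
  obtain ⟨B₂, hB₂⟩ := H₂.exists_bound_haar i.2
  have hm : Measurable fun x : X₁ × X₂ => H₁.haar i.1 x.1 * H₂.haar i.2 x.2 :=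
    ((H₁.measurable_haar i.1).comp measurable_fst).mul
      ((H₂.measurable_haar i.2).comp measurable_snd)
  refine hf.bdd_smul (B₁ * B₂) hm.aestronglyMeasurable
    (Filter.Eventually.of_forall fun x => ?_)
  rw [norm_mul]
  exact mul_le_mul (hB₁ _) (hB₂ _) (norm_nonneg _) ((norm_nonneg _).trans (hB₁ x.1))

lemma haarCoeff_add {f g : X₁ × X₂ → 𝕜} (hf : Integrable f (μ₁.prod μ₂))
    (hg : Integrable g (μ₁.prod μ₂)) (i : H₁.Index × H₂.Index) :
    haarCoeff H₁ H₂ (f + g) i = haarCoeff H₁ H₂ f i + haarCoeff H₁ H₂ g i := by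
  simp only [haarCoeff, Pi.add_apply, smul_add]
  exact integral_add (integrable_haar_smul H₁ H₂ hf i) (integrable_haar_smul H₁ H₂ hg i)

lemma haarCoeff_smul (c : 𝕜) (f : X₁ × X₂ → 𝕜) (i : H₁.Index × H₂.Index) :
    haarCoeff H₁ H₂ (c • f) i = c * haarCoeff H₁ H₂ f i := by
  simp only [haarCoeff, Pi.smul_apply, smul_comm _ c]
  rw [integral_smul, smul_eq_mul]

lemma countable_index {X : Type*} [MeasurableSpace X] {ρ : X → X → ℝ} {μ : Measure X}
    (H : HaarSystem ρ μ) : Countable H.Index := by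
  have : ∀ k, Countable (H.cubes k) := fun k => (H.countable_cubes k).to_subtype
  infer_instance

lemma measurable_normChar {X : Type*} [MeasurableSpace X] {ρ : X → X → ℝ} {μ : Measure X}
    (H : HaarSystem ρ μ) (i : H.Index) : Measurable (H.normChar i) :=
  measurable_const.indicator (H.measurableSet_cube i.1 _ i.2.1.2)

lemma measurable_squareFn (f : X₁ × X₂ → 𝕜) : Measurable (squareFn H₁ H₂ f) := by
  have := countable_index H₁
  have := countable_index H₂
  refine (Measurable.tsum fun i => ?_).pow_const _
  exact ((measurable_const.mul ((measurable_normChar H₁ i.1).comp measurable_fst)).mul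
    ((measurable_normChar H₂ i.2).comp measurable_snd)).pow_const 2

lemma squareFn_add_le {f g : X₁ × X₂ → 𝕜} (hf : Integrable f (μ₁.prod μ₂))
    (hg : Integrable g (μ₁.prod μ₂)) (x : X₁ × X₂) :
    squareFn H₁ H₂ (f + g) x ≤
      (2 : ℝ≥0∞) ^ (1 / 2 : ℝ) * (squareFn H₁ H₂ f x + squareFn H₁ H₂ g x) := by
  have key : ∀ a b : ℝ≥0∞, (a + b) ^ 2 ≤ 2 * (a ^ 2 + b ^ 2) := by
    intro a b
    have := ENNReal.rpow_add_le_mul_rpow_add_rpow a b (p := 2) (by norm_num)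
    norm_num at this
    exact this
  refine le_trans ?_ (mul_le_mul_right (ENNReal.rpow_add_le_add_rpow _ _ (by norm_num)
    (by norm_num)) _)
  rw [← ENNReal.mul_rpow_of_nonneg _ _ (by norm_num : (0 : ℝ) ≤ 1 / 2)]
  refine ENNReal.rpow_le_rpow ?_ (by norm_num)
  rw [← ENNReal.tsum_add, ← ENNReal.tsum_mul_left]
  refine ENNReal.tsum_le_tsum fun i => le_trans ?_ (key _ _)
  gcongr
  rw [haarCoeff_add H₁ H₂ hf hg, ← add_mul, ← add_mul]
  gcongr
  exact enorm_add_le _ _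

lemma squareFn_smul (c : 𝕜) (f : X₁ × X₂ → 𝕜) (x : X₁ × X₂) :
    squareFn H₁ H₂ (c • f) x = ‖c‖ₑ * squareFn H₁ H₂ f x := by
  have h : ∀ i : H₁.Index × H₂.Index,
      (‖haarCoeff H₁ H₂ (c • f) i‖ₑ * H₁.normChar i.1 x.1 * H₂.normChar i.2 x.2) ^ 2 =
      ‖c‖ₑ ^ 2 *
        (‖haarCoeff H₁ H₂ f i‖ₑ * H₁.normChar i.1 x.1 * H₂.normChar i.2 x.2) ^ 2 := by
    intro i
    rw [haarCoeff_smul, enorm_mul]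
    ring
  simp only [squareFn, h]
  rw [ENNReal.tsum_mul_left, ENNReal.mul_rpow_of_nonneg _ _ (by norm_num : (0 : ℝ) ≤ 1 / 2),
    ← ENNReal.rpow_natCast, ← ENNReal.rpow_mul]
  norm_num

end aux

/-- The dyadic product Hardy space `H¹_{d,d}(X₁ × X₂) = {f ∈ L¹ : S_{d,d}(f) ∈ L¹}`, as a space
of functions (not of equivalence classes) with the seminorm `h1Norm`. -/
def hardySpace (𝕜 : Type*) [RCLike 𝕜] (H₁ : HaarSystem ρ₁ μ₁) (H₂ : HaarSystem ρ₂ μ₂) :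
    Submodule 𝕜 (X₁ × X₂ → 𝕜) where
  carrier := {f | Integrable f (μ₁.prod μ₂) ∧ h1Norm H₁ H₂ f < ∞}
  zero_mem' := by
    refine ⟨integrable_zero _ _ _, ?_⟩
    have h : ∀ x, squareFn H₁ H₂ (0 : X₁ × X₂ → 𝕜) x = 0 := fun x => by
      have := squareFn_smul H₁ H₂ (0 : 𝕜) 0 x
      simpa using this
    simp [h1Norm, h]
  add_mem' := by
    rintro f g ⟨hf, hf'⟩ ⟨hg, hg'⟩
    refine ⟨hf.add hg, ?_⟩
    calc h1Norm H₁ H₂ (f + g)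
        ≤ ∫⁻ x, (2 : ℝ≥0∞) ^ (1 / 2 : ℝ) * (squareFn H₁ H₂ f x + squareFn H₁ H₂ g x)
            ∂(μ₁.prod μ₂) := lintegral_mono (squareFn_add_le H₁ H₂ hf hg)
      _ = (2 : ℝ≥0∞) ^ (1 / 2 : ℝ) * (h1Norm H₁ H₂ f + h1Norm H₁ H₂ g) := by
          have hm : Measurable fun x => squareFn H₁ H₂ f x + squareFn H₁ H₂ g x :=
            (measurable_squareFn H₁ H₂ f).add (measurable_squareFn H₁ H₂ g)
          rw [lintegral_const_mul _ hm, lintegral_add_left (measurable_squareFn H₁ H₂ f),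
            h1Norm, h1Norm]
      _ < ∞ := ENNReal.mul_lt_top (ENNReal.rpow_lt_top_of_nonneg (by norm_num) (by norm_num))
          (ENNReal.add_lt_top.2 ⟨hf', hg'⟩)
  smul_mem' := by
    rintro c f ⟨hf, hf'⟩
    refine ⟨hf.smul c, ?_⟩
    have : h1Norm H₁ H₂ (c • f) = ‖c‖ₑ * h1Norm H₁ H₂ f := by
      simp only [h1Norm, squareFn_smul]
      rw [lintegral_const_mul _ (measurable_squareFn H₁ H₂ f)]
    rw [this]
    exact ENNReal.mul_lt_top enorm_lt_top hf'

/-- The space `L²(X₁ × X₂)`, as a space of functions. -/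
def squareIntegrable (𝕜 : Type*) [RCLike 𝕜] (μ₁ : Measure X₁) (μ₂ : Measure X₂) :
    Submodule 𝕜 (X₁ × X₂ → 𝕜) where
  carrier := {f | MemLp f 2 (μ₁.prod μ₂)}
  zero_mem' := MemLp.zero
  add_mem' := MemLp.add
  smul_mem' c _ hf := MemLp.const_smul hf c

/-- The pairing `⟨φ, f⟩ = ∑ ⟨φ, h_{Q_1}^{u_1} h_{Q_2}^{u_2}⟩ ⟨f, h_{Q_1}^{u_1} h_{Q_2}^{u_2}⟩`,
through which `∫ φ f` is understood for those `f ∈ H¹_{d,d} ∩ L²` for which `φ f` fails to be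
integrable. -/
def haarPairing (H₁ : HaarSystem ρ₁ μ₁) (H₂ : HaarSystem ρ₂ μ₂) (φ f : X₁ × X₂ → 𝕜) : 𝕜 :=
  ∑' i : H₁.Index × H₂.Index, haarCoeff H₁ H₂ φ i * haarCoeff H₁ H₂ f i

/-- Conditions on `φ ∈ BMO_{d,d}` and `f ∈ H¹_{d,d} ∩ L²` under which the pairing is given by the
absolutely convergent integral `∫ φ f`: either `φ ∈ L²`, or `f` is bounded with bounded support;
moreover, in a variable in which the space has finite measure, `f` has integral zero. -/
structure IsAdmissiblePair (ρ₁ : X₁ → X₁ → ℝ) (ρ₂ : X₂ → X₂ → ℝ) (μ₁ : Measure X₁)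
    (μ₂ : Measure X₂) (φ f : X₁ × X₂ → 𝕜) : Prop where
  regular : MemLp φ 2 (μ₁.prod μ₂) ∨
    (MemLp f ∞ (μ₁.prod μ₂) ∧ ∃ (x₁ : X₁) (r₁ : ℝ) (x₂ : X₂) (r₂ : ℝ),
      ∀ᵐ x ∂(μ₁.prod μ₂), x ∉ qball ρ₁ x₁ r₁ ×ˢ qball ρ₂ x₂ r₂ → f x = 0)
  cancel₁ : μ₁ univ < ∞ → ∀ᵐ x₂ ∂μ₂, ∫ x₁, f (x₁, x₂) ∂μ₁ = 0
  cancel₂ : μ₂ univ < ∞ → ∀ᵐ x₁ ∂μ₁, ∫ x₂, f (x₁, x₂) ∂μ₂ = 0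

end Product

end ProductDyadic

end

open ProductDyadic

/-!
The sets `rect i = Q₁ × Q₂` are indexed by pairs of Haar labels, and `h_i` denotes the product Haar
function of the label `i`. The duality rests on one inequality, `tsum_mul_le_of_carleson`: if the
sequence `a` satisfies the Carleson condition `∑_{rect i ⊆ Ω} a_i² ≤ B² μ(Ω)` for all sets `Ω` of
finite measure, and `b` has the square function `S`, then `∑ a_i b_i ≤ 96 B ∫ S`. Each rectangle is
assigned to the last level set `{S > 2 ^ k}` by which it is filled by more than one half. The
rectangles of one class lie in an enlargement of the level set of measure at most `16 μ{S > 2 ^ k}`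
(two applications of the dyadic weak type inequality, `measure_rectEnlargement_le`), at least half
of each lies outside `{S > 2 ^ (k + 1)}`, and the Cauchy–Schwarz inequality bounds the sum over the
class by a multiple of `2 ^ k μ{S > 2 ^ k}`.

Since the product measure is outer regular, the Carleson condition for open sets is the one for all
sets (`IsBMO.carleson`). Hence the pairing with `φ ∈ BMO` converges absolutely on the whole Hardy
space and is bounded there by `96 𝒞₁ᵈ(φ)`, without recourse to an extension from
`L²` (`IsBMO.exists_functional`). Finite Haar sums are dense by dominated convergence
(`tendsto_h1Norm_sub_haarSum`), and they are admissible for every `φ`; this yields the uniqueness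
statements (`eq_zero_of_haarSum`).

The same inequality, tested with the signum of a Haar sum, whose coefficients satisfy the Carleson
condition by Bessel's inequality, bounds the `L¹` norm of the sum by its square function
(`lintegral_haarSum_le`). So the Haar series of `f ∈ H¹` converges in `L¹`. Its sum has the
coefficients of `f`, and its integral in each variable is zero; as an integrable function with
vanishing coefficients is zero, up to cancellation in the variables in which the space has finite
measure (`ae_eq_zero_of_haarCoeff_eq_zero`), the sum is `f` (`hasSum_haar`). For `φ ∈ L²`, the
identity `⟨φ, f⟩ = ∫ φ f` then follows from convergence in `L²`. For bounded `f` with bounded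
support it is obtained along the partial sums up to generation `n`, which are averages of `f` over
rectangles and therefore have the same bound and a common bounded support, by dominated convergence
(`haarPairing_eq_integral_of_bounded`).

For the converse, let `c_i = ℓ(h_i)`. Testing `ℓ` on the sums `∑ c̄_i h_i` over rectangles in `Ω`
shows that `c` satisfies the Carleson condition with constant `‖ℓ‖` (`carleson_of_functional`). A
locally integrable function with these coefficients is constructed on each member of an exhaustion
by products of cubes, as a Haar series in which each factor is shifted so as to vanish near a base
point (`exists_haarCoeff_eq`); the shifts do not affect the coefficients, and at each stage all but
finitely many of them are zero.
-/

namespace ProductDyadic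

open Filter Topology

/-! ### Systems of dyadic cubes -/

section Cubes

variable {X : Type*} [MeasurableSpace X] {ρ : X → X → ℝ} {μ : Measure X}

lemma DyadicSystem.exists_cube (D : DyadicSystem ρ) (k : ℤ) (x : X) : ∃ Q ∈ D.cubes k, x ∈ Q :=
  mem_sUnion.1 (D.sUnion_cubes k ▸ mem_univ x)

/-- What the analysis needs to know about a system of cubes: cubes have positive finite measure,
they generate the σ-algebra, and they lie under an increasing sequence `T n` of cubes of
generation `-n` around a point `x₀`, whose members are the bounded sets up to inclusion. -/
structure HaarSystem.Regular (H : HaarSystem ρ μ) (T : ℕ → Set X) (x₀ : X) : Prop where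
  measure_pos : ∀ k, ∀ Q ∈ H.cubes k, 0 < μ Q
  measure_lt_top : ∀ k, ∀ Q ∈ H.cubes k, μ Q < ∞
  generateFrom : ‹MeasurableSpace X› = MeasurableSpace.generateFrom {Q | ∃ k, Q ∈ H.cubes k}
  tower_mem : ∀ n : ℕ, T n ∈ H.cubes (-n)
  mem_tower : ∀ n, x₀ ∈ T n
  monotone_tower : Monotone T
  exists_subset_tower : ∀ (x : X) (r : ℝ), ∃ n, qball ρ x r ⊆ T n
  exists_cube_subset_tower : ∀ k, ∀ Q ∈ H.cubes k, ∃ n, Q ⊆ T n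
  tower_subset : ∀ n, ∃ (x : X) (r : ℝ), T n ⊆ qball ρ x r

lemma HaarSystem.Regular.measurableSet_tower {H : HaarSystem ρ μ} {T : ℕ → Set X} {x₀ : X}
    (hH : H.Regular T x₀) (n : ℕ) : MeasurableSet (T n) :=
  H.measurableSet_cube _ _ (hH.tower_mem n)

lemma HaarSystem.Regular.iUnion_tower {H : HaarSystem ρ μ} {T : ℕ → Set X} {x₀ : X}
    (hH : H.Regular T x₀) : ⋃ n, T n = univ := by
  refine eq_univ_of_forall fun x => mem_iUnion.2 ?_
  obtain ⟨Q, hQ, hx⟩ := H.exists_cube 0 x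
  obtain ⟨n, hn⟩ := hH.exists_cube_subset_tower 0 Q hQ
  exact ⟨n, hn hx⟩

lemma HaarSystem.Regular.sigmaFinite {H : HaarSystem ρ μ} {T : ℕ → Set X} {x₀ : X}
    (hH : H.Regular T x₀) : SigmaFinite μ :=
  ⟨⟨{ set := T
      set_mem := fun _ => trivial
      finite := fun n => hH.measure_lt_top _ _ (hH.tower_mem n)
      spanning := hH.iUnion_tower }⟩⟩

end Cubes

/-! ### Topology and measure of a space of homogeneous type -/

section Geometry

variable {X : Type*} {ρ : X → X → ℝ}

lemma IsQuasiMetric.mem_comap_nhds_zero {A₀ : ℝ} (hρ : IsQuasiMetric ρ A₀) {r : Set (X × X)} :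
    r ∈ comap (fun p : X × X => ρ p.1 p.2) (𝓝 0) ↔
      ∃ ε : ℝ, 0 < ε ∧ ∀ x y, ρ x y < ε → (x, y) ∈ r := by
  rw [((Metric.nhds_basis_ball (x := (0 : ℝ))).comap fun p : X × X => ρ p.1 p.2).mem_iff]
  refine exists_congr fun ε => and_congr_right fun _ => ⟨fun h x y hxy => h ?_, ?_⟩
  · simpa [abs_of_nonneg (hρ.nonneg x y)] using hxy
  · rintro h ⟨x, y⟩ hxy
    exact h x y (by simpa [abs_of_nonneg (hρ.nonneg x y)] using hxy)

/-- The uniform structure of a quasi-metric. -/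
def IsQuasiMetric.uniformCore {A₀ : ℝ} (hρ : IsQuasiMetric ρ A₀) : UniformSpace.Core X := by
  refine UniformSpace.Core.mk' (comap (fun p : X × X => ρ p.1 p.2) (𝓝 0)) ?_ ?_ ?_
  · intro r hr x
    obtain ⟨ε, hε, h⟩ := hρ.mem_comap_nhds_zero.1 hr
    exact h x x (by rwa [(hρ.eq_zero_iff x x).2 rfl])
  · intro r hr
    obtain ⟨ε, hε, h⟩ := hρ.mem_comap_nhds_zero.1 hr
    exact hρ.mem_comap_nhds_zero.2 ⟨ε, hε, fun x y hxy => h y x (by rwa [hρ.symm])⟩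
  · intro r hr
    obtain ⟨ε, hε, h⟩ := hρ.mem_comap_nhds_zero.1 hr
    have hA : 0 < A₀ := lt_of_lt_of_le one_pos hρ.one_le
    refine ⟨{p | ρ p.1 p.2 < ε / (2 * A₀)}, hρ.mem_comap_nhds_zero.2
      ⟨ε / (2 * A₀), by positivity, fun x y hxy => hxy⟩, ?_⟩
    rintro ⟨x, y⟩ ⟨z, hxz, hzy⟩
    refine h x y ?_
    have h1 : ρ x z < ε / (2 * A₀) := hxz
    have h2 : ρ z y < ε / (2 * A₀) := hzy
    calc ρ x y ≤ A₀ * (ρ x z + ρ z y) := hρ.quasi_triangle x y z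
      _ < A₀ * (ε / (2 * A₀) + ε / (2 * A₀)) := by gcongr
      _ = ε := by field_simp; norm_num

variable [TopologicalSpace X] [MeasurableSpace X] {μ : Measure X}

/-- The topology is induced by the uniform structure of the quasi-metric. Since this uniform
structure is countably generated, the space is pseudometrizable, although balls of the quasi-metric
need not be open. -/
lemma IsHomogeneousType.exists_uniformSpace (hX : IsHomogeneousType ρ μ) :
    ∃ u : UniformSpace X, u.toTopologicalSpace = ‹TopologicalSpace X› ∧
      uniformity X = comap (fun p : X × X => ρ p.1 p.2) (𝓝 0) := by
  obtain ⟨A₀, hρ⟩ := hX.quasiMetric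
  refine ⟨UniformSpace.ofCore hρ.uniformCore, ?_, rfl⟩
  let u := UniformSpace.ofCore hρ.uniformCore
  refine TopologicalSpace.ext_iff.2 fun s => ?_
  rw [hX.isOpen_iff, isOpen_uniformity]
  refine forall₂_congr fun x hx => ?_
  refine hρ.mem_comap_nhds_zero.trans (exists_congr fun ε => and_congr_right fun _ => ?_)
  exact ⟨fun h y hy => h x y hy rfl, fun h x' y hy hx' => h (by subst hx'; exact hy)⟩

lemma IsHomogeneousType.mem_nhds_iff (hX : IsHomogeneousType ρ μ) {x : X} {s : Set X} :
    s ∈ 𝓝 x ↔ ∃ ε : ℝ, 0 < ε ∧ qball ρ x ε ⊆ s := by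
  obtain ⟨A₀, hρ⟩ := hX.quasiMetric
  obtain ⟨u, hu, hu'⟩ := hX.exists_uniformSpace
  subst hu
  rw [nhds_eq_comap_uniformity, mem_comap_prodMk, hu', hρ.mem_comap_nhds_zero]
  refine exists_congr fun ε => and_congr_right fun _ => ?_
  exact ⟨fun h y hy => h x y hy rfl, fun h x' y hy hx' => h (by subst hx'; exact hy)⟩

lemma IsHomogeneousType.pseudoMetrizableSpace (hX : IsHomogeneousType ρ μ) :
    TopologicalSpace.PseudoMetrizableSpace X := by
  obtain ⟨u, hu, hu'⟩ := hX.exists_uniformSpace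
  subst hu
  have : IsCountablyGenerated (uniformity X) := hu' ▸ inferInstance
  infer_instance

/-- By the doubling condition, a null ball would force the measure to vanish. -/
lemma IsHomogeneousType.measure_qball_pos (hX : IsHomogeneousType ρ μ) (x : X) {r : ℝ}
    (hr : 0 < r) : 0 < μ (qball ρ x r) := by
  obtain ⟨K, hK⟩ := hX.doubling
  rw [pos_iff_ne_zero]
  intro h0
  have h : ∀ n : ℕ, μ (qball ρ x (2 ^ n * r)) = 0 := by
    intro n
    induction n with
    | zero => simpa using h0
    | succ n ih =>
      have := (hK x (2 ^ n * r) (by positivity)).1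
      rw [ih, mul_zero, ← mul_assoc, ← pow_succ'] at this
      exact le_antisymm this zero_le
  refine hX.ne_zero (Measure.measure_univ_eq_zero.1 ?_)
  have hU : (univ : Set X) = ⋃ n : ℕ, qball ρ x (2 ^ n * r) := by
    refine (eq_univ_of_forall fun y => mem_iUnion.2 ?_).symm
    obtain ⟨n, hn⟩ := pow_unbounded_of_one_lt (ρ x y / r) (one_lt_two)
    exact ⟨n, (div_lt_iff₀ hr).1 hn⟩
  rw [hU]
  exact measure_iUnion_null h

lemma IsHomogeneousType.measure_qball_lt_top (hX : IsHomogeneousType ρ μ) (x : X) (r : ℝ) :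
    μ (qball ρ x r) < ∞ := by
  obtain ⟨K, hK⟩ := hX.doubling
  obtain ⟨A₀, hρ⟩ := hX.quasiMetric
  refine (measure_mono ?_).trans_lt (hK x (max r 1) (by positivity)).2
  exact fun y (hy : ρ x y < r) => lt_of_lt_of_le hy (le_max_left _ _)

lemma IsHomogeneousType.isLocallyFiniteMeasure (hX : IsHomogeneousType ρ μ) :
    IsLocallyFiniteMeasure μ :=
  ⟨fun x => ⟨qball ρ x 1, hX.mem_nhds_iff.2 ⟨1, one_pos, subset_rfl⟩,
    hX.measure_qball_lt_top x 1⟩⟩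

lemma IsHomogeneousType.exists_qball_subset (hX : IsHomogeneousType ρ μ) (x x₀ : X) (r : ℝ) :
    ∃ r', qball ρ x r ⊆ qball ρ x₀ r' := by
  obtain ⟨A₀, hρ⟩ := hX.quasiMetric
  refine ⟨A₀ * (ρ x₀ x + r), fun y hy => (hρ.quasi_triangle x₀ y x).trans_lt ?_⟩
  have : ρ x y < r := hy
  have hA : 0 < A₀ := lt_of_lt_of_le one_pos hρ.one_le
  gcongr

lemma DyadicSystem.center_mem (hX : IsHomogeneousType ρ μ) (D : DyadicSystem ρ) {k : ℤ}
    {Q : Set X} (hQ : Q ∈ D.cubes k) : D.center k Q ∈ Q := by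
  obtain ⟨A₀, hρ⟩ := hX.quasiMetric
  refine D.ball_subset k Q hQ ?_
  have := D.c_pos
  have := D.δ_pos
  change ρ _ _ < _
  rw [(hρ.eq_zero_iff _ _).2 rfl]
  positivity

/-- Cubes of late generations are small. -/
lemma IsHomogeneousType.exists_cube_subset_qball (hX : IsHomogeneousType ρ μ)
    (D : DyadicSystem ρ) {ε : ℝ} (hε : 0 < ε) :
    ∃ k : ℤ, ∀ Q ∈ D.cubes k, ∀ x ∈ Q, Q ⊆ qball ρ x ε := by
  obtain ⟨A₀, hρ⟩ := hX.quasiMetric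
  have hA : 0 < A₀ := lt_of_lt_of_le one_pos hρ.one_le
  have hC : 0 < D.C := D.c_pos.trans_le D.c_le_C
  obtain ⟨n, hn⟩ := exists_pow_lt_of_lt_one (show 0 < ε / (2 * A₀ * D.C) by positivity) D.δ_lt_one
  refine ⟨n, fun Q hQ x hx y hy => ?_⟩
  have h1 : ρ x (D.center n Q) < D.C * D.δ ^ (n : ℤ) := by
    rw [hρ.symm]; exact D.subset_ball n Q hQ hx
  have h2 : ρ (D.center n Q) y < D.C * D.δ ^ (n : ℤ) := D.subset_ball n Q hQ hy
  rw [zpow_natCast] at h1 h2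
  calc ρ x y ≤ A₀ * (ρ x (D.center n Q) + ρ (D.center n Q) y) := hρ.quasi_triangle _ _ _
    _ < A₀ * (D.C * D.δ ^ n + D.C * D.δ ^ n) := by gcongr
    _ = (2 * A₀ * D.C) * D.δ ^ n := by ring
    _ < (2 * A₀ * D.C) * (ε / (2 * A₀ * D.C)) := by gcongr
    _ = ε := by field_simp

/-- The centers of the cubes form a countable dense set. -/
lemma IsHomogeneousType.secondCountableTopology (hX : IsHomogeneousType ρ μ)
    (D : DyadicSystem ρ) : SecondCountableTopology X := by
  have hs : TopologicalSpace.SeparableSpace X := by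
    refine ⟨⋃ k : ℤ, D.center k '' D.cubes k,
      countable_iUnion fun k => (D.countable_cubes k).image _, fun x => ?_⟩
    rw [mem_closure_iff_nhds]
    intro t ht
    obtain ⟨ε, hε, h⟩ := hX.mem_nhds_iff.1 ht
    obtain ⟨k, hk⟩ := hX.exists_cube_subset_qball D hε
    obtain ⟨Q, hQ, hx⟩ := D.exists_cube k x
    exact ⟨D.center k Q, h (hk Q hQ x hx (D.center_mem hX hQ)),
      mem_iUnion.2 ⟨k, mem_image_of_mem _ hQ⟩⟩
  obtain ⟨u, hu, hu'⟩ := hX.exists_uniformSpace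
  subst hu
  have : IsCountablyGenerated (uniformity X) := hu' ▸ inferInstance
  exact UniformSpace.secondCountable_of_separable X

/-- The tower consists of the cubes of generation `-n` whose center is the distinguished point. -/
lemma IsHomogeneousType.exists_regular (hX : IsHomogeneousType ρ μ) (H : HaarSystem ρ μ) :
    ∃ T x₀, H.Regular T x₀ := by
  obtain ⟨A₀, hρ⟩ := hX.quasiMetric
  have hA : 0 < A₀ := lt_of_lt_of_le one_pos hρ.one_le
  have hc := H.c_pos
  have hδ := H.δ_pos
  obtain ⟨x₀, hx₀⟩ := H.distinguished
  choose P hP hPx using hx₀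
  have hmem : ∀ n : ℕ, x₀ ∈ P (-n) := fun n => by
    rw [← hPx (-n)]; exact H.center_mem hX (hP _)
  have hexh : ∀ (x : X) (r : ℝ), ∃ n : ℕ, qball ρ x r ⊆ P (-n) := by
    intro x r
    obtain ⟨r', hr'⟩ := hX.exists_qball_subset x x₀ r
    obtain ⟨n, hn⟩ := pow_unbounded_of_one_lt (r' / H.c) ((one_lt_inv₀ hδ).2 H.δ_lt_one)
    refine ⟨n, hr'.trans (Subset.trans (fun y hy => ?_) (H.ball_subset _ _ (hP (-n))))⟩
    rw [hPx]
    refine lt_of_lt_of_le (show ρ x₀ y < r' from hy) ?_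
    rw [zpow_neg, zpow_natCast, ← inv_pow]
    exact ((div_lt_iff₀' hc).1 hn).le
  have hball : ∀ k, ∀ Q ∈ H.cubes k, Q ⊆ qball ρ (H.center k Q) (H.C * H.δ ^ k) := H.subset_ball
  refine ⟨fun n => P (-n), x₀, ?_, ?_, ?_, fun n => hP _, hmem, ?_, hexh, ?_, ?_⟩
  · exact fun k Q hQ => (hX.measure_qball_pos _ (by positivity)).trans_le
      (measure_mono (H.ball_subset k Q hQ))
  · exact fun k Q hQ => (measure_mono (hball k Q hQ)).trans_lt (hX.measure_qball_lt_top _ _)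
  · refine le_antisymm ?_ ?_
    · refine hX.borel.measurable_eq.le.trans ?_
      refine MeasurableSpace.generateFrom_le fun U hU => ?_
      -- An open set is the union of the countably many cubes it contains
      have hUeq : U = ⋃ k : ℤ, ⋃₀ {Q | Q ∈ H.cubes k ∧ Q ⊆ U} := by
        refine Subset.antisymm (fun x hx => ?_)
          (iUnion_subset fun k => sUnion_subset fun Q hQ => hQ.2)
        obtain ⟨ε, hε, h⟩ := (hX.isOpen_iff U).1 hU x hx
        obtain ⟨k, hk⟩ := hX.exists_cube_subset_qball H.toDyadicSystem hε
        obtain ⟨Q, hQ, hxQ⟩ := H.exists_cube k x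
        exact mem_iUnion.2 ⟨k, mem_sUnion.2 ⟨Q, ⟨hQ, (hk Q hQ x hxQ).trans h⟩, hxQ⟩⟩
      rw [hUeq]
      refine MeasurableSet.iUnion fun k => MeasurableSet.sUnion
        ((H.countable_cubes k).mono fun Q hQ => hQ.1) fun Q hQ => ?_
      exact MeasurableSpace.measurableSet_generateFrom ⟨k, hQ.1⟩
    · exact MeasurableSpace.generateFrom_le fun Q ⟨k, hQ⟩ => H.measurableSet_cube k Q hQ
  · refine monotone_nat_of_le_succ fun n => ?_
    refine (H.nested (-((n + 1 : ℕ) : ℤ)) (-n) (by push_cast; omega) _ (hP _) _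
      (hP _)).resolve_right fun h => ?_
    exact disjoint_left.1 h (hmem (n + 1)) (hmem n)
  · intro k Q hQ
    obtain ⟨n, hn⟩ := hexh (H.center k Q) (H.C * H.δ ^ k)
    exact ⟨n, (hball k Q hQ).trans hn⟩
  · exact fun n => ⟨_, _, hball _ _ (hP _)⟩

end Geometry

/-- The product measure is outer regular. This allows to pass from the open sets in the
definition of the BMO norm to unions of dyadic rectangles. -/
lemma outerRegular_prod {X₁ X₂ : Type*} [TopologicalSpace X₁] [MeasurableSpace X₁]
    [TopologicalSpace X₂] [MeasurableSpace X₂] {ρ₁ : X₁ → X₁ → ℝ} {ρ₂ : X₂ → X₂ → ℝ}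
    {μ₁ : Measure X₁} {μ₂ : Measure X₂} (h₁ : IsHomogeneousType ρ₁ μ₁)
    (h₂ : IsHomogeneousType ρ₂ μ₂) (D₁ : DyadicSystem ρ₁) (D₂ : DyadicSystem ρ₂)
    [SigmaFinite μ₁] [SigmaFinite μ₂] : (μ₁.prod μ₂).OuterRegular := by
  have := h₁.borel
  have := h₂.borel
  have := h₁.pseudoMetrizableSpace
  have := h₂.pseudoMetrizableSpace
  have := h₁.secondCountableTopology D₁
  have := h₂.secondCountableTopology D₂
  have := h₁.isLocallyFiniteMeasure
  have := h₂.isLocallyFiniteMeasure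
  infer_instance

/-! ### Haar functions on one factor -/

section OneParameter

variable {X : Type*} [MeasurableSpace X] {ρ : X → X → ℝ} {μ : Measure X} {H : HaarSystem ρ μ}

lemma HaarSystem.child_mem (k : ℤ) (Q : H.cubes k) (j : Fin (H.numChildren k Q)) :
    (H.child k Q j : Set X) ∈ H.cubes (k + 1) := (H.child k Q j).2.1

lemma HaarSystem.child_subset (k : ℤ) (Q : H.cubes k) (j : Fin (H.numChildren k Q)) :
    (H.child k Q j : Set X) ⊆ Q := (H.child k Q j).2.2

lemma HaarSystem.disjoint_child (k : ℤ) (Q : H.cubes k) {j j' : Fin (H.numChildren k Q)}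
    (h : j ≠ j') : Disjoint (H.child k Q j : Set X) (H.child k Q j') :=
  H.disjoint_cubes (k + 1) (H.child_mem k Q j) (H.child_mem k Q j') fun he =>
    h ((H.child k Q).injective (Subtype.ext he))

lemma HaarSystem.exists_child_eq {k : ℤ} (Q : H.cubes k) {P : Set X} (hP : P ∈ H.cubes (k + 1))
    (hPQ : P ⊆ Q) : ∃ j, (H.child k Q j : Set X) = P :=
  ⟨(H.child k Q).symm ⟨P, hP, hPQ⟩, by rw [Equiv.apply_symm_apply]⟩

lemma HaarSystem.mem_tail {k : ℤ} {Q : H.cubes k} {u : ℕ} {x : X} :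
    x ∈ H.tail k Q u ↔ ∃ j : Fin (H.numChildren k Q), u ≤ j ∧ x ∈ (H.child k Q j : Set X) := by
  simp [HaarSystem.tail]

lemma HaarSystem.tail_zero (k : ℤ) (Q : H.cubes k) : H.tail k Q 0 = Q := by
  ext x
  rw [H.mem_tail]
  refine ⟨fun ⟨j, _, hx⟩ => H.child_subset k Q j hx, fun hx => ?_⟩
  rw [← H.sUnion_children k Q Q.2] at hx
  obtain ⟨P, ⟨hP, hPQ⟩, hxP⟩ := hx
  obtain ⟨j, rfl⟩ := H.exists_child_eq Q hP hPQ
  exact ⟨j, Nat.zero_le _, hxP⟩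

lemma HaarSystem.measurableSet_tail (k : ℤ) (Q : H.cubes k) (u : ℕ) :
    MeasurableSet (H.tail k Q u) :=
  MeasurableSet.iUnion fun j => MeasurableSet.iUnion fun _ => H.measurableSet_child k Q j

lemma HaarSystem.tail_subset (k : ℤ) (Q : H.cubes k) (u : ℕ) : H.tail k Q u ⊆ Q := by
  intro x hx
  obtain ⟨j, _, hx⟩ := H.mem_tail.1 hx
  exact H.child_subset k Q j hx

lemma HaarSystem.tail_anti (k : ℤ) (Q : H.cubes k) {u v : ℕ} (h : u ≤ v) :
    H.tail k Q v ⊆ H.tail k Q u := by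
  intro x hx
  obtain ⟨j, hj, hx⟩ := H.mem_tail.1 hx
  exact H.mem_tail.2 ⟨j, h.trans hj, hx⟩

lemma HaarSystem.tail_eq (k : ℤ) (Q : H.cubes k) (u : Fin (H.numChildren k Q)) :
    H.tail k Q u = (H.child k Q u : Set X) ∪ H.tail k Q (u + 1) := by
  ext x
  simp only [mem_union, H.mem_tail]
  constructor
  · rintro ⟨j, hj, hx⟩
    rcases hj.eq_or_lt with h | h
    · exact Or.inl (Fin.ext h ▸ hx)
    · exact Or.inr ⟨j, h, hx⟩
  · rintro (hx | ⟨j, hj, hx⟩)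
    · exact ⟨u, le_rfl, hx⟩
    · exact ⟨j, (Nat.le_succ _).trans hj, hx⟩

lemma HaarSystem.disjoint_child_tail (k : ℤ) (Q : H.cubes k) (u : Fin (H.numChildren k Q)) :
    Disjoint (H.child k Q u : Set X) (H.tail k Q (u + 1)) := by
  rw [disjoint_left]
  intro x hx hx'
  obtain ⟨j, hj, hxj⟩ := H.mem_tail.1 hx'
  refine disjoint_left.1 (H.disjoint_child k Q (j := u) (j' := j) ?_) hx hxj
  rintro rfl
  omega

lemma HaarSystem.measurableSet_cube' (i : H.Index) : MeasurableSet (H.cube i) :=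
  H.measurableSet_cube _ _ i.2.1.2

lemma HaarSystem.measurableSet_head (i : H.Index) : MeasurableSet (H.head i) :=
  H.measurableSet_child _ _ _

lemma HaarSystem.head_subset (i : H.Index) : H.head i ⊆ H.cube i := H.child_subset _ _ _

lemma HaarSystem.tail_eq_head_union (i : H.Index) :
    H.tail i.1 i.2.1 i.2.2 = H.head i ∪ H.tail i.1 i.2.1 (i.2.2 + 1) :=
  H.tail_eq i.1 i.2.1 ⟨i.2.2, lt_of_lt_of_le i.2.2.isLt (Nat.sub_le _ _)⟩

lemma HaarSystem.disjoint_head_tail (i : H.Index) :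
    Disjoint (H.head i) (H.tail i.1 i.2.1 (i.2.2 + 1)) :=
  H.disjoint_child_tail i.1 i.2.1 ⟨i.2.2, lt_of_lt_of_le i.2.2.isLt (Nat.sub_le _ _)⟩

/-- A child of a cube of generation `k` contains a cube of a generation `l > k` or is disjoint from
it. -/
lemma HaarSystem.mem_child_iff {k l : ℤ} (h : k < l) (Q : H.cubes k)
    (j : Fin (H.numChildren k Q)) {P : Set X} (hP : P ∈ H.cubes l) {x y : X} (hx : x ∈ P)
    (hy : y ∈ P) : x ∈ (H.child k Q j : Set X) ↔ y ∈ (H.child k Q j : Set X) := by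
  rcases H.nested (k + 1) l h _ (H.child_mem k Q j) P hP with h' | h'
  · exact iff_of_true (h' hx) (h' hy)
  · exact iff_of_false (fun hx' => disjoint_left.1 h' hx' hx) fun hy' => disjoint_left.1 h' hy' hy

/-- A Haar function is constant on the cubes of later generations. -/
lemma HaarSystem.haar_eq_of_mem (i : H.Index) {l : ℤ} (h : i.1 < l) {P : Set X}
    (hP : P ∈ H.cubes l) {x y : X} (hx : x ∈ P) (hy : y ∈ P) : H.haar i x = H.haar i y := by
  have h1 : x ∈ H.head i ↔ y ∈ H.head i := H.mem_child_iff h _ _ hP hx hy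
  have h2 : x ∈ H.tail i.1 i.2.1 (i.2.2 + 1) ↔ y ∈ H.tail i.1 i.2.1 (i.2.2 + 1) := by
    simp only [H.mem_tail, H.mem_child_iff h _ _ hP hx hy]
  unfold HaarSystem.haar
  exact congrArg₂ (· - ·) (indicator_eq_indicator h1 rfl) (indicator_eq_indicator h2 rfl)

lemma HaarSystem.haar_eq_zero (i : H.Index) {x : X} (hx : x ∉ H.cube i) : H.haar i x = 0 := by
  have h1 : x ∉ H.head i := fun h => hx (H.head_subset i h)
  have h2 : x ∉ H.tail i.1 i.2.1 (i.2.2 + 1) := fun h => hx (H.tail_subset _ _ _ h)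
  simp [HaarSystem.haar, h1, h2]

lemma HaarSystem.haar_eq_zero_of_notMem_tail (i : H.Index) {x : X}
    (hx : x ∉ H.tail i.1 i.2.1 i.2.2) : H.haar i x = 0 := by
  rw [H.tail_eq_head_union, mem_union, not_or] at hx
  simp [HaarSystem.haar, hx.1, hx.2]

namespace HaarSystem.Regular

variable {T : ℕ → Set X} {x₀ : X} (hH : H.Regular T x₀)
include hH

lemma measure_ne_top_of_subset {k : ℤ} {Q A : Set X} (hQ : Q ∈ H.cubes k) (hA : A ⊆ Q) :
    μ A ≠ ∞ := ((measure_mono hA).trans_lt (hH.measure_lt_top k Q hQ)).ne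

lemma measureReal_pos {k : ℤ} {Q : Set X} (hQ : Q ∈ H.cubes k) : 0 < μ.real Q :=
  ENNReal.toReal_pos (hH.measure_pos k Q hQ).ne' (hH.measure_lt_top k Q hQ).ne

lemma measureReal_head_pos (i : H.Index) : 0 < μ.real (H.head i) :=
  hH.measureReal_pos (H.child_mem _ _ _)

lemma measureReal_tail_pos (k : ℤ) (Q : H.cubes k) {u : ℕ} (hu : u < H.numChildren k Q) :
    0 < μ.real (H.tail k Q u) := by
  refine (hH.measureReal_pos (H.child_mem k Q ⟨u, hu⟩)).trans_le
    (measureReal_mono (fun x hx => H.mem_tail.2 ⟨_, le_rfl, hx⟩)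
      (hH.measure_ne_top_of_subset Q.2 (H.tail_subset k Q u)))

lemma measureReal_tail_succ_pos (i : H.Index) :
    0 < μ.real (H.tail i.1 i.2.1 (i.2.2 + 1)) :=
  hH.measureReal_tail_pos _ _ (by have := i.2.2.isLt; omega)

lemma measureReal_tail (i : H.Index) : μ.real (H.tail i.1 i.2.1 i.2.2) =
    μ.real (H.head i) + μ.real (H.tail i.1 i.2.1 (i.2.2 + 1)) := by
  rw [H.tail_eq_head_union]
  exact measureReal_union (H.disjoint_head_tail i) (H.measurableSet_tail _ _ _)
    (hH.measure_ne_top_of_subset i.2.1.2 (H.head_subset i))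
    (hH.measure_ne_top_of_subset i.2.1.2 (H.tail_subset _ _ _))

/-- The integral of a function against a Haar function, up to a nonzero factor. -/
lemma integral_haar_smul {E : Type*} [NormedAddCommGroup E] [NormedSpace ℝ E] (i : H.Index)
    {G : X → E} (hG : IntegrableOn G (H.cube i) μ) :
    (√(μ.real (H.head i)) * √(μ.real (H.tail i.1 i.2.1 i.2.2)) *
        √(μ.real (H.tail i.1 i.2.1 (i.2.2 + 1)))) • ∫ x, H.haar i x • G x ∂μ =
      μ.real (H.tail i.1 i.2.1 (i.2.2 + 1)) • (∫ x in H.head i, G x ∂μ) -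
        μ.real (H.head i) • ∫ x in H.tail i.1 i.2.1 (i.2.2 + 1), G x ∂μ := by
  have h1 := hH.measureReal_head_pos i
  have h2 := hH.measureReal_tail_succ_pos i
  have h3 : 0 < μ.real (H.tail i.1 i.2.1 i.2.2) := by rw [hH.measureReal_tail]; positivity
  have hs1 := Real.sqrt_pos.2 h1
  have hs2 := Real.sqrt_pos.2 h2
  have hs3 := Real.sqrt_pos.2 h3
  have e1 := Real.mul_self_sqrt h1.le
  have e2 := Real.mul_self_sqrt h2.le
  set h := μ.real (H.head i)
  set t' := μ.real (H.tail i.1 i.2.1 (i.2.2 + 1))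
  set t := μ.real (H.tail i.1 i.2.1 i.2.2)
  have hfun : ∀ x, H.haar i x • G x =
      (H.head i).indicator (fun x => (√t' / (√h * √t)) • G x) x -
        (H.tail i.1 i.2.1 (i.2.2 + 1)).indicator (fun x => (√h / (√t * √t')) • G x) x := by
    intro x
    unfold HaarSystem.haar
    rw [sub_smul]
    congr 1 <;> · simp only [indicator]; split_ifs <;> simp [h, t, t']
  have i1 : IntegrableOn G (H.head i) μ := hG.mono_set (H.head_subset i)
  have i2 : IntegrableOn G (H.tail i.1 i.2.1 (i.2.2 + 1)) μ := hG.mono_set (H.tail_subset _ _ _)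
  have j1 : IntegrableOn (fun x => (√t' / (√h * √t)) • G x) (H.head i) μ := i1.smul _
  have j2 : IntegrableOn (fun x => (√h / (√t * √t')) • G x)
    (H.tail i.1 i.2.1 (i.2.2 + 1)) μ := i2.smul _
  simp_rw [hfun]
  rw [integral_sub (j1.integrable_indicator (H.measurableSet_head i))
      (j2.integrable_indicator (H.measurableSet_tail _ _ _)),
    integral_indicator (H.measurableSet_head i), integral_indicator (H.measurableSet_tail _ _ _),
    integral_smul, integral_smul, smul_sub, smul_smul, smul_smul]
  congr 2
  · field_simp; exact (pow_two _).trans e2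
  · field_simp; exact (pow_two _).trans e1

lemma integrable_haar (i : H.Index) : Integrable (H.haar i) μ := by
  unfold HaarSystem.haar
  refine Integrable.sub ?_ ?_
  · exact (integrableOn_const (hH.measure_ne_top_of_subset i.2.1.2
      (H.head_subset i))).integrable_indicator (H.measurableSet_head i)
  · exact (integrableOn_const (hH.measure_ne_top_of_subset i.2.1.2
      (H.tail_subset _ _ _))).integrable_indicator (H.measurableSet_tail _ _ _)

lemma integral_haar (i : H.Index) : ∫ x, H.haar i x ∂μ = 0 := by
  have h1 := hH.measureReal_head_pos i
  have h2 := hH.measureReal_tail_succ_pos i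
  have h3 : 0 < μ.real (H.tail i.1 i.2.1 i.2.2) := by rw [hH.measureReal_tail]; positivity
  have h := hH.integral_haar_smul i (G := fun _ => (1 : ℝ))
    (integrableOn_const (hH.measure_lt_top _ _ i.2.1.2).ne)
  simp only [smul_eq_mul, mul_one, setIntegral_const] at h
  rw [mul_comm (μ.real (H.head i)), sub_self] at h
  exact (mul_eq_zero.1 h).resolve_left (by positivity)

lemma integral_haar_mul_self (i : H.Index) : ∫ x, H.haar i x * H.haar i x ∂μ = 1 := by
  have h1 := hH.measureReal_head_pos i
  have h2 := hH.measureReal_tail_succ_pos i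
  have ht := hH.measureReal_tail i
  have h3 : 0 < μ.real (H.tail i.1 i.2.1 i.2.2) := by rw [ht]; positivity
  have h := hH.integral_haar_smul i (G := H.haar i) (hH.integrable_haar i).integrableOn
  have hd := H.disjoint_head_tail i
  have e1 := Real.mul_self_sqrt h1.le
  have e2 := Real.mul_self_sqrt h2.le
  have e3 := Real.mul_self_sqrt h3.le
  have hs1 := Real.sqrt_pos.2 h1
  have hs2 := Real.sqrt_pos.2 h2
  have hs3 := Real.sqrt_pos.2 h3
  have g1 : ∫ x in H.head i, H.haar i x ∂μ = μ.real (H.head i) *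
      (√(μ.real (H.tail i.1 i.2.1 (i.2.2 + 1))) /
      (√(μ.real (H.head i)) * √(μ.real (H.tail i.1 i.2.1 i.2.2)))) := by
    rw [setIntegral_congr_fun (g := fun _ => √(μ.real (H.tail i.1 i.2.1 (i.2.2 + 1))) /
      (√(μ.real (H.head i)) * √(μ.real (H.tail i.1 i.2.1 i.2.2)))) (H.measurableSet_head i),
      setIntegral_const, smul_eq_mul]
    intro x hx
    simp [HaarSystem.haar, hx, disjoint_left.1 hd hx]
  have g2 : ∫ x in H.tail i.1 i.2.1 (i.2.2 + 1), H.haar i x ∂μ =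
      -(μ.real (H.tail i.1 i.2.1 (i.2.2 + 1)) * (√(μ.real (H.head i)) /
      (√(μ.real (H.tail i.1 i.2.1 i.2.2)) * √(μ.real (H.tail i.1 i.2.1 (i.2.2 + 1)))))) := by
    rw [setIntegral_congr_fun (g := fun _ => -(√(μ.real (H.head i)) /
      (√(μ.real (H.tail i.1 i.2.1 i.2.2)) * √(μ.real (H.tail i.1 i.2.1 (i.2.2 + 1))))))
      (H.measurableSet_tail _ _ _), setIntegral_const, smul_eq_mul, mul_neg]
    intro x hx
    simp [HaarSystem.haar, hx, disjoint_right.1 hd hx]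
  simp only [smul_eq_mul] at h
  rw [g1, g2] at h
  set a := √(μ.real (H.head i))
  set b := √(μ.real (H.tail i.1 i.2.1 (i.2.2 + 1)))
  set c := √(μ.real (H.tail i.1 i.2.1 i.2.2))
  rw [← e1, ← e2] at h
  have hc : c * c = a * a + b * b := by rw [e1, e2, e3, ht]
  have h' : a * c * b * ∫ x, H.haar i x * H.haar i x ∂μ = a * c * b * 1 := by
    rw [h]
    field_simp
    rw [← pow_two, ← pow_two, ← pow_two] at hc
    rw [hc]
    ring
  exact mul_left_cancel₀ (by positivity) h'

/-- A Haar function is orthogonal to each function that is constant on the set `E_u` where the Haar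
function lives. -/
lemma integral_haar_mul_of_const {i : H.Index} {g : X → ℝ} {c : ℝ}
    (hg : ∀ x ∈ H.tail i.1 i.2.1 i.2.2, g x = c) : ∫ x, H.haar i x * g x ∂μ = 0 := by
  have : ∀ x, H.haar i x * g x = c * H.haar i x := by
    intro x
    by_cases hx : x ∈ H.tail i.1 i.2.1 i.2.2
    · rw [hg x hx, mul_comm]
    · rw [H.haar_eq_zero_of_notMem_tail i hx]; simp
  simp_rw [this, integral_const_mul, hH.integral_haar, mul_zero]

lemma integral_haar_mul (i j : H.Index) [Decidable (i = j)] :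
    ∫ x, H.haar i x * H.haar j x ∂μ = if i = j then 1 else 0 := by
  split_ifs with hij
  · rw [hij, hH.integral_haar_mul_self]
  -- For different generations, the earlier function is constant on the cube of the later one.
  have key : ∀ i j : H.Index, i.1 < j.1 → ∫ x, H.haar j x * H.haar i x ∂μ = 0 := by
    intro i j h
    obtain ⟨x, hx⟩ : (H.cube j).Nonempty :=
      nonempty_of_measure_ne_zero (hH.measure_pos _ _ j.2.1.2).ne'
    exact hH.integral_haar_mul_of_const (c := H.haar i x) fun y hy =>
      H.haar_eq_of_mem i h j.2.1.2 (H.tail_subset _ _ _ hy) hx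
  -- For one cube, the function with the smaller label is constant on the tail of the other one.
  have key' : ∀ (k : ℤ) (Q : H.cubes k) (u v : Fin (H.numChildren k Q - 1)), u < v →
      ∫ x, H.haar ⟨k, Q, v⟩ x * H.haar ⟨k, Q, u⟩ x ∂μ = 0 := by
    intro k Q u v h
    refine hH.integral_haar_mul_of_const (i := ⟨k, Q, v⟩) (c := -(√(μ.real (H.head ⟨k, Q, u⟩)) /
      (√(μ.real (H.tail k Q u)) * √(μ.real (H.tail k Q (u + 1)))))) fun x hx => ?_
    have hx' : x ∈ H.tail k Q (u + 1) := H.tail_anti k Q h hx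
    have := disjoint_right.1 (H.disjoint_head_tail ⟨k, Q, u⟩) hx'
    simp [HaarSystem.haar, hx', this]
  rcases lt_trichotomy i.1 j.1 with h | h | h
  · simp_rw [mul_comm (H.haar i _)]; exact key i j h
  · obtain ⟨k, Q, u⟩ := i
    obtain ⟨l, P, v⟩ := j
    obtain rfl : k = l := h
    by_cases hQP : Q = P
    · subst hQP
      have huv : u ≠ v := fun h => hij (by rw [h])
      rcases huv.lt_or_gt with h | h
      · simp_rw [mul_comm (H.haar ⟨k, Q, u⟩ _)]; exact key' k Q u v h
      · exact key' k Q v u h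
    · have hd : Disjoint (Q : Set X) P :=
        H.disjoint_cubes k Q.2 P.2 fun h => hQP (Subtype.ext h)
      have : ∀ x, H.haar ⟨k, Q, u⟩ x * H.haar ⟨k, P, v⟩ x = 0 := by
        intro x
        by_cases hx : x ∈ (Q : Set X)
        · rw [H.haar_eq_zero ⟨k, P, v⟩ (disjoint_left.1 hd hx), mul_zero]
        · rw [H.haar_eq_zero ⟨k, Q, u⟩ hx, zero_mul]
      simp [this]
  · exact key j i h

/-- If the Haar coefficients of `G` that belong to `Q` vanish, then `G` has the same average over
`Q` and over each child of `Q`. -/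
lemma setIntegral_child {E : Type*} [NormedAddCommGroup E] [NormedSpace ℝ E] {k : ℤ}
    (Q : H.cubes k) {G : X → E} (hG : IntegrableOn G Q μ)
    (h0 : ∀ u, ∫ x, H.haar ⟨k, Q, u⟩ x • G x ∂μ = 0) (j : Fin (H.numChildren k Q)) :
    ∫ x in (H.child k Q j : Set X), G x ∂μ =
      (μ.real (H.child k Q j : Set X) / μ.real (Q : Set X)) • ∫ x in (Q : Set X), G x ∂μ := by
  have hQ := hH.measureReal_pos Q.2
  set c : E := (μ.real (Q : Set X))⁻¹ • ∫ x in (Q : Set X), G x ∂μ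
  -- The set function `F` vanishes on each tail set, by induction.
  set F : Set X → E := fun A => (∫ x in A, G x ∂μ) - μ.real A • c with hF
  have hadd : ∀ u : Fin (H.numChildren k Q),
      F (H.tail k Q u) = F (H.child k Q u) + F (H.tail k Q (u + 1)) := by
    intro u
    simp only [hF]
    rw [H.tail_eq, setIntegral_union (H.disjoint_child_tail k Q u) (H.measurableSet_tail _ _ _)
      (hG.mono_set (H.child_subset k Q u)) (hG.mono_set (H.tail_subset k Q _)),
      measureReal_union (H.disjoint_child_tail k Q u) (H.measurableSet_tail _ _ _)
      (hH.measure_ne_top_of_subset Q.2 (H.child_subset k Q u))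
      (hH.measure_ne_top_of_subset Q.2 (H.tail_subset k Q _)), add_smul]
    abel
  have hstep : ∀ u : Fin (H.numChildren k Q), F (H.tail k Q u) = 0 → F (H.child k Q u) = 0 := by
    intro u hu
    by_cases hlt : (u : ℕ) < H.numChildren k Q - 1
    · let i : H.Index := ⟨k, Q, ⟨u, hlt⟩⟩
      have h1 := hH.measureReal_head_pos i
      have h2 := hH.measureReal_tail_succ_pos i
      have e := hH.integral_haar_smul i hG
      rw [h0, smul_zero] at e
      have hF2 : μ.real (H.tail k Q (u + 1)) • F (H.child k Q u) =
          μ.real (H.child k Q u : Set X) • F (H.tail k Q (u + 1)) := by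
        simp only [hF]
        rw [smul_sub, smul_sub, smul_comm _ _ c]
        congr 1
        exact (sub_eq_zero.1 e.symm)
      rw [hadd, add_eq_zero_iff_neg_eq] at hu
      rw [← hu, smul_neg, eq_neg_iff_add_eq_zero, ← add_smul] at hF2
      exact (smul_eq_zero.1 hF2).resolve_left (add_pos h2 h1).ne'
    · have hempty : H.tail k Q (u + 1) = ∅ := by
        refine eq_empty_of_forall_notMem fun x hx => ?_
        obtain ⟨j, hj, _⟩ := H.mem_tail.1 hx
        have := j.isLt
        omega
      have := hadd u
      rw [hu, hempty] at this
      simpa [hF] using this.symm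
  have htail : ∀ u : ℕ, ∀ hu : u < H.numChildren k Q, F (H.tail k Q u) = 0 := by
    intro u
    induction u with
    | zero =>
      intro _
      simp only [hF, H.tail_zero, c]
      rw [smul_smul, mul_inv_cancel₀ hQ.ne', one_smul, sub_self]
    | succ u ih =>
      intro hu
      have h := ih (Nat.lt_of_succ_lt hu)
      have h' := hstep ⟨u, Nat.lt_of_succ_lt hu⟩ h
      rw [hadd ⟨u, Nat.lt_of_succ_lt hu⟩, h', zero_add] at h
      exact h
  have := sub_eq_zero.1 (hstep j (htail j j.isLt))
  rw [this, smul_smul, div_eq_mul_inv]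

lemma tendsto_measureReal_tower (h : μ univ = ∞) :
    Tendsto (fun n => μ.real (T n)) atTop atTop := by
  have h1 : Tendsto (fun n => μ (T n)) atTop (𝓝 ∞) := by
    have := tendsto_measure_iUnion_atTop (μ := μ) hH.monotone_tower
    rwa [hH.iUnion_tower, h] at this
  refine tendsto_atTop.2 fun b => ?_
  filter_upwards [h1.eventually (lt_mem_nhds (ENNReal.ofReal_lt_top (r := b)))] with n hn
  exact (ENNReal.ofReal_le_iff_le_toReal (hH.measure_lt_top _ _ (hH.tower_mem n)).ne).1 hn.le

end HaarSystem.Regular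
end OneParameter

/-! ### Haar functions and the tower of large cubes -/

section OneParameterTower

variable {X : Type*} [MeasurableSpace X] {ρ : X → X → ℝ} {μ : Measure X} {H : HaarSystem ρ μ}
  {T : ℕ → Set X} {x₀ : X}

lemma HaarSystem.Regular.nonempty (hH : H.Regular T x₀) {k : ℤ} {Q : Set X}
    (hQ : Q ∈ H.cubes k) : Q.Nonempty := nonempty_of_measure_ne_zero (hH.measure_pos k Q hQ).ne'

/-- The cubes of a generation `k` refine those of a generation `l ≤ k`. -/
lemma HaarSystem.subset_of_mem {k l : ℤ} (h : l ≤ k)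
    {Q P A : Set X} (hQ : Q ∈ H.cubes k) (hP : P ∈ H.cubes l) (hA : A.Nonempty) (hAQ : A ⊆ Q)
    (hAP : A ⊆ P) : Q ⊆ P := by
  refine (H.nested l k h P hP Q hQ).resolve_right fun hd => ?_
  obtain ⟨x, hx⟩ := hA
  exact disjoint_left.1 hd (hAP hx) (hAQ hx)

/-- If the Haar coefficients of generation less than `n` vanish, then the averages over the cubes of
generation at most `n` in `T m` all agree with the average over `T m`. -/
lemma HaarSystem.Regular.setIntegral_of_subset_tower (hH : H.Regular T x₀) {E : Type*}
    [NormedAddCommGroup E] [NormedSpace ℝ E] {G : X → E} (hG : Integrable G μ) {n : ℤ}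
    (h0 : ∀ i : H.Index, i.1 < n → ∫ x, H.haar i x • G x ∂μ = 0) (m d : ℕ) :
    ∀ Q ∈ H.cubes (-m + d), Q ⊆ T m → -(m : ℤ) + d ≤ n →
      ∫ x in Q, G x ∂μ = (μ.real Q / μ.real (T m)) • ∫ x in T m, G x ∂μ := by
  induction d with
  | zero =>
    intro Q hQ hQT _
    simp only [Nat.cast_zero, add_zero] at hQ
    have : Q = T m := hQT.antisymm (H.subset_of_mem le_rfl (hH.tower_mem m) hQ (hH.nonempty hQ)
      hQT subset_rfl)
    rw [this, div_self (hH.measureReal_pos (hH.tower_mem m)).ne', one_smul]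
  | succ d ih =>
    intro Q hQ hQT hn
    obtain ⟨P, ⟨hP, hQP⟩, -⟩ := H.parent (-m + (d + 1 : ℕ)) (-m + d) (by push_cast; omega) Q hQ
    have hPT : P ⊆ T m := H.subset_of_mem (by omega) hP (hH.tower_mem m) (hH.nonempty hQ) hQP hQT
    have hQ' : Q ∈ H.cubes ((-m + d) + 1) := by
      convert hQ using 2
      push_cast
      ring
    obtain ⟨j, rfl⟩ := H.exists_child_eq ⟨P, hP⟩ hQ' hQP
    rw [hH.setIntegral_child ⟨P, hP⟩ hG.integrableOn (fun u => h0 _ ?_) j,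
      ih P hP hPT (by push_cast at hn; omega), smul_smul]
    · have := hH.measureReal_pos hP
      congr 1
      field_simp
    · change -(m : ℤ) + d < n
      push_cast at hn
      omega

/-- A function without Haar coefficients of generation less than `n`, and with integral zero if
the space has finite measure, has integral zero over the cubes of generation at most `n`. If the
space has infinite measure, this is because the averages over the cubes `T m` tend to zero. -/
lemma HaarSystem.Regular.setIntegral_cube_eq_zero (hH : H.Regular T x₀) {E : Type*}
    [NormedAddCommGroup E] [NormedSpace ℝ E] {G : X → E} (hG : Integrable G μ) {n : ℤ}
    (h0 : ∀ i : H.Index, i.1 < n → ∫ x, H.haar i x • G x ∂μ = 0)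
    (huniv : μ univ < ∞ → ∫ x, G x ∂μ = 0) {k : ℤ} (hk : k ≤ n) {Q : Set X}
    (hQ : Q ∈ H.cubes k) : ∫ x in Q, G x ∂μ = 0 := by
  obtain ⟨m₀, hm₀⟩ := hH.exists_cube_subset_tower k Q hQ
  have hev : ∀ᶠ m : ℕ in atTop,
      ∫ x in Q, G x ∂μ = (μ.real Q / μ.real (T m)) • ∫ x in T m, G x ∂μ := by
    filter_upwards [eventually_ge_atTop m₀, eventually_ge_atTop (-k).toNat] with m hm hmk
    obtain ⟨d, hd⟩ : ∃ d : ℕ, k = -m + d := ⟨(k + m).toNat, by omega⟩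
    subst hd
    exact hH.setIntegral_of_subset_tower hG h0 m d Q hQ (hm₀.trans (hH.monotone_tower hm)) hk
  have hlim : Tendsto (fun m => ∫ x in T m, G x ∂μ) atTop (𝓝 (∫ x, G x ∂μ)) := by
    have := tendsto_setIntegral_of_monotone (μ := μ) (f := G) hH.measurableSet_tower
      hH.monotone_tower hG.integrableOn
    rwa [hH.iUnion_tower, Measure.restrict_univ] at this
  refine tendsto_nhds_unique (f := fun _ : ℕ => ∫ x in Q, G x ∂μ) (l := atTop)
    tendsto_const_nhds (Tendsto.congr' (hev.mono fun m h => h.symm) ?_)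
  by_cases hfin : μ univ < ∞
  · rw [huniv hfin] at hlim
    rw [tendsto_zero_iff_norm_tendsto_zero] at hlim ⊢
    refine squeeze_zero' (Eventually.of_forall fun m => norm_nonneg _) ?_ hlim
    filter_upwards [eventually_ge_atTop m₀] with m hm
    rw [norm_smul]
    refine mul_le_of_le_one_left (norm_nonneg _) ?_
    rw [Real.norm_of_nonneg (by positivity)]
    exact div_le_one_of_le₀ (measureReal_mono (hm₀.trans (hH.monotone_tower hm))
      (hH.measure_lt_top _ _ (hH.tower_mem m)).ne) measureReal_nonneg
  · have h1 := (tendsto_const_nhds (x := μ.real Q)).div_atTop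
      (hH.tendsto_measureReal_tower (not_lt_top_iff.1 hfin))
    simpa using h1.smul hlim

lemma HaarSystem.Regular.finite_cubes (hH : H.Regular T x₀) (m d : ℕ) :
    {Q | Q ∈ H.cubes (-m + d) ∧ Q ⊆ T m}.Finite := by
  induction d with
  | zero =>
    refine (finite_singleton (T m)).subset fun Q ⟨hQ, hQT⟩ => ?_
    simp only [Nat.cast_zero, add_zero] at hQ
    exact hQT.antisymm (H.subset_of_mem le_rfl (hH.tower_mem m) hQ (hH.nonempty hQ)
      hQT subset_rfl)
  | succ d ih =>
    refine (ih.biUnion (t := fun P => {R | R ∈ H.cubes (-m + d + 1) ∧ R ⊆ P})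
      fun P hP => ?_).subset fun Q ⟨hQ, hQT⟩ => ?_
    · exact finite_of_encard_le_coe (H.children_le _ P hP.1)
    · obtain ⟨P, ⟨hP, hQP⟩, -⟩ := H.parent (-m + (d + 1 : ℕ)) (-m + d) (by push_cast; omega) Q hQ
      refine mem_biUnion (x := P) ⟨hP, ?_⟩ ⟨?_, hQP⟩
      · exact H.subset_of_mem (by omega) hP (hH.tower_mem m) (hH.nonempty hQ) hQP hQT
      · convert hQ using 2
        push_cast
        ring

/-- The indices of the Haar functions that are supported in the cube `T n` of the tower and are
of its generation or of a later one. -/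
def HaarSystem.below (H : HaarSystem ρ μ) (T : ℕ → Set X) (n : ℕ) : Set H.Index :=
  {i | -(n : ℤ) ≤ i.1 ∧ H.cube i ⊆ T n}

lemma HaarSystem.Regular.finite_below (hH : H.Regular T x₀) (m : ℕ) (n : ℤ) :
    {i | i ∈ H.below T m ∧ i.1 < n}.Finite := by
  have h : ∀ k ∈ Ico (-(m : ℤ)) n, {Q : H.cubes k | (Q : Set X) ⊆ T m}.Finite := by
    intro k hk
    obtain ⟨d, rfl⟩ : ∃ d : ℕ, k = -m + d := ⟨(k + m).toNat, by have := hk.1; omega⟩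
    exact ((hH.finite_cubes m d).preimage Subtype.val_injective.injOn).subset
      fun Q hQ => ⟨Q.2, hQ⟩
  refine ((finite_Ico (-(m : ℤ)) n).biUnion fun k hk => (h k hk).biUnion fun Q _ =>
    finite_range fun u : Fin (H.numChildren k Q - 1) => (⟨k, Q, u⟩ : H.Index)).subset ?_
  rintro ⟨k, Q, u⟩ ⟨hi, hn⟩
  exact mem_biUnion (x := k) ⟨hi.1, hn⟩ (mem_biUnion (x := Q) hi.2 ⟨u, rfl⟩)

lemma HaarSystem.Regular.eventually_mem_below (hH : H.Regular T x₀) (i : H.Index) :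
    ∀ᶠ n in atTop, i ∈ H.below T n := by
  obtain ⟨n, hn⟩ := hH.exists_cube_subset_tower i.1 _ i.2.1.2
  filter_upwards [eventually_ge_atTop n, eventually_ge_atTop (-i.1).toNat] with m h1 h2
  exact ⟨by omega, hn.trans (hH.monotone_tower h1)⟩

lemma HaarSystem.Regular.haar_eq_zero_of_notMem_below (hH : H.Regular T x₀) {n : ℕ}
    {i : H.Index} (hi : i ∉ H.below T n) (hn : -(n : ℤ) ≤ i.1) {x : X} (hx : x ∈ T n) :
    H.haar i x = 0 := by
  refine H.haar_eq_zero i fun hxi => hi ⟨hn, ?_⟩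
  exact H.subset_of_mem hn i.2.1.2 (hH.tower_mem n) (singleton_nonempty x)
    (singleton_subset_iff.2 hxi) (singleton_subset_iff.2 hx)

/-- The Haar functions of all other cubes are constant on `T n`: their cubes are disjoint from `T n`
or contain it in one of their children. -/
lemma HaarSystem.Regular.haar_eq_of_notMem_below (hH : H.Regular T x₀) {n : ℕ}
    {i : H.Index} (hi : i ∉ H.below T n) {x y : X} (hx : x ∈ T n) (hy : y ∈ T n) :
    H.haar i x = H.haar i y := by
  by_cases hn : -(n : ℤ) ≤ i.1
  · rw [hH.haar_eq_zero_of_notMem_below hi hn hx, hH.haar_eq_zero_of_notMem_below hi hn hy]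
  · exact H.haar_eq_of_mem i (not_le.1 hn) (hH.tower_mem n) hx hy

/-- The constant that is subtracted from a Haar function of negative generation in order that it
vanish near the base point `x₀`. -/
noncomputable def HaarSystem.shift (H : HaarSystem ρ μ) (x₀ : X) (i : H.Index) : ℝ :=
  if 0 ≤ i.1 then 0 else H.haar i x₀

lemma HaarSystem.Regular.haar_sub_shift_eq_zero (hH : H.Regular T x₀) {n : ℕ}
    {i : H.Index} (hi : i ∉ H.below T n) {x : X} (hx : x ∈ T n) :
    H.haar i x - H.shift x₀ i = 0 := by
  unfold HaarSystem.shift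
  split_ifs with h
  · rw [hH.haar_eq_zero_of_notMem_below hi (by omega) hx, sub_zero]
  · rw [hH.haar_eq_of_notMem_below hi hx (hH.mem_tower n), sub_self]

lemma HaarSystem.Regular.finite_shift_ne_zero (hH : H.Regular T x₀) (n : ℕ) :
    {i | i ∈ H.below T n ∧ H.shift x₀ i ≠ 0}.Finite := by
  refine (hH.finite_below n 0).subset fun i hi => ⟨hi.1, ?_⟩
  by_contra h
  exact hi.2 (if_pos (not_lt.1 h))

/-- Shifting and truncating the Haar functions preserves their biorthogonality to the Haar functions
of the cubes in `T n`, since the latter have integral zero and are supported in `T n`. -/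
lemma HaarSystem.Regular.integral_haar_mul_shifted (hH : H.Regular T x₀) {n : ℕ}
    {j : H.Index} (hj : j ∈ H.below T n) (i : H.Index) [Decidable (i = j)] :
    ∫ x, H.haar j x * (T n).indicator (fun x => H.haar i x - H.shift x₀ i) x ∂μ =
      if i = j then 1 else 0 := by
  by_cases hi : i ∈ H.below T n
  · have h : ∀ x, H.haar j x * (T n).indicator (fun x => H.haar i x - H.shift x₀ i) x =
        H.haar i x * H.haar j x - H.shift x₀ i * H.haar j x := by
      intro x
      by_cases hx : x ∈ T n
      · rw [indicator_of_mem hx]; ring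
      · rw [H.haar_eq_zero j fun h => hx (hj.2 h)]; simp
    have hint : Integrable (fun x => H.haar i x * H.haar j x) μ := by
      obtain ⟨B, hB⟩ := H.exists_bound_haar i
      exact (hH.integrable_haar j).bdd_mul (H.measurable_haar i).aestronglyMeasurable
        (Eventually.of_forall hB)
    simp_rw [h]
    rw [integral_sub hint ((hH.integrable_haar j).const_mul _), integral_const_mul,
      hH.integral_haar, mul_zero, sub_zero, hH.integral_haar_mul]
  · have h : ∀ x, H.haar j x * (T n).indicator (fun x => H.haar i x - H.shift x₀ i) x = 0 := by
      intro x
      by_cases hx : x ∈ T n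
      · rw [indicator_of_mem hx, hH.haar_sub_shift_eq_zero hi hx, mul_zero]
      · rw [indicator_of_notMem hx, mul_zero]
    rw [if_neg (by rintro rfl; exact hi hj)]
    simp [h]

end OneParameterTower

/-! ### A maximal inequality for dyadic rectangles -/

section Maximal

/-- The union of the cubes of which `E` fills more than a quarter. -/
def HaarSystem.enlargement {X : Type*} [MeasurableSpace X] {ρ : X → X → ℝ} {μ : Measure X}
    (H : HaarSystem ρ μ) (E : Set X) : Set X :=
  ⋃₀ {Q | (∃ k, Q ∈ H.cubes k) ∧ μ Q < 4 * μ (Q ∩ E)}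

lemma HaarSystem.countable_setOf_cubes {X : Type*} [MeasurableSpace X] {ρ : X → X → ℝ}
    {μ : Measure X} (H : HaarSystem ρ μ) : {Q | ∃ k, Q ∈ H.cubes k}.Countable := by
  have : {Q | ∃ k, Q ∈ H.cubes k} = ⋃ k, H.cubes k := by ext; simp
  rw [this]
  exact countable_iUnion H.countable_cubes

/-- The weak type (1,1) inequality for the dyadic maximal function of an indicator function. -/
lemma HaarSystem.measure_enlargement_le {X : Type*} [MeasurableSpace X] {ρ : X → X → ℝ}
    {μ : Measure X} (H : HaarSystem ρ μ) {E : Set X} (hE : MeasurableSet E) :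
    μ (H.enlargement E) ≤ 4 * μ E := by
  classical
  -- For finitely many cubes, the maximal ones are disjoint and have the same union.
  have hfin : ∀ F : Finset (Set X), (∀ Q ∈ F, (∃ k, Q ∈ H.cubes k) ∧ μ Q < 4 * μ (Q ∩ E)) →
      μ (⋃ Q ∈ F, Q) ≤ 4 * μ E := by
    intro F hF
    set N := F.filter (Maximal (· ∈ F)) with hN
    have hNF : ∀ Q ∈ N, Q ∈ F := fun Q hQ => (Finset.mem_filter.1 hQ).1
    have hdisj : (N : Set (Set X)).PairwiseDisjoint (fun Q => Q ∩ E) := by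
      intro Q hQ P hP hne
      obtain ⟨k, hk⟩ := (hF Q (hNF Q hQ)).1
      obtain ⟨l, hl⟩ := (hF P (hNF P hP)).1
      have hQm := (Finset.mem_filter.1 hQ).2
      have hPm := (Finset.mem_filter.1 hP).2
      have : Disjoint Q P := by
        rcases le_total k l with h | h
        · exact (H.nested k l h Q hk P hl).resolve_left fun hPQ => hne (hPm.eq_of_subset
            hQm.prop hPQ).symm
        · exact ((H.nested l k h P hl Q hk).resolve_left fun hQP => hne (hQm.eq_of_subset
            hPm.prop hQP)).symm
      exact this.mono inter_subset_left inter_subset_left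
    calc μ (⋃ Q ∈ F, Q) ≤ μ (⋃ Q ∈ N, Q) := by
          refine measure_mono (iUnion₂_subset fun Q hQ => ?_)
          obtain ⟨P, hQP, hP⟩ := F.exists_le_maximal hQ
          exact subset_trans hQP (subset_biUnion_of_mem (u := fun Q => Q)
            (Finset.mem_filter.2 ⟨hP.prop, hP⟩ : P ∈ N))
      _ ≤ ∑ Q ∈ N, μ Q := measure_biUnion_finset_le N _
      _ ≤ ∑ Q ∈ N, 4 * μ (Q ∩ E) := Finset.sum_le_sum fun Q hQ => (hF Q (hNF Q hQ)).2.le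
      _ = 4 * μ (⋃ Q ∈ N, Q ∩ E) := by
          rw [← Finset.mul_sum, measure_biUnion_finset hdisj]
          intro Q hQ
          obtain ⟨k, hk⟩ := (hF Q (hNF Q hQ)).1
          exact (H.measurableSet_cube k Q hk).inter hE
      _ ≤ 4 * μ E := by
          gcongr
          exact iUnion₂_subset fun Q _ => inter_subset_right
  unfold HaarSystem.enlargement
  set S : Set (Set X) := {Q | (∃ k, Q ∈ H.cubes k) ∧ μ Q < 4 * μ (Q ∩ E)}
  rcases S.eq_empty_or_nonempty with h0 | h0
  · simp [h0]
  obtain ⟨g, hg⟩ := (H.countable_setOf_cubes.mono fun Q (hQ : Q ∈ S) => hQ.1).exists_eq_range h0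
  rw [hg, sUnion_range, measure_iUnion_eq_iSup_accumulate]
  refine iSup_le fun n => ?_
  refine (measure_mono ?_).trans (hfin ((Finset.range (n + 1)).image g) ?_)
  · intro x hx
    obtain ⟨m, hm, hx⟩ := mem_accumulate.1 hx
    exact mem_biUnion (Finset.mem_coe.2 (Finset.mem_image_of_mem g
      (Finset.mem_range.2 (Nat.lt_succ_of_le hm)))) hx
  · intro Q hQ
    obtain ⟨m, _, rfl⟩ := Finset.mem_image.1 hQ
    have : g m ∈ S := hg ▸ mem_range_self m
    exact this

variable {X₁ X₂ : Type*} [MeasurableSpace X₁] [MeasurableSpace X₂]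
  {ρ₁ : X₁ → X₁ → ℝ} {ρ₂ : X₂ → X₂ → ℝ} {μ₁ : Measure X₁} {μ₂ : Measure X₂}

/-- The slicewise enlargement of a set in the second variable. -/
def HaarSystem.sliceEnlargement (H₂ : HaarSystem ρ₂ μ₂) (E : Set (X₁ × X₂)) : Set (X₁ × X₂) :=
  {x | x.2 ∈ H₂.enlargement (Prod.mk x.1 ⁻¹' E)}

lemma HaarSystem.measurableSet_sliceEnlargement [SFinite μ₂] (H₂ : HaarSystem ρ₂ μ₂)
    {E : Set (X₁ × X₂)} (hE : MeasurableSet E) : MeasurableSet (H₂.sliceEnlargement E) := by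
  have : H₂.sliceEnlargement E = ⋃ Q ∈ {Q | ∃ k, Q ∈ H₂.cubes k},
      {x₁ | μ₂ Q < 4 * μ₂ (Q ∩ Prod.mk x₁ ⁻¹' E)} ×ˢ Q := by
    ext x
    simp only [HaarSystem.sliceEnlargement, HaarSystem.enlargement, mem_ofPred_eq, mem_sUnion,
      mem_iUnion, mem_prod, exists_prop]
    exact exists_congr fun Q => and_assoc
  rw [this]
  refine MeasurableSet.biUnion H₂.countable_setOf_cubes fun Q ⟨k, hk⟩ => ?_
  have hQ := H₂.measurableSet_cube k Q hk
  refine MeasurableSet.prod (measurableSet_lt measurable_const (Measurable.const_mul ?_ _)) hQ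
  exact measurable_measure_prodMk_left ((measurable_snd hQ).inter hE)

lemma HaarSystem.measure_sliceEnlargement_le [SFinite μ₂] (H₂ : HaarSystem ρ₂ μ₂)
    {E : Set (X₁ × X₂)} (hE : MeasurableSet E) :
    μ₁.prod μ₂ (H₂.sliceEnlargement E) ≤ 4 * μ₁.prod μ₂ E := by
  rw [Measure.prod_apply (H₂.measurableSet_sliceEnlargement hE), Measure.prod_apply hE,
    ← lintegral_const_mul _ (measurable_measure_prodMk_left hE)]
  exact lintegral_mono fun x => H₂.measure_enlargement_le (measurable_prodMk_left hE)

/-- A set of measure at most `16 μ(Ω)` that contains each dyadic rectangle of which `Ω` fills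
more than one half. -/
def rectEnlargement (H₁ : HaarSystem ρ₁ μ₁) (H₂ : HaarSystem ρ₂ μ₂) (Ω : Set (X₁ × X₂)) :
    Set (X₁ × X₂) :=
  Prod.swap ⁻¹' H₁.sliceEnlargement (Prod.swap ⁻¹' H₂.sliceEnlargement Ω)

variable [SFinite μ₂] (H₁ : HaarSystem ρ₁ μ₁) (H₂ : HaarSystem ρ₂ μ₂)

/-- If the slices of which `Ω` fills more than a quarter made up at most a quarter of the rectangle,
then `Ω` would fill at most one half of it. -/
lemma prod_subset_rectEnlargement {Ω : Set (X₁ × X₂)} (hΩ : MeasurableSet Ω) {k l : ℤ}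
    {Q₁ : Set X₁} {Q₂ : Set X₂} (h₁ : Q₁ ∈ H₁.cubes k) (h₂ : Q₂ ∈ H₂.cubes l)
    (h : μ₁.prod μ₂ (Q₁ ×ˢ Q₂) < 2 * μ₁.prod μ₂ (Q₁ ×ˢ Q₂ ∩ Ω)) :
    Q₁ ×ˢ Q₂ ⊆ rectEnlargement H₁ H₂ Ω := by
  rintro ⟨x₁, x₂⟩ ⟨hx₁, hx₂⟩
  have m₁ := H₁.measurableSet_cube k Q₁ h₁
  have m₂ := H₂.measurableSet_cube l Q₂ h₂
  set A : Set X₁ := Prod.mk x₂ ⁻¹' (Prod.swap ⁻¹' H₂.sliceEnlargement Ω) with hA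
  have mA : MeasurableSet A :=
    measurable_prodMk_left (measurable_swap (H₂.measurableSet_sliceEnlargement hΩ))
  refine mem_sUnion.2 ⟨Q₁, ⟨⟨k, h₁⟩, ?_⟩, hx₁⟩
  change μ₁ Q₁ < 4 * μ₁ (Q₁ ∩ A)
  -- A slice of the rectangle is filled by at most a quarter, unless it belongs to `A`.
  have hslice : ∀ y ∈ Q₁, 4 * μ₂ (Q₂ ∩ Prod.mk y ⁻¹' Ω) ≤
      μ₂ Q₂ + A.indicator (fun _ => 4 * μ₂ Q₂) y := by
    intro y _
    by_cases hy : y ∈ A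
    · rw [indicator_of_mem hy]
      exact le_add_left (by gcongr; exact inter_subset_left)
    · rw [indicator_of_notMem hy, add_zero]
      by_contra hlt
      exact hy (mem_sUnion.2 ⟨Q₂, ⟨⟨l, h₂⟩, not_le.1 hlt⟩, hx₂⟩)
  have hint : 4 * μ₁.prod μ₂ (Q₁ ×ˢ Q₂ ∩ Ω) ≤
      μ₁ Q₁ * μ₂ Q₂ + 4 * μ₁ (Q₁ ∩ A) * μ₂ Q₂ := by
    rw [Measure.prod_apply ((m₁.prod m₂).inter hΩ), ← lintegral_const_mul _
      (measurable_measure_prodMk_left ((m₁.prod m₂).inter hΩ))]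
    calc ∫⁻ y, 4 * μ₂ (Prod.mk y ⁻¹' (Q₁ ×ˢ Q₂ ∩ Ω)) ∂μ₁
        ≤ ∫⁻ y, Q₁.indicator (fun y => μ₂ Q₂ + A.indicator (fun _ => 4 * μ₂ Q₂) y) y ∂μ₁ := by
          refine lintegral_mono fun y => ?_
          by_cases hy : y ∈ Q₁
          · rw [indicator_of_mem hy, preimage_inter, mk_preimage_prod_right hy]
            exact hslice y hy
          · rw [preimage_inter, mk_preimage_prod_right_eq_empty hy]
            simp
      _ = μ₁ Q₁ * μ₂ Q₂ + 4 * μ₁ (Q₁ ∩ A) * μ₂ Q₂ := by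
          rw [lintegral_indicator m₁, lintegral_add_left measurable_const, setLIntegral_const,
            lintegral_indicator_const mA, Measure.restrict_apply mA, inter_comm A]
          ring
  rw [Measure.prod_prod] at h
  have hlt : μ₁ Q₁ * μ₂ Q₂ + μ₁ Q₁ * μ₂ Q₂ < μ₁ Q₁ * μ₂ Q₂ + 4 * μ₁ (Q₁ ∩ A) * μ₂ Q₂ := by
    refine lt_of_lt_of_le ?_ hint
    rw [← two_mul, show (4 : ℝ≥0∞) = 2 * 2 by norm_num, mul_assoc]
    exact (ENNReal.mul_lt_mul_iff_right two_ne_zero (by simp)).2 h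
  have h' := lt_of_add_lt_add_left hlt
  exact lt_of_mul_lt_mul_right' h'

variable [SFinite μ₁]

lemma measurableSet_rectEnlargement {Ω : Set (X₁ × X₂)} (hΩ : MeasurableSet Ω) :
    MeasurableSet (rectEnlargement H₁ H₂ Ω) :=
  measurable_swap (H₁.measurableSet_sliceEnlargement
    (measurable_swap (H₂.measurableSet_sliceEnlargement hΩ)))

lemma measure_rectEnlargement_le {Ω : Set (X₁ × X₂)} (hΩ : MeasurableSet Ω) :
    μ₁.prod μ₂ (rectEnlargement H₁ H₂ Ω) ≤ 16 * μ₁.prod μ₂ Ω := by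
  have h1 := H₂.measurableSet_sliceEnlargement hΩ
  have h2 := H₁.measurableSet_sliceEnlargement (measurable_swap h1)
  calc μ₁.prod μ₂ (rectEnlargement H₁ H₂ Ω)
      = μ₂.prod μ₁ (H₁.sliceEnlargement (Prod.swap ⁻¹' H₂.sliceEnlargement Ω)) :=
        Measure.measurePreserving_swap.measure_preimage h2.nullMeasurableSet
    _ ≤ 4 * μ₂.prod μ₁ (Prod.swap ⁻¹' H₂.sliceEnlargement Ω) :=
        H₁.measure_sliceEnlargement_le (measurable_swap h1)
    _ = 4 * μ₁.prod μ₂ (H₂.sliceEnlargement Ω) := by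
        rw [Measure.measurePreserving_swap.measure_preimage h1.nullMeasurableSet]
    _ ≤ 4 * (4 * μ₁.prod μ₂ Ω) := by gcongr; exact H₂.measure_sliceEnlargement_le hΩ
    _ = 16 * μ₁.prod μ₂ Ω := by rw [← mul_assoc]; norm_num

end Maximal

/-! ### Carleson sequences -/

section Sums

/-- The Cauchy–Schwarz inequality. -/
lemma ENNReal_tsum_mul_le_of_sq_le {α : Type*} {a b : α → ℝ≥0∞} {A D V : ℝ≥0∞}
    (ha : ∑' i, a i ^ 2 ≤ A ^ 2 * V) (hb : ∑' i, b i ^ 2 ≤ D ^ 2 * V) :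
    ∑' i, a i * b i ≤ A * D * V := by
  let _ : MeasurableSpace α := ⊤
  have h := ENNReal.lintegral_mul_le_Lp_mul_Lq Measure.count Real.HolderConjugate.two_two
    (f := a) (g := b) measurable_from_top.aemeasurable measurable_from_top.aemeasurable
  simp only [Pi.mul_apply, lintegral_count, ENNReal.rpow_two] at h
  refine h.trans ((mul_le_mul' (ENNReal.rpow_le_rpow ha (by norm_num))
    (ENNReal.rpow_le_rpow hb (by norm_num))).trans_eq ?_)
  have hsq : ∀ t : ℝ≥0∞, (t ^ 2) ^ (1 / 2 : ℝ) = t := fun t => by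
    rw [← ENNReal.rpow_two, ← ENNReal.rpow_mul]; norm_num
  rw [ENNReal.mul_rpow_of_nonneg _ _ (by norm_num), ENNReal.mul_rpow_of_nonneg _ _ (by norm_num),
    hsq, hsq]
  calc A * V ^ (1 / 2 : ℝ) * (D * V ^ (1 / 2 : ℝ)) = A * D * (V ^ (1 / 2 : ℝ)) ^ 2 := by ring
    _ = A * D * V := by rw [← ENNReal.rpow_two, ← ENNReal.rpow_mul]; norm_num

lemma tsum_two_zpow_le (s : ℝ≥0∞) :
    ∑' k : ℤ, (if (2 : ℝ≥0∞) ^ k < s then (2 : ℝ≥0∞) ^ k else 0) ≤ 2 * s := by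
  rcases eq_or_ne s ∞ with rfl | hs
  · simp
  rcases eq_or_ne s 0 with rfl | h0
  · simp
  obtain ⟨n, hn⟩ := ENNReal.exists_mem_Ioc_zpow h0 hs ENNReal.one_lt_two (by simp)
  have hinj : Function.Injective fun j : ℕ => n - (j : ℤ) := fun a b h => by
    simpa using h
  have hsupp : Function.support
      (fun k : ℤ => if (2 : ℝ≥0∞) ^ k < s then (2 : ℝ≥0∞) ^ k else 0) ⊆
      range fun j : ℕ => n - (j : ℤ) := by
    intro k hk
    have hks : (2 : ℝ≥0∞) ^ k < s := by
      by_contra h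
      exact hk (if_neg h)
    have hkn : k < n + 1 := by
      by_contra h
      exact absurd (hks.trans_le hn.2)
        (not_lt.2 (ENNReal.zpow_le_of_le one_le_two (not_lt.1 h)))
    exact ⟨(n - k).toNat, by simp only []; omega⟩
  rw [← hinj.tsum_eq hsupp]
  calc ∑' j : ℕ, (if (2 : ℝ≥0∞) ^ (n - (j : ℤ)) < s then (2 : ℝ≥0∞) ^ (n - (j : ℤ)) else 0)
      ≤ ∑' j : ℕ, (2 : ℝ≥0∞) ^ n * 2⁻¹ ^ j := by
        refine ENNReal.tsum_le_tsum fun j => ?_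
        have : (2 : ℝ≥0∞) ^ (n - (j : ℤ)) = 2 ^ n * 2⁻¹ ^ j := by
          rw [ENNReal.zpow_sub two_ne_zero (by simp), zpow_natCast, ENNReal.inv_pow]
        rw [← this]
        split_ifs <;> simp
    _ = 2 * 2 ^ n := by rw [ENNReal.tsum_mul_left, ENNReal.tsum_geometric_two, mul_comm]
    _ ≤ 2 * s := by gcongr; exact hn.1.le

end Sums

section Carleson

variable {X₁ X₂ : Type*} [MeasurableSpace X₁] [MeasurableSpace X₂]
  {ρ₁ : X₁ → X₁ → ℝ} {ρ₂ : X₂ → X₂ → ℝ} {μ₁ : Measure X₁} {μ₂ : Measure X₂}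

/-- The dyadic rectangle of a product Haar function. -/
def rect (H₁ : HaarSystem ρ₁ μ₁) (H₂ : HaarSystem ρ₂ μ₂) (i : H₁.Index × H₂.Index) :
    Set (X₁ × X₂) := H₁.cube i.1 ×ˢ H₂.cube i.2

/-- The square function of a sequence `b` of Haar coefficients. -/
noncomputable def sqSum (H₁ : HaarSystem ρ₁ μ₁) (H₂ : HaarSystem ρ₂ μ₂)
    (b : H₁.Index × H₂.Index → ℝ≥0∞) (x : X₁ × X₂) : ℝ≥0∞ :=
  (∑' i, (b i * H₁.normChar i.1 x.1 * H₂.normChar i.2 x.2) ^ 2) ^ (1 / 2 : ℝ)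

variable {H₁ : HaarSystem ρ₁ μ₁} {H₂ : HaarSystem ρ₂ μ₂}

lemma measurableSet_rect (i : H₁.Index × H₂.Index) : MeasurableSet (rect H₁ H₂ i) :=
  (H₁.measurableSet_cube' i.1).prod (H₂.measurableSet_cube' i.2)

lemma measurable_sqSum_term (b : H₁.Index × H₂.Index → ℝ≥0∞) (i : H₁.Index × H₂.Index) :
    Measurable fun x : X₁ × X₂ =>
      (b i * H₁.normChar i.1 x.1 * H₂.normChar i.2 x.2) ^ 2 :=
  ((measurable_const.mul ((measurable_normChar H₁ i.1).comp measurable_fst)).mul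
    ((measurable_normChar H₂ i.2).comp measurable_snd)).pow_const 2

lemma measurable_sqSum (b : H₁.Index × H₂.Index → ℝ≥0∞) : Measurable (sqSum H₁ H₂ b) := by
  have := countable_index H₁
  have := countable_index H₂
  exact (Measurable.tsum (measurable_sqSum_term b)).pow_const _

lemma sqSum_sq (b : H₁.Index × H₂.Index → ℝ≥0∞) (x : X₁ × X₂) :
    sqSum H₁ H₂ b x ^ 2 = ∑' i, (b i * H₁.normChar i.1 x.1 * H₂.normChar i.2 x.2) ^ 2 := by
  rw [sqSum, ← ENNReal.rpow_two, ← ENNReal.rpow_mul]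
  norm_num

lemma sqSum_mono {b b' : H₁.Index × H₂.Index → ℝ≥0∞} (h : ∀ i, b i ≤ b' i) (x : X₁ × X₂) :
    sqSum H₁ H₂ b x ≤ sqSum H₁ H₂ b' x := by
  refine ENNReal.rpow_le_rpow (ENNReal.tsum_le_tsum fun i => ?_) (by norm_num)
  gcongr
  exact h i

variable {T₁ : ℕ → Set X₁} {x₁ : X₁} {T₂ : ℕ → Set X₂} {x₂ : X₂}

lemma sqSum_term_eq (h₁ : H₁.Regular T₁ x₁) [SFinite μ₂] (b : H₁.Index × H₂.Index → ℝ≥0∞)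
    (i : H₁.Index × H₂.Index) (x : X₁ × X₂) :
    (b i * H₁.normChar i.1 x.1 * H₂.normChar i.2 x.2) ^ 2 =
      (rect H₁ H₂ i).indicator (fun _ => b i ^ 2 * (μ₁.prod μ₂ (rect H₁ H₂ i))⁻¹) x := by
  have hsq : ∀ t : ℝ≥0∞, (t ^ (-(1 / 2) : ℝ)) ^ 2 = t⁻¹ := fun t => by
    rw [← ENNReal.rpow_two, ← ENNReal.rpow_mul]
    norm_num
    exact ENNReal.rpow_neg_one t
  have p₁ : μ₁ (H₁.cube i.1) ≠ 0 := (h₁.measure_pos _ _ i.1.2.1.2).ne'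
  have f₁ : μ₁ (H₁.cube i.1) ≠ ∞ := (h₁.measure_lt_top _ _ i.1.2.1.2).ne
  by_cases hx : x ∈ rect H₁ H₂ i
  · rw [indicator_of_mem hx, HaarSystem.normChar, HaarSystem.normChar, indicator_of_mem hx.1,
      indicator_of_mem hx.2, mul_pow, mul_pow, hsq, hsq, rect, Measure.prod_prod,
      ENNReal.mul_inv (Or.inl p₁) (Or.inl f₁), mul_assoc]
  · rw [indicator_of_notMem hx]
    have : x.1 ∉ H₁.cube i.1 ∨ x.2 ∉ H₂.cube i.2 := by
      by_contra h
      push Not at h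
      exact hx h
    rcases this with h | h
    · rw [HaarSystem.normChar, indicator_of_notMem h]; simp
    · rw [HaarSystem.normChar, HaarSystem.normChar, indicator_of_notMem h]; simp

lemma setLIntegral_sqSum_sq (h₁ : H₁.Regular T₁ x₁) [SFinite μ₂]
    (b : H₁.Index × H₂.Index → ℝ≥0∞) (A : Set (X₁ × X₂)) :
    ∫⁻ x in A, sqSum H₁ H₂ b x ^ 2 ∂(μ₁.prod μ₂) =
      ∑' i, b i ^ 2 * ((μ₁.prod μ₂ (rect H₁ H₂ i))⁻¹ * μ₁.prod μ₂ (rect H₁ H₂ i ∩ A)) := by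
  have := countable_index H₁
  have := countable_index H₂
  simp_rw [sqSum_sq]
  rw [lintegral_tsum fun i => (measurable_sqSum_term b i).aemeasurable]
  refine tsum_congr fun i => ?_
  simp_rw [sqSum_term_eq h₁]
  rw [lintegral_indicator_const (measurableSet_rect i),
    Measure.restrict_apply (measurableSet_rect i), mul_assoc]

section

variable (h₁ : H₁.Regular T₁ x₁) (h₂ : H₂.Regular T₂ x₂)
include h₁ h₂

lemma measure_rect_ne_zero [SFinite μ₂] (i : H₁.Index × H₂.Index) :
    μ₁.prod μ₂ (rect H₁ H₂ i) ≠ 0 := by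
  rw [rect, Measure.prod_prod]
  exact mul_ne_zero (h₁.measure_pos _ _ i.1.2.1.2).ne' (h₂.measure_pos _ _ i.2.2.1.2).ne'

lemma measure_rect_ne_top [SFinite μ₂] (i : H₁.Index × H₂.Index) :
    μ₁.prod μ₂ (rect H₁ H₂ i) ≠ ∞ := by
  rw [rect, Measure.prod_prod]
  exact ENNReal.mul_ne_top (h₁.measure_lt_top _ _ i.1.2.1.2).ne
    (h₂.measure_lt_top _ _ i.2.2.1.2).ne

lemma lintegral_sqSum_sq [SFinite μ₂] (b : H₁.Index × H₂.Index → ℝ≥0∞) :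
    ∫⁻ x, sqSum H₁ H₂ b x ^ 2 ∂(μ₁.prod μ₂) = ∑' i, b i ^ 2 := by
  rw [← setLIntegral_univ, setLIntegral_sqSum_sq h₁]
  refine tsum_congr fun i => ?_
  rw [inter_univ, ENNReal.inv_mul_cancel (measure_rect_ne_zero h₁ h₂ i)
    (measure_rect_ne_top h₁ h₂ i), mul_one]

/-- The duality inequality between Carleson sequences and sequences with integrable square
function. The rectangles are sorted by the level sets `{S > 2 ^ k}` of the square function `S`
of which they are filled by more than one half. -/
theorem tsum_mul_le_of_carleson [SigmaFinite μ₁] [SigmaFinite μ₂]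
    {a b : H₁.Index × H₂.Index → ℝ≥0∞} {B : ℝ≥0∞}
    (hB : ∀ Ω : Set (X₁ × X₂), MeasurableSet Ω → μ₁.prod μ₂ Ω < ∞ →
      ∑' i : {i // rect H₁ H₂ i ⊆ Ω}, a i ^ 2 ≤ B ^ 2 * μ₁.prod μ₂ Ω)
    (hb : ∫⁻ x, sqSum H₁ H₂ b x ∂(μ₁.prod μ₂) ≠ ∞) :
    ∑' i, a i * b i ≤ 96 * B * ∫⁻ x, sqSum H₁ H₂ b x ∂(μ₁.prod μ₂) := by
  set S := sqSum H₁ H₂ b with hS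
  set μ := μ₁.prod μ₂
  have hSm : Measurable S := measurable_sqSum b
  set U : ℤ → Set (X₁ × X₂) := fun k => {x | (2 : ℝ≥0∞) ^ k < S x} with hU
  have hUm : ∀ k, MeasurableSet (U k) := fun k => measurableSet_lt measurable_const hSm
  have h2pos : ∀ k : ℤ, (2 : ℝ≥0∞) ^ k ≠ 0 := fun k =>
    (ENNReal.zpow_pos two_ne_zero (by simp) k).ne'
  have h2top : ∀ k : ℤ, (2 : ℝ≥0∞) ^ k ≠ ∞ := fun k => ENNReal.zpow_ne_top two_ne_zero (by simp) k
  have hUle : ∀ k, 2 ^ k * μ (U k) ≤ ∫⁻ x, S x ∂μ := fun k =>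
    le_trans (by gcongr; exact fun x (hx : (2 : ℝ≥0∞) ^ k < S x) => hx.le)
      (mul_meas_ge_le_lintegral hSm (2 ^ k))
  set V : ℤ → Set (X₁ × X₂) := fun k => rectEnlargement H₁ H₂ (U k)
  have hVm : ∀ k, MeasurableSet (V k) := fun k => measurableSet_rectEnlargement H₁ H₂ (hUm k)
  have hVle : ∀ k, μ (V k) ≤ 16 * μ (U k) := fun k => measure_rectEnlargement_le H₁ H₂ (hUm k)
  have hUfin : ∀ k, μ (U k) < ∞ := fun k => by
    by_contra h
    have h1 := hUle k
    rw [not_lt_top_iff.1 h, ENNReal.mul_top (h2pos k)] at h1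
    exact hb (top_le_iff.1 h1)
  have hVfin : ∀ k, μ (V k) < ∞ := fun k =>
    (hVle k).trans_lt (ENNReal.mul_lt_top (by simp) (hUfin k))
  let P : H₁.Index × H₂.Index → ℤ → Prop := fun i k =>
    μ (rect H₁ H₂ i) < 2 * μ (rect H₁ H₂ i ∩ U k)
  set 𝓑 : ℤ → Set (H₁.Index × H₂.Index) := fun k => {i | P i k ∧ ¬ P i (k + 1)}
  -- Each relevant index belongs to one of the classes: its rectangle is contained in the level sets
  -- of low level, because the square function is bounded below on it, and is not filled by those of
  -- high level, because the square function is integrable.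
  have hcover : Function.support (fun i => a i * b i) ⊆ ⋃ k, 𝓑 k := by
    intro i hi
    have hbi : b i ≠ 0 := right_ne_zero_of_mul hi
    have hR0 := measure_rect_ne_zero h₁ h₂ i
    have hRt := measure_rect_ne_top h₁ h₂ i
    have hSi : ∀ x ∈ rect H₁ H₂ i, b i ^ 2 * (μ (rect H₁ H₂ i))⁻¹ ≤ S x ^ 2 := by
      intro x hx
      rw [hS, sqSum_sq]
      refine le_trans ?_ (ENNReal.le_tsum i)
      rw [sqSum_term_eq h₁, indicator_of_mem hx]
    have hne : ∃ k, P i k := by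
      have hpos : 0 < b i ^ 2 * (μ (rect H₁ H₂ i))⁻¹ :=
        ENNReal.mul_pos (pow_ne_zero 2 hbi) (ENNReal.inv_ne_zero.2 hRt)
      obtain ⟨n, hn⟩ : ∃ n : ℕ, ((2 : ℝ≥0∞) ^ (-(n : ℤ))) ^ 2 <
          b i ^ 2 * (μ (rect H₁ H₂ i))⁻¹ := by
        have ht : Tendsto (fun n : ℕ => ((2 : ℝ≥0∞)⁻¹ ^ n) ^ 2) atTop (𝓝 (0 ^ 2)) :=
          ((ENNReal.continuous_pow 2).tendsto 0).comp
            (ENNReal.tendsto_pow_atTop_nhds_zero_of_lt_one ENNReal.one_half_lt_one)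
        rw [zero_pow two_ne_zero] at ht
        obtain ⟨n, hn⟩ := (ht.eventually (gt_mem_nhds hpos)).exists
        refine ⟨n, ?_⟩
        rwa [ENNReal.zpow_neg, zpow_natCast, ENNReal.inv_pow]
      refine ⟨-n, ?_⟩
      have hsub : rect H₁ H₂ i ⊆ U (-n) := fun x hx =>
        lt_of_not_ge fun h =>
        absurd (hn.trans_le (hSi x hx)) (not_lt.2 (pow_le_pow_left' h 2))
      change μ (rect H₁ H₂ i) < 2 * μ (rect H₁ H₂ i ∩ U (-n))
      rw [inter_eq_left.2 hsub, two_mul]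
      exact ENNReal.lt_add_right hRt hR0
    have hbdd : ∃ N : ℤ, ∀ k, P i k → k ≤ N := by
      obtain ⟨N, hN⟩ : ∃ N : ℕ, 2 * ∫⁻ x, S x ∂μ < 2 ^ N * μ (rect H₁ H₂ i) := by
        have ht : Tendsto (fun N : ℕ => (2 : ℝ≥0∞) ^ N * μ (rect H₁ H₂ i)) atTop
            (𝓝 (∞ * μ (rect H₁ H₂ i))) :=
          ENNReal.Tendsto.mul_const (ENNReal.tendsto_pow_atTop_nhds_top_iff.2
            ENNReal.one_lt_two) (Or.inl (by simp))
        rw [ENNReal.top_mul hR0] at ht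
        exact (ht.eventually (lt_mem_nhds (ENNReal.mul_lt_top (by simp) hb.lt_top))).exists
      refine ⟨N, fun k hk => ?_⟩
      by_contra hlt
      have h1 : (2 : ℝ≥0∞) ^ (N : ℤ) ≤ 2 ^ k :=
        ENNReal.zpow_le_of_le one_le_two (by omega)
      have h2 : 2 ^ k * μ (rect H₁ H₂ i) ≤ 2 * ∫⁻ x, S x ∂μ := by
        calc 2 ^ k * μ (rect H₁ H₂ i) ≤ 2 ^ k * (2 * μ (rect H₁ H₂ i ∩ U k)) := by
              gcongr
          _ ≤ 2 ^ k * (2 * μ (U k)) := by gcongr; exact inter_subset_right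
          _ = 2 * (2 ^ k * μ (U k)) := by ring
          _ ≤ 2 * ∫⁻ x, S x ∂μ := by gcongr; exact hUle k
      refine absurd (h2.trans_lt hN) (not_lt.2 ?_)
      rw [← zpow_natCast]
      gcongr
    obtain ⟨k, hk, hmax⟩ := Int.exists_greatest_of_bdd hbdd hne
    exact mem_iUnion.2 ⟨k, hk, fun h => by have := hmax _ h; omega⟩
  -- The bound for one class. At least half of each rectangle lies where `S ≤ 2 ^ (k + 1)`.
  have hclass : ∀ k, ∑' i : 𝓑 k, a i * b i ≤ 48 * B * (2 ^ k * μ (U k)) := by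
    intro k
    have hsub : ∀ i ∈ 𝓑 k, rect H₁ H₂ i ⊆ V k := fun i hi =>
      prod_subset_rectEnlargement H₁ H₂ (hUm k) i.1.2.1.2 i.2.2.1.2 hi.1
    have hA : ∑' i : 𝓑 k, a i ^ 2 ≤ B ^ 2 * μ (V k) :=
      (ENNReal.tsum_mono_subtype (fun i => a i ^ 2) hsub).trans (hB (V k) (hVm k) (hVfin k))
    have hD : ∑' i : 𝓑 k, b i ^ 2 ≤ (3 * 2 ^ k) ^ 2 * μ (V k) := by
      calc ∑' i : 𝓑 k, b i ^ 2
          ≤ ∑' i : 𝓑 k, 2 * (b i ^ 2 * ((μ (rect H₁ H₂ i))⁻¹ *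
              μ (rect H₁ H₂ i ∩ (V k \ U (k + 1))))) := by
            refine ENNReal.tsum_le_tsum fun ⟨i, hi⟩ => ?_
            have hR0 := measure_rect_ne_zero h₁ h₂ i
            have hRt := measure_rect_ne_top h₁ h₂ i
            have hi2 : 2 * μ (rect H₁ H₂ i ∩ U (k + 1)) ≤ μ (rect H₁ H₂ i) := not_lt.1 hi.2
            have heq : rect H₁ H₂ i ∩ (V k \ U (k + 1)) = rect H₁ H₂ i \ U (k + 1) := by
              rw [← inter_sdiff_assoc, inter_eq_left.2 (hsub i hi)]
            have hhalf : μ (rect H₁ H₂ i) ≤ 2 * μ (rect H₁ H₂ i ∩ (V k \ U (k + 1))) := by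
              rw [heq]
              have h := measure_inter_add_sdiff (μ := μ) (rect H₁ H₂ i) (hUm (k + 1))
              have hne : 2 * μ (rect H₁ H₂ i ∩ U (k + 1)) ≠ ∞ := ne_top_of_le_ne_top hRt hi2
              refine (ENNReal.add_le_add_iff_left hne).1 ?_
              rw [← mul_add, h, two_mul (μ (rect H₁ H₂ i))]
              gcongr
            calc b i ^ 2 = b i ^ 2 * ((μ (rect H₁ H₂ i))⁻¹ * μ (rect H₁ H₂ i)) := by
                  rw [ENNReal.inv_mul_cancel hR0 hRt, mul_one]
              _ ≤ b i ^ 2 * ((μ (rect H₁ H₂ i))⁻¹ *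
                    (2 * μ (rect H₁ H₂ i ∩ (V k \ U (k + 1))))) := by gcongr
              _ = 2 * (b i ^ 2 * ((μ (rect H₁ H₂ i))⁻¹ *
                    μ (rect H₁ H₂ i ∩ (V k \ U (k + 1))))) := by ring
        _ ≤ ∑' i, 2 * (b i ^ 2 * ((μ (rect H₁ H₂ i))⁻¹ *
              μ (rect H₁ H₂ i ∩ (V k \ U (k + 1))))) :=
            ENNReal.tsum_comp_le_tsum_of_injective Subtype.val_injective _
        _ = 2 * ∫⁻ x in V k \ U (k + 1), S x ^ 2 ∂μ := by
            rw [ENNReal.tsum_mul_left, setLIntegral_sqSum_sq h₁]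
        _ ≤ 2 * ∫⁻ x in V k \ U (k + 1), (2 ^ (k + 1)) ^ 2 ∂μ := by
            gcongr 2 * ?_
            refine setLIntegral_mono measurable_const fun x hx => ?_
            gcongr
            exact not_lt.1 hx.2
        _ ≤ 2 * ((2 ^ (k + 1)) ^ 2 * μ (V k)) := by
            rw [setLIntegral_const]
            gcongr
            exact sdiff_subset
        -- The constant `8` is rounded up to a square.
        _ ≤ (3 * 2 ^ k) ^ 2 * μ (V k) := by
            rw [ENNReal.zpow_add two_ne_zero (by simp), zpow_one, mul_pow, mul_pow]
            calc 2 * ((2 ^ k) ^ 2 * 2 ^ 2 * μ (V k)) = 8 * ((2 ^ k) ^ 2 * μ (V k)) := by ring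
              _ ≤ 9 * ((2 ^ k) ^ 2 * μ (V k)) := by gcongr; norm_num
              _ = 3 ^ 2 * (2 ^ k) ^ 2 * μ (V k) := by ring
    calc ∑' i : 𝓑 k, a i * b i ≤ B * (3 * 2 ^ k) * μ (V k) := ENNReal_tsum_mul_le_of_sq_le hA hD
      _ ≤ B * (3 * 2 ^ k) * (16 * μ (U k)) := by gcongr; exact hVle k
      _ = 48 * B * (2 ^ k * μ (U k)) := by ring
  calc ∑' i, a i * b i = ∑' i : (⋃ k, 𝓑 k), a i * b i :=
        (tsum_subtype_eq_of_support_subset hcover).symm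
    _ ≤ ∑' k, ∑' i : 𝓑 k, a i * b i := ENNReal.tsum_iUnion_le_tsum (fun i => a i * b i) 𝓑
    _ ≤ ∑' k : ℤ, 48 * B * (2 ^ k * μ (U k)) := ENNReal.tsum_le_tsum hclass
    _ = 48 * B * ∑' k : ℤ, 2 ^ k * μ (U k) := ENNReal.tsum_mul_left
    _ = 48 * B * ∫⁻ x, ∑' k : ℤ, (if (2 : ℝ≥0∞) ^ k < S x then (2 : ℝ≥0∞) ^ k else 0) ∂μ := by
        rw [lintegral_tsum fun k => (Measurable.ite (hUm k) measurable_const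
          measurable_const).aemeasurable]
        congr 1
        refine tsum_congr fun k => ?_
        rw [← lintegral_indicator_const (hUm k)]
        refine lintegral_congr fun x => ?_
        by_cases hx : (2 : ℝ≥0∞) ^ k < S x
        · rw [if_pos hx, indicator_of_mem (show x ∈ U k from hx)]
        · rw [if_neg hx, indicator_of_notMem (show x ∉ U k from hx)]
    _ ≤ 48 * B * ∫⁻ x, 2 * S x ∂μ := by
        gcongr with x
        exact tsum_two_zpow_le (S x)
    _ = 96 * B * ∫⁻ x, S x ∂μ := by
        rw [lintegral_const_mul _ hSm]
        ring

end

lemma tsum_le_bmoNorm [TopologicalSpace X₁] [TopologicalSpace X₂] [SFinite μ₂]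
    (h₁ : H₁.Regular T₁ x₁)
    (h₂ : H₂.Regular T₂ x₂) {𝕜 : Type*} [RCLike 𝕜] (φ : X₁ × X₂ → 𝕜) {Ω : Set (X₁ × X₂)}
    (hΩ : IsOpen Ω) (hfin : μ₁.prod μ₂ Ω < ∞) :
    ∑' i : {i // rect H₁ H₂ i ⊆ Ω}, ‖haarCoeff H₁ H₂ φ i‖ₑ ^ 2 ≤
      bmoNorm H₁ H₂ φ ^ 2 * μ₁.prod μ₂ Ω := by
  rcases eq_or_ne (μ₁.prod μ₂ Ω) 0 with h0 | h0
  · have : IsEmpty {i // rect H₁ H₂ i ⊆ Ω} :=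
      ⟨fun ⟨i, hi⟩ => measure_rect_ne_zero h₁ h₂ i (measure_mono_null hi h0)⟩
    simp
  · have h : ((μ₁.prod μ₂ Ω)⁻¹ * ∑' i : {i // rect H₁ H₂ i ⊆ Ω},
        ‖haarCoeff H₁ H₂ φ i‖ₑ ^ 2) ^ (1 / 2 : ℝ) ≤ bmoNorm H₁ H₂ φ :=
      le_iSup₂_of_le Ω hΩ (le_iSup_of_le hfin le_rfl)
    have h' := ENNReal.rpow_le_rpow h (zero_le_two (α := ℝ))
    rw [← ENNReal.rpow_mul, ENNReal.rpow_two] at h'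
    norm_num at h'
    rw [mul_comm (bmoNorm H₁ H₂ φ ^ 2)]
    exact (ENNReal.inv_mul_le_iff h0 hfin.ne).1 h'

/-- By outer regularity, the Carleson condition extends from open sets to all sets of finite
measure. -/
lemma IsBMO.carleson [TopologicalSpace X₁] [TopologicalSpace X₂] [SFinite μ₂]
    [(μ₁.prod μ₂).OuterRegular] (h₁ : H₁.Regular T₁ x₁) (h₂ : H₂.Regular T₂ x₂)
    {𝕜 : Type*} [RCLike 𝕜] {φ : X₁ × X₂ → 𝕜} (hφ : IsBMO H₁ H₂ φ) {Ω : Set (X₁ × X₂)}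
    (hfin : μ₁.prod μ₂ Ω < ∞) :
    ∑' i : {i // rect H₁ H₂ i ⊆ Ω}, ‖haarCoeff H₁ H₂ φ i‖ₑ ^ 2 ≤
      bmoNorm H₁ H₂ φ ^ 2 * μ₁.prod μ₂ Ω := by
  have hB : bmoNorm H₁ H₂ φ ^ 2 ≠ ∞ := ENNReal.pow_ne_top hφ.bmoNorm_lt_top.ne
  have key : ∀ ε : ℝ≥0, 0 < ε → ∑' i : {i // rect H₁ H₂ i ⊆ Ω}, ‖haarCoeff H₁ H₂ φ i‖ₑ ^ 2 ≤
      bmoNorm H₁ H₂ φ ^ 2 * (μ₁.prod μ₂ Ω + ε) := by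
    intro ε hε
    obtain ⟨U, hΩU, hU, hUε⟩ := Ω.exists_isOpen_le_add (μ₁.prod μ₂) (ε := ε)
      (ENNReal.coe_ne_zero.2 hε.ne')
    have hUfin : μ₁.prod μ₂ U < ∞ :=
      hUε.trans_lt (ENNReal.add_lt_top.2 ⟨hfin, ENNReal.coe_lt_top⟩)
    calc ∑' i : {i // rect H₁ H₂ i ⊆ Ω}, ‖haarCoeff H₁ H₂ φ i‖ₑ ^ 2
        ≤ ∑' i : {i // rect H₁ H₂ i ⊆ U}, ‖haarCoeff H₁ H₂ φ i‖ₑ ^ 2 :=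
          ENNReal.tsum_mono_subtype (fun i => ‖haarCoeff H₁ H₂ φ i‖ₑ ^ 2)
            (s := {i | rect H₁ H₂ i ⊆ Ω}) (t := {i | rect H₁ H₂ i ⊆ U})
            fun i hi => subset_trans hi hΩU
      _ ≤ bmoNorm H₁ H₂ φ ^ 2 * μ₁.prod μ₂ U := tsum_le_bmoNorm h₁ h₂ φ hU hUfin
      _ ≤ _ := by gcongr
  have hlim : Tendsto (fun ε : ℝ≥0 => bmoNorm H₁ H₂ φ ^ 2 * (μ₁.prod μ₂ Ω + ε)) (𝓝[>] 0)
      (𝓝 (bmoNorm H₁ H₂ φ ^ 2 * (μ₁.prod μ₂ Ω + (0 : ℝ≥0)))) := by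
    refine ENNReal.Tendsto.const_mul (Tendsto.mono_left ?_ nhdsWithin_le_nhds) (Or.inr hB)
    exact tendsto_const_nhds.add (ENNReal.continuous_coe.tendsto 0)
  rw [ENNReal.coe_zero, add_zero] at hlim
  exact ge_of_tendsto hlim (eventually_mem_nhdsWithin.mono fun ε hε => key ε hε)

end Carleson

/-! ### The product Haar functions in `L²` -/

section Tensor

variable (𝕜 : Type*) [RCLike 𝕜] {X₁ X₂ : Type*} [MeasurableSpace X₁] [MeasurableSpace X₂]
  {μ₁ : Measure X₁} {μ₂ : Measure X₂}

/-- The tensor product of two real functions, as a function with values in `𝕜`. -/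
def tensor (p : X₁ → ℝ) (q : X₂ → ℝ) (x : X₁ × X₂) : 𝕜 := ((p x.1 * q x.2 : ℝ) : 𝕜)

variable {𝕜}

omit [MeasurableSpace X₁] [MeasurableSpace X₂] in
lemma tensor_mul_tensor (p p' : X₁ → ℝ) (q q' : X₂ → ℝ) (x : X₁ × X₂) :
    tensor 𝕜 p q x * tensor 𝕜 p' q' x =
      tensor 𝕜 (fun y => p y * p' y) (fun y => q y * q' y) x := by
  simp only [tensor]
  push_cast
  ring

lemma integral_tensor [SFinite μ₁] [SFinite μ₂] (p : X₁ → ℝ) (q : X₂ → ℝ) :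
    ∫ x, tensor 𝕜 p q x ∂(μ₁.prod μ₂) = (((∫ x, p x ∂μ₁) * ∫ x, q x ∂μ₂ : ℝ) : 𝕜) := by
  simp only [tensor]
  rw [integral_ofReal, integral_prod_mul]

lemma integrable_tensor [SFinite μ₂] {p : X₁ → ℝ} {q : X₂ → ℝ}
    (hp : Integrable p μ₁) (hq : Integrable q μ₂) :
    Integrable (tensor 𝕜 p q) (μ₁.prod μ₂) := (hp.mul_prod hq).ofReal

lemma memLp_two_tensor [SFinite μ₁] [SFinite μ₂] {p : X₁ → ℝ} {q : X₂ → ℝ} (hp : MemLp p 2 μ₁)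
    (hq : MemLp q 2 μ₂) : MemLp (tensor 𝕜 p q) 2 (μ₁.prod μ₂) := by
  refine MemLp.ofReal ?_
  have hm : AEStronglyMeasurable (fun x : X₁ × X₂ => p x.1 * q x.2) (μ₁.prod μ₂) :=
    hp.1.comp_fst.mul hq.1.comp_snd
  rw [memLp_two_iff_integrable_sq_norm hm]
  have := ((memLp_two_iff_integrable_sq_norm hp.1).1 hp).mul_prod
    ((memLp_two_iff_integrable_sq_norm hq.1).1 hq)
  refine this.congr (Eventually.of_forall fun x => ?_)
  simp only [norm_mul, mul_pow]

/-- Tensor products of orthonormal families are orthonormal. -/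
lemma orthonormal_tensor [SFinite μ₁] [SFinite μ₂] {J₁ J₂ : Type*} [DecidableEq J₁]
    [DecidableEq J₂] {p : J₁ → X₁ → ℝ} {q : J₂ → X₂ → ℝ} (hp : ∀ j, MemLp (p j) 2 μ₁)
    (hq : ∀ j, MemLp (q j) 2 μ₂)
    (hpo : ∀ i j, ∫ x, p i x * p j x ∂μ₁ = if i = j then 1 else 0)
    (hqo : ∀ i j, ∫ x, q i x * q j x ∂μ₂ = if i = j then 1 else 0) :
    Orthonormal 𝕜 fun j : J₁ × J₂ =>
      ((memLp_two_tensor (hp j.1) (hq j.2)).toLp (tensor 𝕜 (p j.1) (q j.2)) :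
        Lp 𝕜 2 (μ₁.prod μ₂)) := by
  rw [orthonormal_iff_ite]
  rintro ⟨i₁, i₂⟩ ⟨j₁, j₂⟩
  rw [L2.inner_def]
  have : ∫ x, tensor 𝕜 (p i₁) (q i₂) x * tensor 𝕜 (p j₁) (q j₂) x ∂(μ₁.prod μ₂) =
      if (i₁, i₂) = (j₁, j₂) then 1 else 0 := by
    simp_rw [tensor_mul_tensor]
    rw [integral_tensor, hpo, hqo]
    simp only [Prod.mk.injEq]
    split_ifs <;> simp_all
  rw [← this]
  refine integral_congr_ae ?_
  filter_upwards [(memLp_two_tensor (𝕜 := 𝕜) (hp i₁) (hq i₂)).coeFn_toLp,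
    (memLp_two_tensor (𝕜 := 𝕜) (hp j₁) (hq j₂)).coeFn_toLp] with x h1 h2
  rw [h1, h2, RCLike.inner_apply, mul_comm]
  simp [tensor]

lemma memLp_two_of_integrable_of_bdd {X : Type*} [MeasurableSpace X] {μ : Measure X} {f : X → ℝ}
    (hf : Integrable f μ) {B : ℝ} (hB : ∀ x, ‖f x‖ ≤ B) : MemLp f 2 μ := by
  rw [memLp_two_iff_integrable_sq_norm hf.1]
  simp_rw [pow_two]
  exact hf.norm.bdd_mul hf.1.norm (Eventually.of_forall fun x => by simpa using hB x)

lemma summable_orthonormal_smul {ι E : Type*} [NormedAddCommGroup E] [InnerProductSpace 𝕜 E]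
    [CompleteSpace E] {e : ι → E} (he : Orthonormal 𝕜 e) {c : ι → 𝕜}
    (hc : Summable fun i => ‖c i‖ ^ 2) : Summable fun i => c i • e i := by
  have := (he.orthogonalFamily.summable_iff_norm_sq_summable (f := c)).2 hc
  simpa using this

/-- Bessel's inequality in `L²`. -/
lemma tsum_enorm_inner_sq_le {ι E : Type*} [NormedAddCommGroup E] [InnerProductSpace 𝕜 E]
    {e : ι → E} (he : Orthonormal 𝕜 e) (v : E) :
    ∑' i, ‖inner 𝕜 (e i) v‖ₑ ^ 2 ≤ ‖v‖ₑ ^ 2 := by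
  refine ENNReal.summable.tsum_le_of_sum_le fun s => ?_
  have h := ENNReal.ofReal_le_ofReal (he.sum_inner_products_le v (s := s))
  rw [ENNReal.ofReal_sum_of_nonneg fun i _ => by positivity, ENNReal.ofReal_pow (norm_nonneg _),
    ofReal_norm] at h
  refine le_trans (Finset.sum_le_sum fun i _ => ?_) h
  rw [ENNReal.ofReal_pow (norm_nonneg _), ofReal_norm]

end Tensor

section ProductHaar

variable {𝕜 : Type*} [RCLike 𝕜] {X₁ X₂ : Type*} [MeasurableSpace X₁] [MeasurableSpace X₂]
  {ρ₁ : X₁ → X₁ → ℝ} {ρ₂ : X₂ → X₂ → ℝ} {μ₁ : Measure X₁} {μ₂ : Measure X₂}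

variable (𝕜) in
/-- The product Haar function `h_{Q₁}^{u₁} h_{Q₂}^{u₂}`. -/
noncomputable def prodHaar (H₁ : HaarSystem ρ₁ μ₁) (H₂ : HaarSystem ρ₂ μ₂)
    (i : H₁.Index × H₂.Index) : X₁ × X₂ → 𝕜 := tensor 𝕜 (H₁.haar i.1) (H₂.haar i.2)

variable {H₁ : HaarSystem ρ₁ μ₁} {H₂ : HaarSystem ρ₂ μ₂}

lemma haarCoeff_eq (f : X₁ × X₂ → 𝕜) (i : H₁.Index × H₂.Index) :
    haarCoeff H₁ H₂ f i = ∫ x, prodHaar 𝕜 H₁ H₂ i x * f x ∂(μ₁.prod μ₂) := by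
  simp only [haarCoeff, prodHaar, tensor, RCLike.real_smul_eq_coe_mul]

lemma measurable_prodHaar (i : H₁.Index × H₂.Index) : Measurable (prodHaar 𝕜 H₁ H₂ i) :=
  RCLike.measurable_ofReal.comp (((H₁.measurable_haar i.1).comp measurable_fst).mul
    ((H₂.measurable_haar i.2).comp measurable_snd))

variable (𝕜) in
lemma exists_bound_prodHaar (i : H₁.Index × H₂.Index) :
    ∃ B : ℝ, ∀ x, ‖prodHaar 𝕜 H₁ H₂ i x‖ ≤ B := by
  obtain ⟨B₁, hB₁⟩ := H₁.exists_bound_haar i.1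
  obtain ⟨B₂, hB₂⟩ := H₂.exists_bound_haar i.2
  refine ⟨B₁ * B₂, fun x => ?_⟩
  simp only [prodHaar, tensor, RCLike.norm_ofReal, abs_mul]
  exact mul_le_mul (hB₁ _) (hB₂ _) (abs_nonneg _) ((norm_nonneg _).trans (hB₁ x.1))

lemma prodHaar_eq_zero {i : H₁.Index × H₂.Index} {x : X₁ × X₂} (hx : x ∉ rect H₁ H₂ i) :
    prodHaar 𝕜 H₁ H₂ i x = 0 := by
  by_cases h : x.1 ∈ H₁.cube i.1
  · have : x.2 ∉ H₂.cube i.2 := fun h' => hx ⟨h, h'⟩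
    simp [prodHaar, tensor, H₂.haar_eq_zero i.2 this]
  · simp [prodHaar, tensor, H₁.haar_eq_zero i.1 h]

/-- A finite linear combination of product Haar functions. -/
noncomputable def haarSum (H₁ : HaarSystem ρ₁ μ₁) (H₂ : HaarSystem ρ₂ μ₂)
    (a : H₁.Index × H₂.Index → 𝕜)
    (F : Finset (H₁.Index × H₂.Index)) : X₁ × X₂ → 𝕜 :=
  fun x => ∑ i ∈ F, a i * prodHaar 𝕜 H₁ H₂ i x

lemma measurable_haarSum (a : H₁.Index × H₂.Index → 𝕜) (F : Finset (H₁.Index × H₂.Index)) :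
    Measurable (haarSum H₁ H₂ a F) :=
  Finset.measurable_sum _ fun i _ => (measurable_prodHaar i).const_mul _

lemma exists_bound_haarSum (a : H₁.Index × H₂.Index → 𝕜) (F : Finset (H₁.Index × H₂.Index)) :
    ∃ B : ℝ, ∀ x, ‖haarSum H₁ H₂ a F x‖ ≤ B := by
  choose B hB using fun i => exists_bound_prodHaar 𝕜 (H₁ := H₁) (H₂ := H₂) i
  refine ⟨∑ i ∈ F, ‖a i‖ * B i, fun x => norm_sum_le_of_le _ fun i _ => ?_⟩
  rw [norm_mul]
  gcongr
  exact hB i x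

variable {T₁ : ℕ → Set X₁} {x₁ : X₁} {T₂ : ℕ → Set X₂} {x₂ : X₂}
  (h₁ : H₁.Regular T₁ x₁) (h₂ : H₂.Regular T₂ x₂)

lemma HaarSystem.Regular.memLp_two_haar {X : Type*} [MeasurableSpace X] {ρ : X → X → ℝ}
    {μ : Measure X} {H : HaarSystem ρ μ} {T : ℕ → Set X} {x₀ : X} (h : H.Regular T x₀)
    (i : H.Index) : MemLp (H.haar i) 2 μ := by
  obtain ⟨B, hB⟩ := H.exists_bound_haar i
  exact memLp_two_of_integrable_of_bdd (h.integrable_haar i) hB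

include h₁ h₂

variable (𝕜) in
lemma integrable_prodHaar [SFinite μ₂] (i : H₁.Index × H₂.Index) :
    Integrable (prodHaar 𝕜 H₁ H₂ i) (μ₁.prod μ₂) :=
  integrable_tensor (h₁.integrable_haar i.1) (h₂.integrable_haar i.2)

lemma integrable_haarSum [SFinite μ₂] (a : H₁.Index × H₂.Index → 𝕜)
    (F : Finset (H₁.Index × H₂.Index)) : Integrable (haarSum H₁ H₂ a F) (μ₁.prod μ₂) :=
  integrable_finsetSum _ fun i _ => (integrable_prodHaar 𝕜 h₁ h₂ i).const_mul _

variable [SigmaFinite μ₁] [SigmaFinite μ₂]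

variable (𝕜) in
lemma memLp_two_prodHaar (i : H₁.Index × H₂.Index) :
    MemLp (prodHaar 𝕜 H₁ H₂ i) 2 (μ₁.prod μ₂) :=
  memLp_two_tensor (h₁.memLp_two_haar i.1) (h₂.memLp_two_haar i.2)

lemma memLp_two_haarSum (a : H₁.Index × H₂.Index → 𝕜)
    (F : Finset (H₁.Index × H₂.Index)) : MemLp (haarSum H₁ H₂ a F) 2 (μ₁.prod μ₂) :=
  memLp_finsetSum _ fun i _ => (memLp_two_prodHaar 𝕜 h₁ h₂ i).const_mul _

variable (𝕜) in
lemma orthonormal_prodHaar : Orthonormal 𝕜 fun i : H₁.Index × H₂.Index =>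
    (memLp_two_prodHaar 𝕜 h₁ h₂ i).toLp (prodHaar 𝕜 H₁ H₂ i) := by
  classical
  exact orthonormal_tensor h₁.memLp_two_haar h₂.memLp_two_haar
    (fun i j => h₁.integral_haar_mul i j) fun i j => h₂.integral_haar_mul i j

lemma haarCoeff_eq_inner {f : X₁ × X₂ → 𝕜} (hf : MemLp f 2 (μ₁.prod μ₂))
    (i : H₁.Index × H₂.Index) : haarCoeff H₁ H₂ f i =
      inner 𝕜 ((memLp_two_prodHaar 𝕜 h₁ h₂ i).toLp (prodHaar 𝕜 H₁ H₂ i)) (hf.toLp f) := by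
  rw [haarCoeff_eq, L2.inner_def]
  refine integral_congr_ae ?_
  filter_upwards [(memLp_two_prodHaar 𝕜 h₁ h₂ i).coeFn_toLp, hf.coeFn_toLp] with x e1 e2
  rw [e1, e2, RCLike.inner_apply, mul_comm]
  simp [prodHaar, tensor]

lemma haarCoeff_prodHaar [DecidableEq (H₁.Index × H₂.Index)] (i j : H₁.Index × H₂.Index) :
    haarCoeff H₁ H₂ (prodHaar 𝕜 H₁ H₂ i) j = if j = i then 1 else 0 := by
  rw [haarCoeff_eq_inner h₁ h₂ (memLp_two_prodHaar 𝕜 h₁ h₂ i)]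
  exact orthonormal_iff_ite.1 (orthonormal_prodHaar 𝕜 h₁ h₂) j i

lemma haarCoeff_haarSum (a : H₁.Index × H₂.Index → 𝕜) (F : Finset (H₁.Index × H₂.Index))
    [DecidableEq (H₁.Index × H₂.Index)]
    (j : H₁.Index × H₂.Index) :
    haarCoeff H₁ H₂ (haarSum H₁ H₂ a F) j = if j ∈ F then a j else 0 := by
  rw [haarCoeff_eq]
  simp only [haarSum, Finset.mul_sum]
  have hint : ∀ i, Integrable (fun x => prodHaar 𝕜 H₁ H₂ j x * (a i * prodHaar 𝕜 H₁ H₂ i x))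
      (μ₁.prod μ₂) := by
    intro i
    obtain ⟨B, hB⟩ := exists_bound_prodHaar 𝕜 (H₁ := H₁) (H₂ := H₂) j
    exact ((integrable_prodHaar 𝕜 h₁ h₂ i).const_mul _).bdd_mul
      (measurable_prodHaar j).aestronglyMeasurable (Eventually.of_forall hB)
  rw [integral_finsetSum _ fun i _ => hint i]
  have : ∀ i, ∫ x, prodHaar 𝕜 H₁ H₂ j x * (a i * prodHaar 𝕜 H₁ H₂ i x) ∂(μ₁.prod μ₂) =
      if j = i then a i else 0 := by
    intro i
    simp_rw [mul_left_comm _ (a i)]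
    rw [integral_const_mul, ← haarCoeff_eq, haarCoeff_prodHaar h₁ h₂]
    simp
  simp_rw [this]
  exact Finset.sum_ite_eq F j a

/-- Bessel's inequality for Haar coefficients. -/
lemma tsum_haarCoeff_sq_le {f : X₁ × X₂ → 𝕜} (hf : MemLp f 2 (μ₁.prod μ₂)) :
    ∑' i, ‖haarCoeff H₁ H₂ f i‖ₑ ^ 2 ≤ eLpNorm f 2 (μ₁.prod μ₂) ^ 2 := by
  simp_rw [haarCoeff_eq_inner h₁ h₂ hf]
  refine (tsum_enorm_inner_sq_le (orthonormal_prodHaar 𝕜 h₁ h₂) _).trans_eq ?_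
  rw [Lp.enorm_toLp]

/-- The Haar coefficients of a bounded function form a Carleson sequence. -/
lemma carleson_of_norm_le_one {ψ : X₁ × X₂ → 𝕜} (hψm : Measurable ψ) (hψ : ∀ x, ‖ψ x‖ ≤ 1)
    {Ω : Set (X₁ × X₂)} (hΩ : MeasurableSet Ω) (hfin : μ₁.prod μ₂ Ω < ∞) :
    ∑' i : {i // rect H₁ H₂ i ⊆ Ω}, ‖haarCoeff H₁ H₂ ψ i‖ₑ ^ 2 ≤ μ₁.prod μ₂ Ω := by
  have h1 : MemLp (Ω.indicator fun _ => (1 : ℝ)) 2 (μ₁.prod μ₂) :=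
    memLp_indicator_const 2 hΩ 1 (Or.inr hfin.ne)
  have hbd : ∀ x, ‖Ω.indicator ψ x‖ ≤ ‖Ω.indicator (fun _ => (1 : ℝ)) x‖ := fun x => by
    by_cases hx : x ∈ Ω
    · simpa [hx] using hψ x
    · simp [hx]
  have h2 : MemLp (Ω.indicator ψ) 2 (μ₁.prod μ₂) :=
    h1.of_le (hψm.indicator hΩ).aestronglyMeasurable (Eventually.of_forall hbd)
  have hco : ∀ i, rect H₁ H₂ i ⊆ Ω →
      haarCoeff H₁ H₂ ψ i = haarCoeff H₁ H₂ (Ω.indicator ψ) i := by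
    intro i hi
    rw [haarCoeff_eq, haarCoeff_eq]
    refine integral_congr_ae (Eventually.of_forall fun x => ?_)
    by_cases hx : x ∈ Ω
    · simp [hx]
    · simp [prodHaar_eq_zero fun h => hx (hi h)]
  calc ∑' i : {i // rect H₁ H₂ i ⊆ Ω}, ‖haarCoeff H₁ H₂ ψ i‖ₑ ^ 2
      = ∑' i : {i // rect H₁ H₂ i ⊆ Ω}, ‖haarCoeff H₁ H₂ (Ω.indicator ψ) i‖ₑ ^ 2 :=
        tsum_congr fun i => by rw [hco i i.2]
    _ ≤ ∑' i, ‖haarCoeff H₁ H₂ (Ω.indicator ψ) i‖ₑ ^ 2 :=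
        ENNReal.tsum_comp_le_tsum_of_injective Subtype.val_injective _
    _ ≤ eLpNorm (Ω.indicator ψ) 2 (μ₁.prod μ₂) ^ 2 := tsum_haarCoeff_sq_le h₁ h₂ h2
    _ ≤ eLpNorm (Ω.indicator fun _ => (1 : ℝ)) 2 (μ₁.prod μ₂) ^ 2 := by
        gcongr
        exact eLpNorm_mono hbd
    _ = μ₁.prod μ₂ Ω := by
        rw [eLpNorm_indicator_const hΩ two_ne_zero (by simp), mul_pow, ← ENNReal.rpow_two,
          ← ENNReal.rpow_two, ← ENNReal.rpow_mul]
        simp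

/-- The `L¹` norm of a finite Haar sum is controlled by its square function. This is the duality
inequality, tested with the signum of the sum. -/
lemma lintegral_haarSum_le (a : H₁.Index × H₂.Index → 𝕜) (F : Finset (H₁.Index × H₂.Index))
    [DecidableEq (H₁.Index × H₂.Index)] :
    ∫⁻ x, ‖haarSum H₁ H₂ a F x‖ₑ ∂(μ₁.prod μ₂) ≤
      96 * ∫⁻ x, sqSum H₁ H₂ (fun i => if i ∈ F then ‖a i‖ₑ else 0) x ∂(μ₁.prod μ₂) := by
  set b : H₁.Index × H₂.Index → ℝ≥0∞ := fun i => if i ∈ F then ‖a i‖ₑ else 0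
  by_cases hb : ∫⁻ x, sqSum H₁ H₂ b x ∂(μ₁.prod μ₂) = ∞
  · rw [hb]; simp
  set f := haarSum H₁ H₂ a F with hf
  have hfm : Measurable f := measurable_haarSum a F
  set ψ : X₁ × X₂ → 𝕜 := fun x => (starRingEnd 𝕜) (f x) * ((‖f x‖⁻¹ : ℝ) : 𝕜) with hψ
  have hψm : Measurable ψ :=
    (RCLike.continuous_conj.measurable.comp hfm).mul
      (RCLike.measurable_ofReal.comp hfm.norm.inv)
  have hψ1 : ∀ x, ‖ψ x‖ ≤ 1 := fun x => by
    simp only [hψ, norm_mul, RCLike.norm_conj, RCLike.norm_ofReal, abs_inv, abs_norm]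
    exact mul_inv_le_one
  have hψf : ∀ x, f x * ψ x = ((‖f x‖ : ℝ) : 𝕜) := fun x => by
    simp only [hψ]
    rw [← mul_assoc, RCLike.mul_conj]
    by_cases h : ‖f x‖ = 0
    · simp [h]
    · push_cast
      have : ((‖f x‖ : ℝ) : 𝕜) ≠ 0 := by exact_mod_cast h
      field_simp
  have hsum : ∫ x, f x * ψ x ∂(μ₁.prod μ₂) = ∑ i ∈ F, a i * haarCoeff H₁ H₂ ψ i := by
    simp only [hf, haarSum, Finset.sum_mul]
    rw [integral_finsetSum]
    · refine Finset.sum_congr rfl fun i _ => ?_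
      simp_rw [mul_assoc]
      rw [integral_const_mul, haarCoeff_eq]
    · intro i _
      exact ((integrable_prodHaar 𝕜 h₁ h₂ i).const_mul _).mul_bdd
        hψm.aestronglyMeasurable (Eventually.of_forall hψ1)
  have hCar := tsum_mul_le_of_carleson h₁ h₂ (a := fun i => ‖haarCoeff H₁ H₂ ψ i‖ₑ) (b := b)
    (B := 1) (fun Ω hΩ hfin => by
      rw [one_pow, one_mul]; exact carleson_of_norm_le_one h₁ h₂ hψm hψ1 hΩ hfin) hb
  calc ∫⁻ x, ‖f x‖ₑ ∂(μ₁.prod μ₂) = ‖∫ x, f x * ψ x ∂(μ₁.prod μ₂)‖ₑ := by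
        simp_rw [hψf]
        rw [integral_ofReal, ← ofReal_norm, RCLike.norm_ofReal, abs_of_nonneg (by positivity),
          ofReal_integral_norm_eq_lintegral_enorm (integrable_haarSum h₁ h₂ a F)]
    _ ≤ ∑ i ∈ F, ‖a i‖ₑ * ‖haarCoeff H₁ H₂ ψ i‖ₑ := by
        rw [hsum]
        exact (enorm_sum_le _ _).trans_eq (Finset.sum_congr rfl fun i _ => enorm_mul _ _)
    _ = ∑ i ∈ F, ‖haarCoeff H₁ H₂ ψ i‖ₑ * b i :=
        Finset.sum_congr rfl fun i hi => by simp only [b, if_pos hi, mul_comm]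
    _ ≤ ∑' i, ‖haarCoeff H₁ H₂ ψ i‖ₑ * b i := ENNReal.sum_le_tsum F
    _ ≤ 96 * ∫⁻ x, sqSum H₁ H₂ b x ∂(μ₁.prod μ₂) := by simpa using hCar

end ProductHaar

/-! ### Functions are determined by their Haar coefficients -/

section Uniqueness

/-- Bounded measurable functions. -/
def BddMeas {X : Type*} [MeasurableSpace X] (p : X → ℝ) : Prop :=
  Measurable p ∧ ∃ B : ℝ, ∀ x, ‖p x‖ ≤ B

lemma bddMeas_indicator {X : Type*} [MeasurableSpace X] {A : Set X} (hA : MeasurableSet A) :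
    BddMeas (A.indicator fun _ => (1 : ℝ)) :=
  ⟨measurable_const.indicator hA, 1, fun x => by
    refine (norm_indicator_le_norm_self _ _).trans ?_; simp⟩

lemma HaarSystem.bddMeas_haar {X : Type*} [MeasurableSpace X] {ρ : X → X → ℝ} {μ : Measure X}
    (H : HaarSystem ρ μ) (i : H.Index) : BddMeas (H.haar i) :=
  ⟨H.measurable_haar i, H.exists_bound_haar i⟩

lemma setIntegral_eq_integral_indicator_smul {X E : Type*} [MeasurableSpace X]
    [NormedAddCommGroup E] [NormedSpace ℝ E] {μ : Measure X} {A : Set X} (hA : MeasurableSet A)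
    (G : X → E) : ∫ x in A, G x ∂μ = ∫ x, A.indicator (fun _ => (1 : ℝ)) x • G x ∂μ := by
  rw [← integral_indicator hA]
  refine integral_congr_ae (Eventually.of_forall fun x => ?_)
  by_cases hx : x ∈ A <;> simp [hx]

lemma HaarSystem.isPiSystem_cubes {X : Type*} [MeasurableSpace X] {ρ : X → X → ℝ}
    {μ : Measure X} (H : HaarSystem ρ μ) : IsPiSystem {Q | ∃ k, Q ∈ H.cubes k} := by
  rintro Q ⟨k, hQ⟩ P ⟨l, hP⟩ hne
  rcases le_total k l with h | h
  · rw [inter_eq_right.2 (H.subset_of_mem h hP hQ hne inter_subset_right inter_subset_left)]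
    exact ⟨l, hP⟩
  · rw [inter_eq_left.2 (H.subset_of_mem h hQ hP hne inter_subset_left inter_subset_right)]
    exact ⟨k, hQ⟩

lemma HaarSystem.Regular.isCountablySpanning_cubes {X : Type*} [MeasurableSpace X]
    {ρ : X → X → ℝ} {μ : Measure X} {H : HaarSystem ρ μ} {T : ℕ → Set X} {x₀ : X}
    (h : H.Regular T x₀) : IsCountablySpanning {Q | ∃ k, Q ∈ H.cubes k} :=
  ⟨T, fun n => ⟨_, h.tower_mem n⟩, h.iUnion_tower⟩

variable {𝕜 : Type*} [RCLike 𝕜] {X₁ X₂ : Type*} [MeasurableSpace X₁] [MeasurableSpace X₂]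
  {ρ₁ : X₁ → X₁ → ℝ} {ρ₂ : X₂ → X₂ → ℝ} {μ₁ : Measure X₁} {μ₂ : Measure X₂}

variable (μ₁ μ₂) in
/-- The weak form of the condition that `f` have integral zero in the first variable. -/
def CancelFst (f : X₁ × X₂ → 𝕜) : Prop :=
  ∀ q : X₂ → ℝ, BddMeas q → ∫ x, q x.2 • f x ∂(μ₁.prod μ₂) = 0

variable (μ₁ μ₂) in
/-- The weak form of the condition that `f` have integral zero in the second variable. -/
def CancelSnd (f : X₁ × X₂ → 𝕜) : Prop :=
  ∀ p : X₁ → ℝ, BddMeas p → ∫ x, p x.1 • f x ∂(μ₁.prod μ₂) = 0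

lemma integrable_fst_smul {f : X₁ × X₂ → 𝕜} (hf : Integrable f (μ₁.prod μ₂)) {p : X₁ → ℝ}
    (hp : BddMeas p) : Integrable (fun x => p x.1 • f x) (μ₁.prod μ₂) := by
  obtain ⟨hm, B, hB⟩ := hp
  exact hf.bdd_smul B (hm.comp measurable_fst).aestronglyMeasurable
    (Eventually.of_forall fun x => hB x.1)

lemma integrable_snd_smul {f : X₁ × X₂ → 𝕜} (hf : Integrable f (μ₁.prod μ₂)) {q : X₂ → ℝ}
    (hq : BddMeas q) : Integrable (fun x => q x.2 • f x) (μ₁.prod μ₂) := by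
  obtain ⟨hm, B, hB⟩ := hq
  exact hf.bdd_smul B (hm.comp measurable_snd).aestronglyMeasurable
    (Eventually.of_forall fun x => hB x.2)

section

variable [SFinite μ₁] [SFinite μ₂] {f : X₁ × X₂ → 𝕜}

lemma integral_fst_smul (hf : Integrable f (μ₁.prod μ₂)) {p : X₁ → ℝ} (hp : BddMeas p) :
    ∫ x, p x.1 • f x ∂(μ₁.prod μ₂) = ∫ x₁, p x₁ • ∫ x₂, f (x₁, x₂) ∂μ₂ ∂μ₁ := by
  rw [integral_prod _ (integrable_fst_smul hf hp)]
  simp_rw [integral_smul]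

lemma integral_snd_smul (hf : Integrable f (μ₁.prod μ₂)) {q : X₂ → ℝ} (hq : BddMeas q) :
    ∫ x, q x.2 • f x ∂(μ₁.prod μ₂) = ∫ x₂, q x₂ • ∫ x₁, f (x₁, x₂) ∂μ₁ ∂μ₂ := by
  rw [integral_prod_symm _ (integrable_snd_smul hf hq)]
  simp_rw [integral_smul]

lemma cancelFst_of_ae (hf : Integrable f (μ₁.prod μ₂))
    (h : ∀ᵐ x₂ ∂μ₂, ∫ x₁, f (x₁, x₂) ∂μ₁ = 0) : CancelFst μ₁ μ₂ f := by
  intro q hq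
  rw [integral_snd_smul hf hq]
  exact integral_eq_zero_of_ae (h.mono fun x hx => by simp [hx])

lemma cancelSnd_of_ae (hf : Integrable f (μ₁.prod μ₂))
    (h : ∀ᵐ x₁ ∂μ₁, ∫ x₂, f (x₁, x₂) ∂μ₂ = 0) : CancelSnd μ₁ μ₂ f := by
  intro p hp
  rw [integral_fst_smul hf hp]
  exact integral_eq_zero_of_ae (h.mono fun x hx => by simp [hx])

end

variable {H₁ : HaarSystem ρ₁ μ₁} {H₂ : HaarSystem ρ₂ μ₂}
  {T₁ : ℕ → Set X₁} {x₁ : X₁} {T₂ : ℕ → Set X₂} {x₂ : X₂}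
  (h₁ : H₁.Regular T₁ x₁) (h₂ : H₂.Regular T₂ x₂)
include h₁ h₂

variable [SigmaFinite μ₁] [SigmaFinite μ₂]

/-- A function without Haar coefficients of generations less than `n` has integral zero over the
dyadic rectangles of generations at most `n`: the one-parameter statement is applied in each
variable. -/
lemma setIntegral_prod_eq_zero {g : X₁ × X₂ → 𝕜} (hg : Integrable g (μ₁.prod μ₂)) {n : ℤ}
    (h0 : ∀ i : H₁.Index × H₂.Index, i.1.1 < n → i.2.1 < n → haarCoeff H₁ H₂ g i = 0)
    (hc₁ : μ₁ univ < ∞ → CancelFst μ₁ μ₂ g) (hc₂ : μ₂ univ < ∞ → CancelSnd μ₁ μ₂ g)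
    {k l : ℤ} (hk : k ≤ n) (hl : l ≤ n) {Q₁ : Set X₁} {Q₂ : Set X₂} (hQ₁ : Q₁ ∈ H₁.cubes k)
    (hQ₂ : Q₂ ∈ H₂.cubes l) : ∫ x in Q₁ ×ˢ Q₂, g x ∂(μ₁.prod μ₂) = 0 := by
  have m₁ := H₁.measurableSet_cube k Q₁ hQ₁
  have m₂ := H₂.measurableSet_cube l Q₂ hQ₂
  have b₁ := bddMeas_indicator m₁
  have b₂ := bddMeas_indicator m₂
  have step : ∀ i₂ : H₂.Index, i₂.1 < n →
      ∫ x, H₂.haar i₂ x.2 • Q₁.indicator (fun _ => (1 : ℝ)) x.1 • g x ∂(μ₁.prod μ₂) = 0 := by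
    intro i₂ hi₂
    have hb := H₂.bddMeas_haar i₂
    have hint := integrable_snd_smul hg hb
    have h := h₁.setIntegral_cube_eq_zero (G := fun y => ∫ z, H₂.haar i₂ z • g (y, z) ∂μ₂)
      hint.integral_prod_left (n := n) (fun i₁ hi₁ => ?_) (fun hfin => ?_) hk hQ₁
    · rw [setIntegral_eq_integral_indicator_smul m₁] at h
      rw [← h, ← integral_fst_smul hint b₁]
      simp_rw [smul_comm (H₂.haar i₂ _)]
    · rw [← integral_fst_smul hint (H₁.bddMeas_haar i₁), ← h0 (i₁, i₂) hi₁ hi₂]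
      simp only [haarCoeff, smul_smul]
    · rw [← hc₁ hfin _ hb, integral_prod _ hint]
  have hint := integrable_fst_smul hg b₁
  have h := h₂.setIntegral_cube_eq_zero
    (G := fun z => ∫ y, Q₁.indicator (fun _ => (1 : ℝ)) y • g (y, z) ∂μ₁)
    hint.integral_prod_right (n := n) (fun i₂ hi₂ => ?_) (fun hfin => ?_) hl hQ₂
  · rw [setIntegral_eq_integral_indicator_smul m₂, ← integral_snd_smul hint b₂] at h
    rw [← h, setIntegral_eq_integral_indicator_smul (m₁.prod m₂)]
    refine integral_congr_ae (Eventually.of_forall fun x => ?_)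
    by_cases hx₁ : x.1 ∈ Q₁ <;> by_cases hx₂ : x.2 ∈ Q₂ <;> simp [hx₁, hx₂, indicator, mem_prod]
  · rw [← integral_snd_smul hint (H₂.bddMeas_haar i₂)]
    exact step i₂ hi₂
  · rw [← hc₂ hfin _ b₁, integral_prod_symm _ hint]

/-- An integrable function vanishes if all its Haar coefficients vanish and it has integral zero
in each variable in which the space has finite measure. -/
lemma ae_eq_zero_of_haarCoeff_eq_zero {g : X₁ × X₂ → 𝕜} (hg : Integrable g (μ₁.prod μ₂))
    (h0 : ∀ i, haarCoeff H₁ H₂ g i = 0)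
    (hc₁ : μ₁ univ < ∞ → CancelFst μ₁ μ₂ g) (hc₂ : μ₂ univ < ∞ → CancelSnd μ₁ μ₂ g) :
    g =ᵐ[μ₁.prod μ₂] 0 := by
  have hrect : ∀ k l Q₁ Q₂, Q₁ ∈ H₁.cubes k → Q₂ ∈ H₂.cubes l →
      ∫ x in Q₁ ×ˢ Q₂, g x ∂(μ₁.prod μ₂) = 0 := fun k l Q₁ Q₂ hQ₁ hQ₂ =>
    setIntegral_prod_eq_zero h₁ h₂ hg (n := max k l) (fun i _ _ => h0 i) hc₁ hc₂ (le_max_left _ _)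
      (le_max_right _ _) hQ₁ hQ₂
  have hgen : (inferInstance : MeasurableSpace (X₁ × X₂)) = MeasurableSpace.generateFrom
      (image2 (· ×ˢ ·) {Q | ∃ k, Q ∈ H₁.cubes k} {Q | ∃ k, Q ∈ H₂.cubes k}) := by
    rw [← generateFrom_prod_eq h₁.isCountablySpanning_cubes h₂.isCountablySpanning_cubes,
      ← h₁.generateFrom, ← h₂.generateFrom]
  have htot : ∫ x, g x ∂(μ₁.prod μ₂) = 0 := by
    have hmono : Monotone fun n => T₁ n ×ˢ T₂ n := fun m n h =>
      prod_mono (h₁.monotone_tower h) (h₂.monotone_tower h)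
    have h := tendsto_setIntegral_of_monotone (μ := μ₁.prod μ₂) (f := g)
      (fun n => (h₁.measurableSet_tower n).prod (h₂.measurableSet_tower n)) hmono hg.integrableOn
    have hU : ⋃ n, T₁ n ×ˢ T₂ n = univ := by
      rw [iUnion_prod_of_monotone h₁.monotone_tower h₂.monotone_tower, h₁.iUnion_tower,
        h₂.iUnion_tower, univ_prod_univ]
    rw [hU, Measure.restrict_univ] at h
    simp_rw [hrect _ _ _ _ (h₁.tower_mem _) (h₂.tower_mem _)] at h
    exact tendsto_nhds_unique h tendsto_const_nhds
  refine hg.ae_eq_zero_of_forall_setIntegral_eq_zero fun s hs hfin => ?_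
  clear hfin
  induction s, hs using MeasurableSpace.induction_on_inter hgen
      (H₁.isPiSystem_cubes.prod H₂.isPiSystem_cubes) with
  | empty => simp
  | basic t ht =>
    obtain ⟨Q₁, ⟨k, hQ₁⟩, Q₂, ⟨l, hQ₂⟩, rfl⟩ := ht
    exact hrect k l Q₁ Q₂ hQ₁ hQ₂
  | compl t ht ih =>
    have := integral_add_compl ht hg
    rwa [htot, ih, zero_add] at this
  | iUnion f hd hm ih =>
    rw [← (hasSum_integral_iUnion hm hd hg.integrableOn).tsum_eq]
    simp [ih]

end Uniqueness

/-! ### Haar series of functions in the Hardy space -/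

section Series

variable {𝕜 : Type*} [RCLike 𝕜] {X₁ X₂ : Type*} [MeasurableSpace X₁] [MeasurableSpace X₂]
  {ρ₁ : X₁ → X₁ → ℝ} {ρ₂ : X₂ → X₂ → ℝ} {μ₁ : Measure X₁} {μ₂ : Measure X₂}
  {H₁ : HaarSystem ρ₁ μ₁} {H₂ : HaarSystem ρ₂ μ₂}

/-- Integration against a function in the conjugate Lebesgue space commutes with sums. -/
lemma hasSum_integral_mul {α ι : Type*} [MeasurableSpace α] {μ : Measure α} {p q : ℝ≥0∞}
    [Fact (1 ≤ p)] [Fact (1 ≤ q)] [p.HolderConjugate q] {v : ι → Lp 𝕜 q μ} {g : Lp 𝕜 q μ}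
    (hv : HasSum v g) {w : α → 𝕜} (hw : MemLp w p μ) :
    HasSum (fun i => ∫ x, w x * v i x ∂μ) (∫ x, w x * g x ∂μ) := by
  have key : ∀ u : Lp 𝕜 q μ,
      (ContinuousLinearMap.mul 𝕜 𝕜).lpPairing μ p q (hw.toLp w) u = ∫ x, w x * u x ∂μ := by
    intro u
    rw [ContinuousLinearMap.lpPairing_eq_integral]
    refine integral_congr_ae ?_
    filter_upwards [hw.coeFn_toLp] with x hx
    rw [hx, ContinuousLinearMap.mul_apply']
  simp_rw [← key]
  exact ((ContinuousLinearMap.mul 𝕜 𝕜).lpPairing μ p q (hw.toLp w)).hasSum hv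

lemma integral_mul_smul_toLp {α : Type*} [MeasurableSpace α] {μ : Measure α} {p : ℝ≥0∞}
    {u : α → 𝕜} (hu : MemLp u p μ) (c : 𝕜) (w : α → 𝕜) :
    ∫ x, w x * (c • hu.toLp u : Lp 𝕜 p μ) x ∂μ = c * ∫ x, w x * u x ∂μ := by
  rw [← integral_const_mul]
  refine integral_congr_ae ?_
  filter_upwards [Lp.coeFn_smul c (hu.toLp u), hu.coeFn_toLp] with x e1 e2
  rw [e1, Pi.smul_apply, e2, smul_eq_mul]
  ring

/-- An unconditional sum is the limit along any increasing sequence of finite sets that exhausts the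
support, whether or not the sequence exhausts the index set. -/
lemma tendsto_sum_of_support {ι E : Type*} [AddCommMonoid E] [TopologicalSpace E] {v : ι → E}
    {a : E} (hv : HasSum v a) {F : ℕ → Finset ι} (hF : Monotone F)
    (hsupp : ∀ i, v i ≠ 0 → ∃ n, i ∈ F n) :
    Tendsto (fun n => ∑ i ∈ F n, v i) atTop (𝓝 a) := by
  classical
  set U : Set ι := ⋃ n, (F n : Set ι) with hU
  have h1 : HasSum (fun i : U => v i) a :=
    (hasSum_subtype_iff_of_support_subset fun i hi =>
      let ⟨n, hn⟩ := hsupp i hi; mem_iUnion.2 ⟨n, hn⟩).2 hv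
  have h2 : Tendsto (fun n => (F n).subtype (· ∈ U)) atTop atTop := by
    refine tendsto_atTop_finset_of_monotone (fun m n hmn i hi => ?_) fun i => ?_
    · rw [Finset.mem_subtype] at hi ⊢
      exact hF hmn hi
    · obtain ⟨n, hn⟩ := mem_iUnion.1 i.2
      exact ⟨n, Finset.mem_subtype.2 hn⟩
  rw [HasSum, SummationFilter.unconditional_filter] at h1
  have h3 := h1.comp h2
  refine h3.congr fun n => ?_
  simp only [Function.comp]
  rw [Finset.sum_subtype_of_mem (fun i => v i) fun i hi => mem_iUnion.2 ⟨n, hi⟩]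

/-- The square functions of the tails of a sequence tend to zero in `L¹`. -/
lemma tendsto_lintegral_sqSum_tail {b : H₁.Index × H₂.Index → ℝ≥0∞}
    [DecidableEq (H₁.Index × H₂.Index)] (hb : ∫⁻ x, sqSum H₁ H₂ b x ∂(μ₁.prod μ₂) ≠ ∞) :
    Tendsto (fun s : Finset (H₁.Index × H₂.Index) =>
      ∫⁻ x, sqSum H₁ H₂ (fun i => if i ∈ s then 0 else b i) x ∂(μ₁.prod μ₂)) atTop (𝓝 0) := by
  have := countable_index H₁
  have := countable_index H₂
  have h : Tendsto (fun s : Finset (H₁.Index × H₂.Index) =>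
      ∫⁻ x, sqSum H₁ H₂ (fun i => if i ∈ s then 0 else b i) x ∂(μ₁.prod μ₂)) atTop
      (𝓝 (∫⁻ _, 0 ∂(μ₁.prod μ₂))) := by
    refine tendsto_lintegral_filter_of_dominated_convergence (sqSum H₁ H₂ b)
      (Eventually.of_forall fun s => measurable_sqSum _)
      (Eventually.of_forall fun s => Eventually.of_forall fun x => sqSum_mono (fun i => ?_) x)
      hb ?_
    · split_ifs <;> simp
    · filter_upwards [ae_lt_top (measurable_sqSum b) hb] with x hx
      set t : H₁.Index × H₂.Index → ℝ≥0∞ :=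
        fun i => (b i * H₁.normChar i.1 x.1 * H₂.normChar i.2 x.2) ^ 2 with ht
      have hfin : ∑' i, t i ≠ ∞ := by
        rw [ht, ← sqSum_sq]
        exact ENNReal.pow_ne_top hx.ne
      have h1 := ((ENNReal.continuous_rpow_const (y := (1 / 2 : ℝ))).tendsto 0).comp
        (ENNReal.tendsto_tsum_compl_atTop_zero hfin)
      rw [ENNReal.zero_rpow_of_pos (by norm_num)] at h1
      refine h1.congr fun s => ?_
      simp only [Function.comp, sqSum]
      congr 1
      refine (tsum_subtype {i | i ∉ s} t).trans ?_
      refine tsum_congr fun i => ?_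
      by_cases hi : i ∈ s <;> simp [hi, ht]
  simpa using h

section

variable [SigmaFinite μ₁] [SigmaFinite μ₂]
  {T₁ : ℕ → Set X₁} {x₁ : X₁} {T₂ : ℕ → Set X₂} {x₂ : X₂}
  (h₁ : H₁.Regular T₁ x₁) (h₂ : H₂.Regular T₂ x₂)
include h₁ h₂

lemma squareFn_sub_haarSum [DecidableEq (H₁.Index × H₂.Index)] {f : X₁ × X₂ → 𝕜}
    (hf : Integrable f (μ₁.prod μ₂)) (F : Finset (H₁.Index × H₂.Index)) :
    squareFn H₁ H₂ (f - haarSum H₁ H₂ (haarCoeff H₁ H₂ f) F) =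
      sqSum H₁ H₂ fun i => if i ∈ F then 0 else ‖haarCoeff H₁ H₂ f i‖ₑ := by
  have hc : ∀ i, ‖haarCoeff H₁ H₂ (f - haarSum H₁ H₂ (haarCoeff H₁ H₂ f) F) i‖ₑ =
      if i ∈ F then 0 else ‖haarCoeff H₁ H₂ f i‖ₑ := by
    intro i
    have hs : f - haarSum H₁ H₂ (haarCoeff H₁ H₂ f) F =
        f + (-1 : 𝕜) • haarSum H₁ H₂ (haarCoeff H₁ H₂ f) F := by
      rw [neg_one_smul, sub_eq_add_neg]
    rw [hs, haarCoeff_add H₁ H₂ hf ((integrable_haarSum h₁ h₂ _ _).smul _), haarCoeff_smul,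
      haarCoeff_haarSum h₁ h₂]
    split_ifs <;> simp
  funext x
  simp only [squareFn, sqSum, hc]

lemma squareFn_haarSum [DecidableEq (H₁.Index × H₂.Index)] (a : H₁.Index × H₂.Index → 𝕜)
    (F : Finset (H₁.Index × H₂.Index)) :
    squareFn H₁ H₂ (haarSum H₁ H₂ a F) = sqSum H₁ H₂ fun i => if i ∈ F then ‖a i‖ₑ else 0 := by
  have hc : ∀ i, ‖haarCoeff H₁ H₂ (haarSum H₁ H₂ a F) i‖ₑ = if i ∈ F then ‖a i‖ₑ else 0 := by
    intro i
    rw [haarCoeff_haarSum h₁ h₂]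
    split_ifs <;> simp
  funext x
  simp only [squareFn, sqSum, hc]

/-- Finite Haar sums are dense in the Hardy space. -/
lemma tendsto_h1Norm_sub_haarSum {f : X₁ × X₂ → 𝕜} (hf : Integrable f (μ₁.prod μ₂))
    (hS : h1Norm H₁ H₂ f < ∞) :
    Tendsto (fun F => h1Norm H₁ H₂ (f - haarSum H₁ H₂ (haarCoeff H₁ H₂ f) F)) atTop (𝓝 0) := by
  classical
  simp only [h1Norm, squareFn_sub_haarSum h₁ h₂ hf]
  exact tendsto_lintegral_sqSum_tail (b := fun i => ‖haarCoeff H₁ H₂ f i‖ₑ) hS.ne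

variable (𝕜) in
omit [SigmaFinite μ₁] in
lemma memLp_one_prodHaar (i : H₁.Index × H₂.Index) :
    MemLp (prodHaar 𝕜 H₁ H₂ i) 1 (μ₁.prod μ₂) :=
  memLp_one_iff_integrable.2 (integrable_prodHaar 𝕜 h₁ h₂ i)

omit [SigmaFinite μ₁] [SigmaFinite μ₂] h₁ h₂ in
lemma sum_smul_toLp_prodHaar {p : ℝ≥0∞} [Fact (1 ≤ p)] (a : H₁.Index × H₂.Index → 𝕜)
    (F : Finset (H₁.Index × H₂.Index))
    (hp : ∀ i, MemLp (prodHaar 𝕜 H₁ H₂ i) p (μ₁.prod μ₂)) :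
    ((∑ i ∈ F, a i • (hp i).toLp (prodHaar 𝕜 H₁ H₂ i) : Lp 𝕜 p (μ₁.prod μ₂)) : X₁ × X₂ → 𝕜)
      =ᵐ[μ₁.prod μ₂] haarSum H₁ H₂ a F := by
  classical
  induction F using Finset.induction_on with
  | empty =>
    simp only [Finset.sum_empty]
    filter_upwards [Lp.coeFn_zero 𝕜 p (μ₁.prod μ₂)] with x hx
    simpa [haarSum] using hx
  | insert i F hi ih =>
    rw [Finset.sum_insert hi]
    filter_upwards [ih, Lp.coeFn_add (a i • (hp i).toLp (prodHaar 𝕜 H₁ H₂ i))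
      (∑ i ∈ F, a i • (hp i).toLp (prodHaar 𝕜 H₁ H₂ i)),
      Lp.coeFn_smul (a i) ((hp i).toLp (prodHaar 𝕜 H₁ H₂ i)), (hp i).coeFn_toLp] with x e1 e2 e3 e4
    rw [e2, Pi.add_apply, e1, e3, Pi.smul_apply, e4]
    simp only [haarSum, Finset.sum_insert hi, smul_eq_mul]

/-- The Haar series of a function in the Hardy space converges in `L¹`. -/
lemma summable_haar_of_h1Norm {f : X₁ × X₂ → 𝕜} (hS : h1Norm H₁ H₂ f < ∞) :
    Summable fun i => haarCoeff H₁ H₂ f i •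
      (memLp_one_prodHaar 𝕜 h₁ h₂ i).toLp (prodHaar 𝕜 H₁ H₂ i) := by
  classical
  rw [summable_iff_vanishing_norm]
  intro ε hε
  have ht := tendsto_lintegral_sqSum_tail (H₁ := H₁) (H₂ := H₂)
    (b := fun i => ‖haarCoeff H₁ H₂ f i‖ₑ) hS.ne
  have ht' := ENNReal.Tendsto.const_mul (a := 96) ht (Or.inr (by simp))
  rw [mul_zero] at ht'
  obtain ⟨s, hs⟩ := (ht'.eventually (gt_mem_nhds (ENNReal.ofReal_pos.2 hε))).exists
  refine ⟨s, fun t hts => ?_⟩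
  rw [← ENNReal.ofReal_lt_ofReal_iff hε, ofReal_norm, Lp.enorm_def, eLpNorm_one_eq_lintegral_enorm]
  refine lt_of_le_of_lt ?_ hs
  have e := sum_smul_toLp_prodHaar (haarCoeff H₁ H₂ f) t
    fun i => memLp_one_prodHaar 𝕜 h₁ h₂ i
  refine (lintegral_congr_ae (e.fun_comp enorm)).le.trans ?_
  refine (lintegral_haarSum_le h₁ h₂ _ t).trans ?_
  gcongr with x
  refine sqSum_mono (fun i => ?_) x
  by_cases hi : i ∈ t
  · rw [if_pos hi, if_neg (Finset.disjoint_left.1 hts hi)]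
  · rw [if_neg hi]
    exact zero_le

omit h₂ in
lemma integral_snd_mul_prodHaar (q : X₂ → ℝ) (i : H₁.Index × H₂.Index) :
    ∫ x, ((q x.2 : ℝ) : 𝕜) * prodHaar 𝕜 H₁ H₂ i x ∂(μ₁.prod μ₂) = 0 := by
  have : ∀ x : X₁ × X₂, ((q x.2 : ℝ) : 𝕜) * prodHaar 𝕜 H₁ H₂ i x =
      tensor 𝕜 (H₁.haar i.1) (fun y => q y * H₂.haar i.2 y) x := fun x => by
    simp only [prodHaar, tensor]; push_cast; ring
  simp_rw [this]
  rw [integral_tensor, h₁.integral_haar, zero_mul, RCLike.ofReal_zero]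

omit h₁ in
lemma integral_fst_mul_prodHaar (p : X₁ → ℝ) (i : H₁.Index × H₂.Index) :
    ∫ x, ((p x.1 : ℝ) : 𝕜) * prodHaar 𝕜 H₁ H₂ i x ∂(μ₁.prod μ₂) = 0 := by
  have : ∀ x : X₁ × X₂, ((p x.1 : ℝ) : 𝕜) * prodHaar 𝕜 H₁ H₂ i x =
      tensor 𝕜 (fun y => p y * H₁.haar i.1 y) (H₂.haar i.2) x := fun x => by
    simp only [prodHaar, tensor]; push_cast; ring
  simp_rw [this]
  rw [integral_tensor, h₂.integral_haar, mul_zero, RCLike.ofReal_zero]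

/-- The sum of an `L¹`-convergent Haar series has integral zero in both variables, also if the
spaces have infinite measure. -/
lemma cancel_of_hasSum {c : H₁.Index × H₂.Index → 𝕜} {g : Lp 𝕜 1 (μ₁.prod μ₂)}
    (hg : HasSum (fun i => c i •
      (memLp_one_prodHaar 𝕜 h₁ h₂ i).toLp (prodHaar 𝕜 H₁ H₂ i)) g) :
    CancelFst μ₁ μ₂ g ∧ CancelSnd μ₁ μ₂ g := by
  have key : ∀ w : X₁ × X₂ → 𝕜, MemLp w ∞ (μ₁.prod μ₂) →
      (∀ i, ∫ x, w x * prodHaar 𝕜 H₁ H₂ i x ∂(μ₁.prod μ₂) = 0) →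
      ∫ x, w x * g x ∂(μ₁.prod μ₂) = 0 := by
    intro w hw h0
    refine (hasSum_integral_mul hg hw).unique ?_
    convert hasSum_zero with i
    rw [integral_mul_smul_toLp, h0, mul_zero]
  constructor
  · rintro q ⟨hq, B, hB⟩
    simp only [RCLike.real_smul_eq_coe_mul]
    refine key (fun x => ((q x.2 : ℝ) : 𝕜)) (memLp_top_of_bound ?_ B ?_) fun i =>
      integral_snd_mul_prodHaar h₁ q i
    · exact (RCLike.measurable_ofReal.comp (hq.comp measurable_snd)).aestronglyMeasurable
    · exact Eventually.of_forall fun x => by simpa using hB x.2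
  · rintro p ⟨hp, B, hB⟩
    simp only [RCLike.real_smul_eq_coe_mul]
    refine key (fun x => ((p x.1 : ℝ) : 𝕜)) (memLp_top_of_bound ?_ B ?_) fun i =>
      integral_fst_mul_prodHaar h₂ p i
    · exact (RCLike.measurable_ofReal.comp (hp.comp measurable_fst)).aestronglyMeasurable
    · exact Eventually.of_forall fun x => by simpa using hB x.1

/-- The coefficients of the sum of an `L¹`-convergent Haar series. -/
lemma haarCoeff_of_hasSum {c : H₁.Index × H₂.Index → 𝕜} {g : Lp 𝕜 1 (μ₁.prod μ₂)}
    (hg : HasSum (fun i => c i •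
      (memLp_one_prodHaar 𝕜 h₁ h₂ i).toLp (prodHaar 𝕜 H₁ H₂ i)) g) (j : H₁.Index × H₂.Index) :
    haarCoeff H₁ H₂ g j = c j := by
  classical
  obtain ⟨B, hB⟩ := exists_bound_prodHaar 𝕜 (H₁ := H₁) (H₂ := H₂) j
  have h := hasSum_integral_mul hg (w := prodHaar 𝕜 H₁ H₂ j)
    (memLp_top_of_bound (measurable_prodHaar j).aestronglyMeasurable B (Eventually.of_forall hB))
  rw [haarCoeff_eq]
  refine h.unique ?_
  convert hasSum_ite_eq j (c j) using 2 with i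
  rw [integral_mul_smul_toLp, ← haarCoeff_eq, haarCoeff_prodHaar h₁ h₂]
  by_cases hij : i = j
  · simp [hij]
  · simp [hij, Ne.symm hij]

/-- A function in the Hardy space is the sum of its Haar series in `L¹`, provided that it has
integral zero in each variable in which the space has finite measure. In a variable in which the
space has infinite measure, this cancellation is automatic. -/
lemma hasSum_haar {f : X₁ × X₂ → 𝕜} (hf : Integrable f (μ₁.prod μ₂)) (hS : h1Norm H₁ H₂ f < ∞)
    (hc₁ : μ₁ univ < ∞ → CancelFst μ₁ μ₂ f) (hc₂ : μ₂ univ < ∞ → CancelSnd μ₁ μ₂ f) :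
    HasSum (fun i => haarCoeff H₁ H₂ f i •
      (memLp_one_prodHaar 𝕜 h₁ h₂ i).toLp (prodHaar 𝕜 H₁ H₂ i))
      ((memLp_one_iff_integrable.2 hf).toLp f) := by
  obtain ⟨g, hg⟩ := summable_haar_of_h1Norm h₁ h₂ hS
  have hgi : Integrable g (μ₁.prod μ₂) := L1.integrable_coeFn g
  have hgc := cancel_of_hasSum h₁ h₂ hg
  have h0 : f - (g : X₁ × X₂ → 𝕜) =ᵐ[μ₁.prod μ₂] 0 := by
    refine ae_eq_zero_of_haarCoeff_eq_zero h₁ h₂ (hf.sub hgi) (fun i => ?_) (fun hfin q hq => ?_)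
      fun hfin p hp => ?_
    · have hs : f - (g : X₁ × X₂ → 𝕜) = f + (-1 : 𝕜) • (g : X₁ × X₂ → 𝕜) := by
        rw [neg_one_smul, sub_eq_add_neg]
      rw [hs, haarCoeff_add H₁ H₂ hf (hgi.smul _), haarCoeff_smul, haarCoeff_of_hasSum h₁ h₂ hg]
      simp
    · simp only [Pi.sub_apply, smul_sub]
      rw [integral_sub (integrable_snd_smul hf hq) (integrable_snd_smul hgi hq), hc₁ hfin q hq,
        hgc.1 q hq, sub_zero]
    · simp only [Pi.sub_apply, smul_sub]
      rw [integral_sub (integrable_fst_smul hf hp) (integrable_fst_smul hgi hp), hc₂ hfin p hp,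
        hgc.2 p hp, sub_zero]
  have hgf : g = (memLp_one_iff_integrable.2 hf).toLp f := by
    refine Lp.ext ?_
    filter_upwards [h0, (memLp_one_iff_integrable.2 hf).coeFn_toLp] with x e1 e2
    rw [e2]
    exact (sub_eq_zero.1 e1).symm
  rwa [hgf] at hg

end

end Series

/-! ### The pairing as an integral -/

section Pairing

variable {𝕜 : Type*} [RCLike 𝕜] {X₁ X₂ : Type*} [MeasurableSpace X₁] [MeasurableSpace X₂]
  {ρ₁ : X₁ → X₁ → ℝ} {ρ₂ : X₂ → X₂ → ℝ} {μ₁ : Measure X₁} {μ₂ : Measure X₂}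
  {H₁ : HaarSystem ρ₁ μ₁} {H₂ : HaarSystem ρ₂ μ₂} [SigmaFinite μ₁] [SigmaFinite μ₂]
  {T₁ : ℕ → Set X₁} {x₁ : X₁} {T₂ : ℕ → Set X₂} {x₂ : X₂}
  (h₁ : H₁.Regular T₁ x₁) (h₂ : H₂.Regular T₂ x₂)
include h₁ h₂

/-- A function in the Hardy space that has integral zero in each variable in which the space has
finite measure has integral zero in both variables. -/
lemma cancel_of_h1Norm {f : X₁ × X₂ → 𝕜} (hf : Integrable f (μ₁.prod μ₂))
    (hS : h1Norm H₁ H₂ f < ∞) (hc₁ : μ₁ univ < ∞ → CancelFst μ₁ μ₂ f)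
    (hc₂ : μ₂ univ < ∞ → CancelSnd μ₁ μ₂ f) : CancelFst μ₁ μ₂ f ∧ CancelSnd μ₁ μ₂ f := by
  have h := cancel_of_hasSum h₁ h₂ (hasSum_haar h₁ h₂ hf hS hc₁ hc₂)
  have e := (memLp_one_iff_integrable.2 hf).coeFn_toLp
  refine ⟨fun q hq => ?_, fun p hp => ?_⟩
  · rw [← h.1 q hq]
    refine integral_congr_ae ?_
    filter_upwards [e] with x hx
    rw [hx]
  · rw [← h.2 p hp]
    refine integral_congr_ae ?_
    filter_upwards [e] with x hx
    rw [hx]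

/-- For square integrable functions, the Haar series converges in `L²` as well. -/
lemma hasSum_haar_two {f : X₁ × X₂ → 𝕜} (hf : Integrable f (μ₁.prod μ₂))
    (hf₂ : MemLp f 2 (μ₁.prod μ₂)) (hS : h1Norm H₁ H₂ f < ∞)
    (hc₁ : μ₁ univ < ∞ → CancelFst μ₁ μ₂ f) (hc₂ : μ₂ univ < ∞ → CancelSnd μ₁ μ₂ f) :
    HasSum (fun i => haarCoeff H₁ H₂ f i •
      (memLp_two_prodHaar 𝕜 h₁ h₂ i).toLp (prodHaar 𝕜 H₁ H₂ i)) (hf₂.toLp f) := by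
  have hs : Summable fun i => ‖haarCoeff H₁ H₂ f i‖ ^ 2 := by
    simp_rw [haarCoeff_eq_inner h₁ h₂ hf₂]
    exact (orthonormal_prodHaar 𝕜 h₁ h₂).inner_products_summable _
  obtain ⟨g, hg⟩ := summable_orthonormal_smul (orthonormal_prodHaar 𝕜 h₁ h₂) hs
  have h1 := hasSum_haar h₁ h₂ hf hS hc₁ hc₂
  have e : g = hf₂.toLp f := by
    refine Lp.ext (EventuallyEq.trans ?_ hf₂.coeFn_toLp.symm)
    refine ae_eq_of_forall_setIntegral_eq_of_sigmaFinite
      (fun s _ hs => have : IsFiniteMeasure ((μ₁.prod μ₂).restrict s) := ⟨by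
          rwa [Measure.restrict_apply_univ]⟩
        ((Lp.memLp g).restrict s).integrable one_le_two)
      (fun s _ _ => hf.integrableOn) fun s hs hfin => ?_
    -- Both sums are tested against the indicator function of a set of finite measure.
    set w : X₁ × X₂ → 𝕜 := s.indicator fun _ => 1 with hw
    have hw2 : MemLp w 2 (μ₁.prod μ₂) := memLp_indicator_const 2 hs 1 (Or.inr hfin.ne)
    have hwt : MemLp w ∞ (μ₁.prod μ₂) := memLp_indicator_const ∞ hs 1 (Or.inr hfin.ne)
    have hint : ∀ u : X₁ × X₂ → 𝕜, ∫ x in s, u x ∂(μ₁.prod μ₂) =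
        ∫ x, w x * u x ∂(μ₁.prod μ₂) := by
      intro u
      rw [← integral_indicator hs]
      congr 1 with x
      by_cases hx : x ∈ s <;> simp [hw, hx]
    have a1 := hasSum_integral_mul h1 hwt
    have a2 := hasSum_integral_mul hg hw2
    simp_rw [integral_mul_smul_toLp] at a1 a2
    rw [hint, hint, a2.unique a1]
    refine integral_congr_ae ?_
    filter_upwards [(memLp_one_iff_integrable.2 hf).coeFn_toLp] with x hx
    rw [hx]
  rwa [e] at hg

lemma hasSum_haarPairing_of_memLp_two {φ f : X₁ × X₂ → 𝕜} (hφ : MemLp φ 2 (μ₁.prod μ₂))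
    (hf : Integrable f (μ₁.prod μ₂))
    (hf₂ : MemLp f 2 (μ₁.prod μ₂)) (hS : h1Norm H₁ H₂ f < ∞)
    (hc₁ : μ₁ univ < ∞ → CancelFst μ₁ μ₂ f) (hc₂ : μ₂ univ < ∞ → CancelSnd μ₁ μ₂ f) :
    HasSum (fun i => haarCoeff H₁ H₂ φ i * haarCoeff H₁ H₂ f i)
      (∫ x, φ x * f x ∂(μ₁.prod μ₂)) := by
  have h := hasSum_integral_mul (hasSum_haar_two h₁ h₂ hf hf₂ hS hc₁ hc₂) hφ
  have e : ∫ x, φ x * (hf₂.toLp f) x ∂(μ₁.prod μ₂) = ∫ x, φ x * f x ∂(μ₁.prod μ₂) := by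
    refine integral_congr_ae ?_
    filter_upwards [hf₂.coeFn_toLp] with x hx
    rw [hx]
  rw [e] at h
  refine h.congr_fun fun i => ?_
  rw [integral_mul_smul_toLp, haarCoeff_eq, mul_comm]
  simp_rw [mul_comm (φ _)]

lemma cancelFst_haarSum (a : H₁.Index × H₂.Index → 𝕜) (F : Finset (H₁.Index × H₂.Index)) :
    CancelFst μ₁ μ₂ (haarSum H₁ H₂ a F) := by
  intro q hq
  simp only [haarSum, RCLike.real_smul_eq_coe_mul, Finset.mul_sum]
  have : ∀ (i : H₁.Index × H₂.Index) (x : X₁ × X₂), ((q x.2 : ℝ) : 𝕜) *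
      (a i * prodHaar 𝕜 H₁ H₂ i x) = a i * (((q x.2 : ℝ) : 𝕜) * prodHaar 𝕜 H₁ H₂ i x) :=
    fun i x => by ring
  simp_rw [this]
  rw [integral_finsetSum]
  · simp_rw [integral_const_mul, integral_snd_mul_prodHaar h₁, mul_zero, Finset.sum_const_zero]
  · intro i _
    have := (integrable_snd_smul (integrable_prodHaar 𝕜 h₁ h₂ i) hq).const_mul (a i)
    simpa only [RCLike.real_smul_eq_coe_mul] using this

lemma cancelSnd_haarSum (a : H₁.Index × H₂.Index → 𝕜) (F : Finset (H₁.Index × H₂.Index)) :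
    CancelSnd μ₁ μ₂ (haarSum H₁ H₂ a F) := by
  intro p hp
  simp only [haarSum, RCLike.real_smul_eq_coe_mul, Finset.mul_sum]
  have : ∀ (i : H₁.Index × H₂.Index) (x : X₁ × X₂), ((p x.1 : ℝ) : 𝕜) *
      (a i * prodHaar 𝕜 H₁ H₂ i x) = a i * (((p x.1 : ℝ) : 𝕜) * prodHaar 𝕜 H₁ H₂ i x) :=
    fun i x => by ring
  simp_rw [this]
  rw [integral_finsetSum]
  · simp_rw [integral_const_mul, integral_fst_mul_prodHaar h₂, mul_zero, Finset.sum_const_zero]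
  · intro i _
    have := (integrable_fst_smul (integrable_prodHaar 𝕜 h₁ h₂ i) hp).const_mul (a i)
    simpa only [RCLike.real_smul_eq_coe_mul] using this

omit [SigmaFinite μ₁] [SigmaFinite μ₂] in
/-- The Haar functions that contribute to a function supported in `T₁ N × T₂ N` belong to
rectangles contained in this set. -/
lemma haarCoeff_eq_zero_of_support {f : X₁ × X₂ → 𝕜} {N : ℕ}
    (hsupp : ∀ᵐ x ∂(μ₁.prod μ₂), x ∉ T₁ N ×ˢ T₂ N → f x = 0)
    (hc₁ : CancelFst μ₁ μ₂ f) (hc₂ : CancelSnd μ₁ μ₂ f) {i : H₁.Index × H₂.Index}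
    (hi : haarCoeff H₁ H₂ f i ≠ 0) : i.1 ∈ H₁.below T₁ N ∧ i.2 ∈ H₂.below T₂ N := by
  constructor
  · by_contra hn
    refine hi ?_
    have : haarCoeff H₁ H₂ f i =
        ∫ x, H₁.haar i.1 x₁ • (H₂.haar i.2 x.2 • f x) ∂(μ₁.prod μ₂) := by
      refine integral_congr_ae ?_
      filter_upwards [hsupp] with x hx
      by_cases hxT : x ∈ T₁ N ×ˢ T₂ N
      · rw [h₁.haar_eq_of_notMem_below hn hxT.1 (h₁.mem_tower N), mul_smul]
      · simp [hx hxT]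
    rw [this, integral_smul, hc₁ _ (H₂.bddMeas_haar i.2), smul_zero]
  · by_contra hn
    refine hi ?_
    have : haarCoeff H₁ H₂ f i =
        ∫ x, H₂.haar i.2 x₂ • (H₁.haar i.1 x.1 • f x) ∂(μ₁.prod μ₂) := by
      refine integral_congr_ae ?_
      filter_upwards [hsupp] with x hx
      by_cases hxT : x ∈ T₁ N ×ˢ T₂ N
      · rw [h₂.haar_eq_of_notMem_below hn hxT.2 (h₂.mem_tower N), mul_comm, mul_smul]
      · simp [hx hxT]
    rw [this, integral_smul, hc₂ _ (H₁.bddMeas_haar i.1), smul_zero]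

/-- A Haar partial sum of `f` that contains all contributions of generation less than `n` and no
others takes the averages of `f` over the dyadic rectangles of generation `n` as its values. In
particular, it has the same bound as `f`. -/
lemma norm_haarSum_le {f : X₁ × X₂ → 𝕜} (hf : Integrable f (μ₁.prod μ₂)) {M : ℝ}
    (hM : ∀ᵐ x ∂(μ₁.prod μ₂), ‖f x‖ ≤ M) (hc₁ : CancelFst μ₁ μ₂ f) (hc₂ : CancelSnd μ₁ μ₂ f)
    {n : ℤ} {F : Finset (H₁.Index × H₂.Index)} (hF : ∀ i ∈ F, i.1.1 < n ∧ i.2.1 < n)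
    (hF' : ∀ i : H₁.Index × H₂.Index, i.1.1 < n → i.2.1 < n → haarCoeff H₁ H₂ f i ≠ 0 → i ∈ F)
    (x : X₁ × X₂) : ‖haarSum H₁ H₂ (haarCoeff H₁ H₂ f) F x‖ ≤ M := by
  classical
  obtain ⟨Q₁, hQ₁, hx₁⟩ := H₁.exists_cube n x.1
  obtain ⟨Q₂, hQ₂, hx₂⟩ := H₂.exists_cube n x.2
  set s := haarSum H₁ H₂ (haarCoeff H₁ H₂ f) F with hs
  have hsi : Integrable s (μ₁.prod μ₂) := integrable_haarSum h₁ h₂ _ _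
  have hconst : ∀ y ∈ Q₁ ×ˢ Q₂, s y = s x := by
    intro y hy
    simp only [hs, haarSum, prodHaar, tensor]
    refine Finset.sum_congr rfl fun i hi => ?_
    rw [HaarSystem.haar_eq_of_mem i.1 (hF i hi).1 hQ₁ hy.1 hx₁,
      HaarSystem.haar_eq_of_mem i.2 (hF i hi).2 hQ₂ hy.2 hx₂]
  have hz : ∫ y in Q₁ ×ˢ Q₂, (f - s) y ∂(μ₁.prod μ₂) = 0 := by
    refine setIntegral_prod_eq_zero h₁ h₂ (hf.sub hsi) (n := n) (fun i hi₁ hi₂ => ?_)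
      (fun _ q hq => ?_) (fun _ p hp => ?_) le_rfl le_rfl hQ₁ hQ₂
    · have e : f - s = f + (-1 : 𝕜) • s := by rw [neg_one_smul, sub_eq_add_neg]
      rw [e, haarCoeff_add H₁ H₂ hf (hsi.smul _), haarCoeff_smul, hs, haarCoeff_haarSum h₁ h₂]
      split_ifs with hi
      · ring
      · have : haarCoeff H₁ H₂ f i = 0 := by
          by_contra h0
          exact hi (hF' i hi₁ hi₂ h0)
        simp [this]
    · simp only [Pi.sub_apply, smul_sub]
      rw [integral_sub (integrable_snd_smul hf hq) (integrable_snd_smul hsi hq), hc₁ q hq,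
        cancelFst_haarSum h₁ h₂ _ _ q hq, sub_zero]
    · simp only [Pi.sub_apply, smul_sub]
      rw [integral_sub (integrable_fst_smul hf hp) (integrable_fst_smul hsi hp), hc₂ p hp,
        cancelSnd_haarSum h₁ h₂ _ _ p hp, sub_zero]
  have hμ : μ₁.prod μ₂ (Q₁ ×ˢ Q₂) < ∞ := by
    rw [Measure.prod_prod]
    exact ENNReal.mul_lt_top (h₁.measure_lt_top _ _ hQ₁) (h₂.measure_lt_top _ _ hQ₂)
  have hpos : 0 < (μ₁.prod μ₂).real (Q₁ ×ˢ Q₂) := by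
    rw [measureReal_prod_prod]
    exact mul_pos (h₁.measureReal_pos hQ₁) (h₂.measureReal_pos hQ₂)
  have hm : MeasurableSet (Q₁ ×ˢ Q₂) :=
    (H₁.measurableSet_cube _ _ hQ₁).prod (H₂.measurableSet_cube _ _ hQ₂)
  simp only [Pi.sub_apply] at hz
  rw [integral_sub hf.integrableOn hsi.integrableOn, setIntegral_congr_fun hm hconst,
    setIntegral_const, sub_eq_zero] at hz
  have hle := norm_setIntegral_le_of_norm_le_const_ae (μ := μ₁.prod μ₂) (s := Q₁ ×ˢ Q₂) hμ
    (ae_restrict_of_ae hM)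
  rw [hz, norm_smul, Real.norm_of_nonneg hpos.le, mul_comm] at hle
  exact le_of_mul_le_mul_right hle hpos

/-- For a bounded function `f` with bounded support, `∫ φ f` is computed along the partial sums of
the Haar series of `f` that run over all generations up to `n`. -/
lemma haarPairing_eq_integral_of_bounded {φ f : X₁ × X₂ → 𝕜}
    (hφ : ∀ n, IntegrableOn φ (T₁ n ×ˢ T₂ n) (μ₁.prod μ₂))
    (hf : Integrable f (μ₁.prod μ₂)) (hS : h1Norm H₁ H₂ f < ∞) {M : ℝ}
    (hM : ∀ᵐ x ∂(μ₁.prod μ₂), ‖f x‖ ≤ M) {N : ℕ}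
    (hsupp : ∀ᵐ x ∂(μ₁.prod μ₂), x ∉ T₁ N ×ˢ T₂ N → f x = 0)
    (hc₁ : CancelFst μ₁ μ₂ f) (hc₂ : CancelSnd μ₁ μ₂ f)
    (hsum : Summable fun i => haarCoeff H₁ H₂ φ i * haarCoeff H₁ H₂ f i) :
    Integrable (fun x => φ x * f x) (μ₁.prod μ₂) ∧
      haarPairing H₁ H₂ φ f = ∫ x, φ x * f x ∂(μ₁.prod μ₂) := by
  classical
  set R := T₁ N ×ˢ T₂ N with hR
  have hRm : MeasurableSet R := (h₁.measurableSet_tower N).prod (h₂.measurableSet_tower N)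
  set ψ := R.indicator φ with hψ
  have hψi : Integrable ψ (μ₁.prod μ₂) := (integrable_indicator_iff hRm).2 (hφ N)
  have hψf : (fun x => ψ x * f x) =ᵐ[μ₁.prod μ₂] fun x => φ x * f x := by
    filter_upwards [hsupp] with x hx
    by_cases hxR : x ∈ R
    · simp [hψ, hxR]
    · simp [hx hxR]
  have hint : Integrable (fun x => ψ x * f x) (μ₁.prod μ₂) :=
    hψi.mul_bdd (c := M) hf.aestronglyMeasurable hM
  refine ⟨hint.congr hψf, ?_⟩
  -- The finite set `F n` consists of the labels of generation less than `n` that can contribute.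
  have hfinite : ∀ n : ℕ, {i : H₁.Index × H₂.Index | (i.1 ∈ H₁.below T₁ N ∧ i.1.1 < (n : ℤ)) ∧
      (i.2 ∈ H₂.below T₂ N ∧ i.2.1 < (n : ℤ))}.Finite := fun n =>
    ((h₁.finite_below N n).prod (h₂.finite_below N n)).subset fun i hi => hi
  set F : ℕ → Finset (H₁.Index × H₂.Index) := fun n => (hfinite n).toFinset with hFdef
  have hmem : ∀ n i, i ∈ F n ↔ (i.1 ∈ H₁.below T₁ N ∧ i.1.1 < (n : ℤ)) ∧
      (i.2 ∈ H₂.below T₂ N ∧ i.2.1 < (n : ℤ)) := fun n i => by simp [hFdef]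
  have hFmono : Monotone F := by
    intro m n hmn i hi
    rw [hmem] at hi ⊢
    refine ⟨⟨hi.1.1, hi.1.2.trans_le ?_⟩, hi.2.1, hi.2.2.trans_le ?_⟩ <;> exact_mod_cast hmn
  have hFsupp : ∀ i, haarCoeff H₁ H₂ f i ≠ 0 → ∃ n, i ∈ F n := by
    intro i hi
    obtain ⟨b₁, b₂⟩ := haarCoeff_eq_zero_of_support h₁ h₂ hsupp hc₁ hc₂ hi
    refine ⟨(max i.1.1 i.2.1 + 1).toNat, (hmem _ _).2 ⟨⟨b₁, ?_⟩, b₂, ?_⟩⟩ <;> omega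
  set s : ℕ → X₁ × X₂ → 𝕜 := fun n => haarSum H₁ H₂ (haarCoeff H₁ H₂ f) (F n) with hs
  have hsM : ∀ n x, ‖s n x‖ ≤ M := fun n x => by
    refine norm_haarSum_le h₁ h₂ hf hM hc₁ hc₂ (n := n) (fun i hi => ?_) (fun i e₁ e₂ hi => ?_) x
    · exact ⟨((hmem n i).1 hi).1.2, ((hmem n i).1 hi).2.2⟩
    · obtain ⟨b₁, b₂⟩ := haarCoeff_eq_zero_of_support h₁ h₂ hsupp hc₁ hc₂ hi
      exact (hmem n i).2 ⟨⟨b₁, e₁⟩, b₂, e₂⟩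
  -- The partial sums converge to `f` in `L¹`, hence almost everywhere along a subsequence.
  obtain ⟨ns, hns, hlim⟩ : ∃ ns : ℕ → ℕ, StrictMono ns ∧
      ∀ᵐ x ∂(μ₁.prod μ₂), Tendsto (fun k => s (ns k) x) atTop (𝓝 (f x)) := by
    have ht := tendsto_sum_of_support (hasSum_haar h₁ h₂ hf hS (fun _ => hc₁) fun _ => hc₂) hFmono
      fun i hi => hFsupp i fun h0 => hi (by rw [h0, zero_smul])
    obtain ⟨ns, hns, hlim⟩ := (tendstoInMeasure_of_tendsto_Lp ht).exists_seq_tendsto_ae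
    refine ⟨ns, hns, ?_⟩
    have he : ∀ᵐ x ∂(μ₁.prod μ₂), ∀ n, (∑ i ∈ F n, haarCoeff H₁ H₂ f i •
        (memLp_one_prodHaar 𝕜 h₁ h₂ i).toLp (prodHaar 𝕜 H₁ H₂ i) :
          Lp 𝕜 1 (μ₁.prod μ₂)) x = s n x :=
      ae_all_iff.2 fun n => sum_smul_toLp_prodHaar (haarCoeff H₁ H₂ f) (F n)
        fun i => memLp_one_prodHaar 𝕜 h₁ h₂ i
    filter_upwards [hlim, he, (memLp_one_iff_integrable.2 hf).coeFn_toLp] with x e1 e2 e3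
    rw [e3] at e1
    exact e1.congr fun k => e2 _
  have hdct : Tendsto (fun k => ∫ x, ψ x * s (ns k) x ∂(μ₁.prod μ₂)) atTop
      (𝓝 (∫ x, ψ x * f x ∂(μ₁.prod μ₂))) := by
    refine tendsto_integral_of_dominated_convergence (fun x => ‖ψ x‖ * M) (fun k => ?_)
      (hψi.norm.mul_const M) (fun k => Eventually.of_forall fun x => ?_) ?_
    · exact hψi.aestronglyMeasurable.mul (measurable_haarSum _ _).aestronglyMeasurable
    · rw [norm_mul]
      exact mul_le_mul_of_nonneg_left (hsM _ x) (norm_nonneg _)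
    · filter_upwards [hlim] with x hx
      exact hx.const_mul _
  have hval : ∀ n, ∫ x, ψ x * s n x ∂(μ₁.prod μ₂) =
      ∑ i ∈ F n, haarCoeff H₁ H₂ φ i * haarCoeff H₁ H₂ f i := by
    intro n
    simp only [hs, haarSum, Finset.mul_sum]
    rw [integral_finsetSum]
    · refine Finset.sum_congr rfl fun i hi => ?_
      rw [haarCoeff_eq φ, mul_comm, ← integral_const_mul]
      refine integral_congr_ae (Eventually.of_forall fun x => ?_)
      by_cases hx : x ∈ rect H₁ H₂ i
      · have hxR : x ∈ R := ⟨((hmem n i).1 hi).1.1.2 hx.1, ((hmem n i).1 hi).2.1.2 hx.2⟩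
        simp only [hψ, indicator_of_mem hxR]
        ring
      · simp [prodHaar_eq_zero hx]
    · intro i _
      obtain ⟨B, hB⟩ := exists_bound_prodHaar 𝕜 (H₁ := H₁) (H₂ := H₂) i
      refine hψi.mul_bdd (c := ‖haarCoeff H₁ H₂ f i‖ * B)
        (measurable_const.mul (measurable_prodHaar i)).aestronglyMeasurable
        (Eventually.of_forall fun x => ?_)
      rw [norm_mul]
      exact mul_le_mul_of_nonneg_left (hB x) (norm_nonneg _)
  have hpair := (tendsto_sum_of_support hsum.hasSum hFmono fun i hi =>
    hFsupp i (right_ne_zero_of_mul hi)).comp hns.tendsto_atTop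
  rw [← integral_congr_ae hψf]
  refine tendsto_nhds_unique hpair (hdct.congr fun k => ?_)
  rw [hval]; rfl

/-- For admissible pairs, the pairing is an absolutely convergent integral. -/
lemma haarPairing_eq_integral {φ f : X₁ × X₂ → 𝕜}
    (hφ : ∀ n, IntegrableOn φ (T₁ n ×ˢ T₂ n) (μ₁.prod μ₂))
    (hf : Integrable f (μ₁.prod μ₂)) (hS : h1Norm H₁ H₂ f < ∞)
    (hf₂ : MemLp f 2 (μ₁.prod μ₂)) (hadm : IsAdmissiblePair ρ₁ ρ₂ μ₁ μ₂ φ f)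
    (hsum : Summable fun i => haarCoeff H₁ H₂ φ i * haarCoeff H₁ H₂ f i) :
    Integrable (fun x => φ x * f x) (μ₁.prod μ₂) ∧
      haarPairing H₁ H₂ φ f = ∫ x, φ x * f x ∂(μ₁.prod μ₂) := by
  have c₁ : μ₁ univ < ∞ → CancelFst μ₁ μ₂ f := fun h => cancelFst_of_ae hf (hadm.cancel₁ h)
  have c₂ : μ₂ univ < ∞ → CancelSnd μ₁ μ₂ f := fun h => cancelSnd_of_ae hf (hadm.cancel₂ h)
  rcases hadm.regular with h2 | ⟨hfb, y₁, r₁, y₂, r₂, hsupp⟩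
  · exact ⟨h2.integrable_mul hf₂,
      (hasSum_haarPairing_of_memLp_two h₁ h₂ h2 hf hf₂ hS c₁ c₂).tsum_eq⟩
  · obtain ⟨d₁, d₂⟩ := cancel_of_h1Norm h₁ h₂ hf hS c₁ c₂
    obtain ⟨n₁, hn₁⟩ := h₁.exists_subset_tower y₁ r₁
    obtain ⟨n₂, hn₂⟩ := h₂.exists_subset_tower y₂ r₂
    refine haarPairing_eq_integral_of_bounded h₁ h₂ hφ hf hS (N := max n₁ n₂)
      (M := (eLpNorm f ∞ (μ₁.prod μ₂)).toReal) ?_ ?_ d₁ d₂ hsum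
    · have := ae_le_eLpNormEssSup (f := f) (μ := μ₁.prod μ₂)
      filter_upwards [this] with x hx
      rw [← toReal_enorm]
      exact ENNReal.toReal_mono hfb.2.ne (by rwa [eLpNorm_exponent_top])
    · filter_upwards [hsupp] with x hx hxR
      refine hx fun hxb => hxR ⟨h₁.monotone_tower (le_max_left _ _) (hn₁ hxb.1),
        h₂.monotone_tower (le_max_right _ _) (hn₂ hxb.2)⟩

end Pairing

/-! ### Functions with prescribed Haar coefficients -/

section Existence

lemma summable_prod_of_finite_fst {α β E : Type*} [AddCommGroup E] [TopologicalSpace E]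
    [IsTopologicalAddGroup E] {f : α × β → E} {S : Set α} (hS : S.Finite)
    (h0 : ∀ i : α × β, i.1 ∉ S → f i = 0) (h : ∀ a, Summable fun b => f (a, b)) : Summable f := by
  classical
  have e : f = fun i => ∑ a ∈ hS.toFinset, if i.1 = a then f (a, i.2) else 0 := by
    funext i
    rw [Finset.sum_ite_eq]
    split_ifs with hi
    · rfl
    · exact h0 i (by simpa using hi)
  rw [e]
  refine summable_sum fun a _ => ?_
  have hinj : Function.Injective fun b : β => (a, b) := fun b b' hb => (Prod.mk.inj hb).2
  refine (hinj.summable_iff fun i hi => ?_).1 ?_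
  · rw [if_neg]
    rintro rfl
    exact hi ⟨i.2, rfl⟩
  · refine (h a).congr fun b => ?_
    simp

lemma summable_prod_of_finite_snd {α β E : Type*} [AddCommGroup E] [TopologicalSpace E]
    [IsTopologicalAddGroup E] {f : α × β → E} {S : Set β} (hS : S.Finite)
    (h0 : ∀ i : α × β, i.2 ∉ S → f i = 0) (h : ∀ b, Summable fun a => f (a, b)) : Summable f := by
  rw [← (Equiv.prodComm β α).summable_iff]
  exact summable_prod_of_finite_fst hS (fun i hi => h0 _ hi) h

variable {𝕜 : Type*} [RCLike 𝕜] {X₁ X₂ : Type*} [MeasurableSpace X₁] [MeasurableSpace X₂]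
  {ρ₁ : X₁ → X₁ → ℝ} {ρ₂ : X₂ → X₂ → ℝ} {μ₁ : Measure X₁} {μ₂ : Measure X₂}
  {H₁ : HaarSystem ρ₁ μ₁} {H₂ : HaarSystem ρ₂ μ₂}
  {T₁ : ℕ → Set X₁} {x₁ : X₁} {T₂ : ℕ → Set X₂} {x₂ : X₂}

/-- The function `1_{T n} (h_i - s_i)`, where `s_i` is the value of `h_i` at the base point if the
cube of `h_i` has negative generation, and zero otherwise. It vanishes unless the cube of `h_i` is
contained in `T n` and has generation at least `-n`. -/
noncomputable def HaarSystem.shifted {X : Type*} [MeasurableSpace X] {ρ : X → X → ℝ}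
    {μ : Measure X} (H : HaarSystem ρ μ) (T : ℕ → Set X) (x₀ : X) (n : ℕ) (i : H.Index) : X → ℝ :=
  (T n).indicator fun x => H.haar i x - H.shift x₀ i

section OneParameter

variable {X : Type*} [MeasurableSpace X] {ρ : X → X → ℝ}
  {μ : Measure X} {H : HaarSystem ρ μ} {T : ℕ → Set X} {x₀ : X} (h : H.Regular T x₀)
include h

lemma HaarSystem.Regular.shifted_eq_zero {n : ℕ} {i : H.Index} (hi : i ∉ H.below T n) :
    H.shifted T x₀ n i = 0 := by
  funext x
  by_cases hx : x ∈ T n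
  · simp [HaarSystem.shifted, hx, h.haar_sub_shift_eq_zero hi hx]
  · simp [HaarSystem.shifted, hx]

omit h in
lemma HaarSystem.shifted_eq {n : ℕ} {i : H.Index} (hi : i ∈ H.below T n) (x : X) :
    H.shifted T x₀ n i x =
      H.haar i x - H.shift x₀ i * (T n).indicator (fun _ => (1 : ℝ)) x := by
  by_cases hx : x ∈ T n
  · simp [HaarSystem.shifted, hx]
  · simp [HaarSystem.shifted, hx, HaarSystem.haar_eq_zero i fun hxi => hx (hi.2 hxi)]

lemma HaarSystem.Regular.memLp_indicator_tower (n : ℕ) (p : ℝ≥0∞) :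
    MemLp ((T n).indicator fun _ => (1 : ℝ)) p μ :=
  memLp_indicator_const p (h.measurableSet_tower n) 1
    (Or.inr (h.measure_lt_top _ _ (h.tower_mem n)).ne)

lemma HaarSystem.Regular.memLp_two_shifted (n : ℕ) (i : H.Index) :
    MemLp (H.shifted T x₀ n i) 2 μ := by
  by_cases hi : i ∈ H.below T n
  · have : H.shifted T x₀ n i =
        H.haar i - fun x => H.shift x₀ i * (T n).indicator (fun _ => (1 : ℝ)) x :=
      funext (HaarSystem.shifted_eq hi)
    rw [this]
    exact (h.memLp_two_haar i).sub ((h.memLp_indicator_tower n 2).const_mul _)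
  · rw [h.shifted_eq_zero hi]
    exact MemLp.zero

end OneParameter

variable [SigmaFinite μ₁] [SigmaFinite μ₂] (h₁ : H₁.Regular T₁ x₁) (h₂ : H₂.Regular T₂ x₂)
include h₁ h₂

lemma summable_fst_smul_tensor_haar {b : H₂.Index → 𝕜} (hb : Summable fun i => ‖b i‖ ^ 2) (n : ℕ) :
    Summable fun i => b i • ((memLp_two_tensor (h₁.memLp_indicator_tower n 2)
      (h₂.memLp_two_haar i)).toLp _ : Lp 𝕜 2 (μ₁.prod μ₂)) := by
  classical
  set k : ℝ := √(μ₁.real (T₁ n)) with hk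
  have hpos : 0 < μ₁.real (T₁ n) := h₁.measureReal_pos (h₁.tower_mem n)
  have hk0 : k ≠ 0 := (Real.sqrt_pos.2 hpos).ne'
  have hmem := h₁.memLp_indicator_tower n 2
  have ho := orthonormal_tensor (𝕜 := 𝕜) (μ₁ := μ₁) (μ₂ := μ₂) (J₁ := Unit) (J₂ := H₂.Index)
    (p := fun _ x => k⁻¹ * (T₁ n).indicator (fun _ => (1 : ℝ)) x) (q := H₂.haar)
    (fun _ => hmem.const_mul _) h₂.memLp_two_haar (fun _ _ => ?_)
    fun i j => h₂.integral_haar_mul i j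
  · have hs := (summable_orthonormal_smul
      (ho.comp (fun i : H₂.Index => ((), i)) fun i j hij => (Prod.mk.inj hij).2) hb).const_smul
      ((k : ℝ) : 𝕜)
    refine hs.congr fun i => ?_
    rw [smul_comm, Function.comp]
    congr 1
    rw [← MemLp.toLp_const_smul]
    refine MemLp.toLp_congr _ _ (Eventually.of_forall fun x => ?_)
    simp only [tensor, Pi.smul_apply, smul_eq_mul]
    rw [← RCLike.ofReal_mul]
    congr 1
    field_simp
  · have : ∀ x, (k⁻¹ * (T₁ n).indicator (fun _ => (1 : ℝ)) x) *
        (k⁻¹ * (T₁ n).indicator (fun _ => (1 : ℝ)) x) =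
        (k⁻¹ * k⁻¹) * (T₁ n).indicator (fun _ => (1 : ℝ)) x := by
      intro x
      by_cases hx : x ∈ T₁ n <;> simp [hx]
    simp_rw [this]
    rw [integral_const_mul, integral_indicator_const _ (h₁.measurableSet_tower n), ← mul_inv, hk,
      Real.mul_self_sqrt hpos.le]
    simp [hpos.ne']

lemma summable_snd_smul_tensor_haar {b : H₁.Index → 𝕜} (hb : Summable fun i => ‖b i‖ ^ 2) (n : ℕ) :
    Summable fun i => b i • ((memLp_two_tensor (h₁.memLp_two_haar i)
      (h₂.memLp_indicator_tower n 2)).toLp _ : Lp 𝕜 2 (μ₁.prod μ₂)) := by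
  classical
  set k : ℝ := √(μ₂.real (T₂ n)) with hk
  have hpos : 0 < μ₂.real (T₂ n) := h₂.measureReal_pos (h₂.tower_mem n)
  have hk0 : k ≠ 0 := (Real.sqrt_pos.2 hpos).ne'
  have hmem := h₂.memLp_indicator_tower n 2
  have ho := orthonormal_tensor (𝕜 := 𝕜) (μ₁ := μ₁) (μ₂ := μ₂) (J₁ := H₁.Index) (J₂ := Unit)
    (p := H₁.haar) (q := fun _ x => k⁻¹ * (T₂ n).indicator (fun _ => (1 : ℝ)) x)
    h₁.memLp_two_haar (fun _ => hmem.const_mul _)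
    (fun i j => h₁.integral_haar_mul i j) (fun _ _ => ?_)
  · have hs := (summable_orthonormal_smul
      (ho.comp (fun i : H₁.Index => (i, ())) fun i j hij => (Prod.mk.inj hij).1) hb).const_smul
      ((k : ℝ) : 𝕜)
    refine hs.congr fun i => ?_
    rw [smul_comm, Function.comp]
    congr 1
    rw [← MemLp.toLp_const_smul]
    refine MemLp.toLp_congr _ _ (Eventually.of_forall fun x => ?_)
    simp only [tensor, Pi.smul_apply, smul_eq_mul]
    rw [← RCLike.ofReal_mul]
    congr 1
    field_simp
  · have : ∀ x, (k⁻¹ * (T₂ n).indicator (fun _ => (1 : ℝ)) x) *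
        (k⁻¹ * (T₂ n).indicator (fun _ => (1 : ℝ)) x) =
        (k⁻¹ * k⁻¹) * (T₂ n).indicator (fun _ => (1 : ℝ)) x := by
      intro x
      by_cases hx : x ∈ T₂ n <;> simp [hx]
    simp_rw [this]
    rw [integral_const_mul, integral_indicator_const _ (h₂.measurableSet_tower n), ← mul_inv, hk,
      Real.mul_self_sqrt hpos.le]
    simp [hpos.ne']

/-- The series of the shifted and truncated Haar functions converges in `L²`. It differs from an
orthogonal series in finitely many shifts. -/
lemma summable_shifted {c : H₁.Index × H₂.Index → 𝕜} {n : ℕ}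
    (hc : Summable ((H₁.below T₁ n ×ˢ H₂.below T₂ n).indicator fun i => ‖c i‖ ^ 2)) :
    Summable fun i : H₁.Index × H₂.Index => c i • ((memLp_two_tensor
      (h₁.memLp_two_shifted n i.1) (h₂.memLp_two_shifted n i.2)).toLp _ :
        Lp 𝕜 2 (μ₁.prod μ₂)) := by
  classical
  set S : Set (H₁.Index × H₂.Index) := H₁.below T₁ n ×ˢ H₂.below T₂ n with hS
  set c' : H₁.Index × H₂.Index → 𝕜 := S.indicator c with hc'
  have hcs : Summable fun i => ‖c' i‖ ^ 2 := by
    refine hc.congr fun i => ?_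
    by_cases hi : i ∈ S <;> simp [hc', hi]
  have t₁ := h₁.memLp_indicator_tower n 2
  have t₂ := h₂.memLp_indicator_tower n 2
  set σ₁ : H₁.Index → 𝕜 := fun i => ((H₁.shift x₁ i : ℝ) : 𝕜) with hσ₁
  set σ₂ : H₂.Index → 𝕜 := fun i => ((H₂.shift x₂ i : ℝ) : 𝕜) with hσ₂
  have F₁ := h₁.finite_shift_ne_zero n
  have F₂ := h₂.finite_shift_ne_zero n
  have z₁ : ∀ i : H₁.Index × H₂.Index, i.1 ∉ {i | i ∈ H₁.below T₁ n ∧ H₁.shift x₁ i ≠ 0} →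
      σ₁ i.1 * c' i = 0 := by
    intro i hi
    by_cases hiS : i ∈ S
    · have : H₁.shift x₁ i.1 = 0 := by
        by_contra h0
        exact hi ⟨hiS.1, h0⟩
      simp [hσ₁, this]
    · simp [hc', hiS]
  have z₂ : ∀ i : H₁.Index × H₂.Index, i.2 ∉ {i | i ∈ H₂.below T₂ n ∧ H₂.shift x₂ i ≠ 0} →
      σ₂ i.2 * c' i = 0 := by
    intro i hi
    by_cases hiS : i ∈ S
    · have : H₂.shift x₂ i.2 = 0 := by
        by_contra h0
        exact hi ⟨hiS.2, h0⟩
      simp [hσ₂, this]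
    · simp [hc', hiS]
  have s1 := summable_orthonormal_smul (orthonormal_prodHaar 𝕜 h₁ h₂) hcs
  have s2 : Summable fun i : H₁.Index × H₂.Index => (σ₁ i.1 * c' i) •
      ((memLp_two_tensor t₁ (h₂.memLp_two_haar i.2)).toLp _ : Lp 𝕜 2 (μ₁.prod μ₂)) := by
    refine summable_prod_of_finite_fst F₁ (fun i hi => by rw [z₁ i hi, zero_smul]) fun a => ?_
    simp_rw [mul_smul]
    refine Summable.const_smul _ (summable_fst_smul_tensor_haar h₁ h₂ ?_ n)
    exact hcs.comp_injective (i := fun b => (a, b)) fun b b' hb => (Prod.mk.inj hb).2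
  have s3 : Summable fun i : H₁.Index × H₂.Index => (σ₂ i.2 * c' i) •
      ((memLp_two_tensor (h₁.memLp_two_haar i.1) t₂).toLp _ : Lp 𝕜 2 (μ₁.prod μ₂)) := by
    refine summable_prod_of_finite_snd F₂ (fun i hi => by rw [z₂ i hi, zero_smul]) fun b => ?_
    simp_rw [mul_smul]
    refine Summable.const_smul _ (summable_snd_smul_tensor_haar h₁ h₂ ?_ n)
    exact hcs.comp_injective (i := fun a => (a, b)) fun b b' hb => (Prod.mk.inj hb).1
  have s4 : Summable fun i : H₁.Index × H₂.Index => (σ₁ i.1 * (σ₂ i.2 * c' i)) •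
      ((memLp_two_tensor t₁ t₂).toLp _ : Lp 𝕜 2 (μ₁.prod μ₂)) := by
    refine summable_of_hasFiniteSupport ((F₁.prod F₂).subset fun i hi => ?_)
    rw [Function.mem_support] at hi
    constructor
    · by_contra h0
      exact hi (by rw [mul_left_comm, z₁ i h0, mul_zero, zero_smul])
    · by_contra h0
      exact hi (by rw [z₂ i h0, mul_zero, zero_smul])
  -- The four series arise from expanding the product of the shifted Haar functions.
  refine (((s1.sub s2).sub s3).add s4).congr fun i => ?_
  by_cases hi : i ∈ S
  · have e : c' i = c i := by simp [hc', hi]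
    rw [e]
    simp only [← MemLp.toLp_const_smul, ← MemLp.toLp_sub, ← MemLp.toLp_add]
    refine MemLp.toLp_congr _ _ (Eventually.of_forall fun x => ?_)
    simp only [prodHaar, tensor, Pi.smul_apply, Pi.sub_apply, Pi.add_apply, smul_eq_mul,
      HaarSystem.shifted_eq hi.1, HaarSystem.shifted_eq hi.2, hσ₁, hσ₂]
    push_cast
    ring
  · have e : c' i = 0 := by simp [hc', hi]
    have e' : tensor 𝕜 (H₁.shifted T₁ x₁ n i.1) (H₂.shifted T₂ x₂ n i.2) = 0 := by
      funext x
      by_cases h : i.1 ∈ H₁.below T₁ n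
      · have h' : i.2 ∉ H₂.below T₂ n := fun h' => hi ⟨h, h'⟩
        simp [tensor, h₂.shifted_eq_zero h']
      · simp [tensor, h₁.shifted_eq_zero h]
    have e'' : ∀ hm : MemLp (tensor 𝕜 (H₁.shifted T₁ x₁ n i.1) (H₂.shifted T₂ x₂ n i.2)) 2
        (μ₁.prod μ₂), hm.toLp _ = 0 := by
      rw [e']
      exact MemLp.toLp_zero
    rw [e, e'']
    simp only [zero_smul, smul_zero, mul_zero, sub_zero, add_zero]

/-- Every family of coefficients that is locally square summable is the family of Haar
coefficients of a locally integrable function. On each of the sets `T₁ n × T₂ n`, this function is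
the sum of the shifted Haar series; the shifts, which make the series converge, do not affect the
coefficients, because the Haar functions have integral zero. -/
lemma exists_haarCoeff_eq {c : H₁.Index × H₂.Index → 𝕜}
    (hc : ∀ n, Summable ((H₁.below T₁ n ×ˢ H₂.below T₂ n).indicator fun i => ‖c i‖ ^ 2)) :
    ∃ φ : X₁ × X₂ → 𝕜, (∀ n, IntegrableOn φ (T₁ n ×ˢ T₂ n) (μ₁.prod μ₂)) ∧
      ∀ i, haarCoeff H₁ H₂ φ i = c i := by
  classical
  choose Φ hΦ using fun n => summable_shifted h₁ h₂ (hc n)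
  set R : ℕ → Set (X₁ × X₂) := fun n => T₁ n ×ˢ T₂ n with hR
  have hRm : ∀ n, MeasurableSet (R n) := fun n =>
    (h₁.measurableSet_tower n).prod (h₂.measurableSet_tower n)
  have hRfin : ∀ n, μ₁.prod μ₂ (R n) < ∞ := fun n => by
    rw [hR, Measure.prod_prod]
    exact ENNReal.mul_lt_top (h₁.measure_lt_top _ _ (h₁.tower_mem n))
      (h₂.measure_lt_top _ _ (h₂.tower_mem n))
  have hRmono : Monotone R := fun m n h =>
    prod_mono (h₁.monotone_tower h) (h₂.monotone_tower h)
  have hΦint : ∀ n (s : Set (X₁ × X₂)), μ₁.prod μ₂ s < ∞ → IntegrableOn (Φ n) s (μ₁.prod μ₂) :=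
    fun n s hs => have : IsFiniteMeasure ((μ₁.prod μ₂).restrict s) := ⟨by
        rwa [Measure.restrict_apply_univ]⟩
      ((Lp.memLp (Φ n)).restrict s).integrable one_le_two
  -- The limits for different `n` agree, since the terms of the series do.
  have hcons : ∀ m n, m ≤ n → ∀ᵐ x ∂(μ₁.prod μ₂), x ∈ R m → Φ n x = Φ m x := by
    intro m n hmn
    rw [← ae_restrict_iff' (hRm m)]
    refine ae_eq_of_forall_setIntegral_eq_of_sigmaFinite
      (fun s _ _ => Integrable.integrableOn (hΦint n _ (hRfin m)))
      (fun s _ _ => Integrable.integrableOn (hΦint m _ (hRfin m)))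
      fun s hs _ => ?_
    rw [Measure.restrict_restrict hs]
    set w : X₁ × X₂ → 𝕜 := (s ∩ R m).indicator fun _ => 1 with hw
    have hsm := hs.inter (hRm m)
    have hw2 : MemLp w 2 (μ₁.prod μ₂) := memLp_indicator_const 2 hsm 1
      (Or.inr ((measure_mono inter_subset_right).trans_lt (hRfin m)).ne)
    have hint : ∀ u : X₁ × X₂ → 𝕜, ∫ x in s ∩ R m, u x ∂(μ₁.prod μ₂) =
        ∫ x, w x * u x ∂(μ₁.prod μ₂) := by
      intro u
      rw [← integral_indicator hsm]
      congr 1 with x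
      by_cases hx : x ∈ s ∩ R m
      · simp only [hw, indicator_of_mem hx, one_mul]
      · simp only [hw, indicator_of_notMem hx, zero_mul]
    have a1 := hasSum_integral_mul (hΦ n) hw2
    have a2 := hasSum_integral_mul (hΦ m) hw2
    simp_rw [integral_mul_smul_toLp] at a1 a2
    rw [hint, hint]
    refine a1.unique (a2.congr_fun fun i => ?_)
    congr 1
    refine integral_congr_ae (Eventually.of_forall fun x => ?_)
    by_cases hx : x ∈ s ∩ R m
    · have x1 := hx.2.1
      have x2 := hx.2.2
      simp [tensor, HaarSystem.shifted, x1, x2, h₁.monotone_tower hmn x1,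
        h₂.monotone_tower hmn x2]
    · simp [hw, hx]
  have hex : ∀ x, ∃ n, x ∈ R n := by
    intro x
    have hU : ⋃ n, T₁ n ×ˢ T₂ n = univ := by
      rw [iUnion_prod_of_monotone h₁.monotone_tower h₂.monotone_tower, h₁.iUnion_tower,
        h₂.iUnion_tower, univ_prod_univ]
    exact mem_iUnion.1 (hU ▸ mem_univ x)
  -- The functions `Φ n` are glued: at each point, the first one defined there is taken.
  set φ : X₁ × X₂ → 𝕜 := fun x => Φ (Nat.find (hex x)) x with hφ
  have hφΦ : ∀ n, ∀ᵐ x ∂(μ₁.prod μ₂), x ∈ R n → φ x = Φ n x := by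
    intro n
    have hall : ∀ᵐ x ∂(μ₁.prod μ₂), ∀ m, m ≤ n → x ∈ R m → Φ n x = Φ m x :=
      ae_all_iff.2 fun m => by
        by_cases hmn : m ≤ n
        · filter_upwards [hcons m n hmn] with x hx _ using hx
        · exact Eventually.of_forall fun x h => absurd h hmn
    filter_upwards [hall] with x hx hxn
    exact (hx _ (Nat.find_min' (hex x) hxn) (Nat.find_spec (hex x))).symm
  refine ⟨φ, fun n => ?_, fun j => ?_⟩
  · refine (hΦint n _ (hRfin n)).congr_fun_ae ?_
    rw [EventuallyEq, ae_restrict_iff' (hRm n)]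
    filter_upwards [hφΦ n] with x hx hxn using (hx hxn).symm
  · obtain ⟨n, hn₁, hn₂⟩ := ((h₁.eventually_mem_below j.1).and (h₂.eventually_mem_below j.2)).exists
    have e : haarCoeff H₁ H₂ φ j = ∫ x, prodHaar 𝕜 H₁ H₂ j x * Φ n x ∂(μ₁.prod μ₂) := by
      rw [haarCoeff_eq]
      refine integral_congr_ae ?_
      filter_upwards [hφΦ n] with x hx
      by_cases hxj : x ∈ rect H₁ H₂ j
      · rw [hx ⟨hn₁.2 hxj.1, hn₂.2 hxj.2⟩]
      · simp [prodHaar_eq_zero hxj]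
    have a := hasSum_integral_mul (hΦ n) (memLp_two_prodHaar 𝕜 h₁ h₂ j)
    rw [e]
    refine a.unique ?_
    convert hasSum_ite_eq j (c j) using 2 with i
    rw [integral_mul_smul_toLp]
    simp_rw [prodHaar, tensor_mul_tensor]
    rw [integral_tensor]
    simp only [HaarSystem.shifted]
    rw [h₁.integral_haar_mul_shifted hn₁, h₂.integral_haar_mul_shifted hn₂]
    by_cases hij : i = j
    · simp [hij]
    · have : ¬ (i.1 = j.1 ∧ i.2 = j.2) := fun h => hij (Prod.ext h.1 h.2)
      rw [if_neg hij]
      by_cases h1 : i.1 = j.1 <;> by_cases h2 : i.2 = j.2 <;> simp_all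

end Existence

/-! ### Bounded functionals on the Hardy space -/

section Duality

variable {𝕜 : Type*} [RCLike 𝕜] {X₁ X₂ : Type*} [MeasurableSpace X₁] [MeasurableSpace X₂]
  {ρ₁ : X₁ → X₁ → ℝ} {ρ₂ : X₂ → X₂ → ℝ} {μ₁ : Measure X₁} {μ₂ : Measure X₂}
  {H₁ : HaarSystem ρ₁ μ₁} {H₂ : HaarSystem ρ₂ μ₂} [SigmaFinite μ₁] [SigmaFinite μ₂]
  {T₁ : ℕ → Set X₁} {x₁ : X₁} {T₂ : ℕ → Set X₂} {x₂ : X₂}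
  (h₁ : H₁.Regular T₁ x₁) (h₂ : H₂.Regular T₂ x₂)
include h₁ h₂

omit [SigmaFinite μ₁] in
/-- The `L¹` norm of a square function supported in `Ω`, by the Cauchy–Schwarz inequality. -/
lemma lintegral_sqSum_le {b : H₁.Index × H₂.Index → ℝ≥0∞} {Ω : Set (X₁ × X₂)}
    (hb : ∀ i, b i ≠ 0 → rect H₁ H₂ i ⊆ Ω) :
    ∫⁻ x, sqSum H₁ H₂ b x ∂(μ₁.prod μ₂) ≤
      (∑' i, b i ^ 2) ^ (1 / 2 : ℝ) * μ₁.prod μ₂ Ω ^ (1 / 2 : ℝ) := by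
  -- The set `Ω` need not be measurable.
  set A := toMeasurable (μ₁.prod μ₂) Ω with hA
  have hAm : MeasurableSet A := measurableSet_toMeasurable _ _
  have h0 : ∀ x, sqSum H₁ H₂ b x = (sqSum H₁ H₂ b * (A.indicator 1 : X₁ × X₂ → ℝ≥0∞)) x := by
    intro x
    by_cases hx : x ∈ A
    · simp [hx]
    · have : sqSum H₁ H₂ b x ^ 2 = 0 := by
        rw [sqSum_sq, ENNReal.tsum_eq_zero]
        intro i
        rw [sqSum_term_eq h₁]
        by_cases hi : b i = 0
        · simp [hi]
        · exact indicator_of_notMem (fun hxi => hx (subset_toMeasurable _ _ (hb i hi hxi))) _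
      rw [pow_eq_zero_iff two_ne_zero] at this
      simp [this]
  calc ∫⁻ x, sqSum H₁ H₂ b x ∂(μ₁.prod μ₂)
      = ∫⁻ x, (sqSum H₁ H₂ b * (A.indicator 1 : X₁ × X₂ → ℝ≥0∞)) x ∂(μ₁.prod μ₂) :=
        lintegral_congr h0
    _ ≤ (∫⁻ x, sqSum H₁ H₂ b x ^ (2 : ℝ) ∂(μ₁.prod μ₂)) ^ (1 / 2 : ℝ) *
        (∫⁻ x, A.indicator 1 x ^ (2 : ℝ) ∂(μ₁.prod μ₂)) ^ (1 / 2 : ℝ) :=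
        ENNReal.lintegral_mul_le_Lp_mul_Lq _ Real.HolderConjugate.two_two
          (measurable_sqSum b).aemeasurable (measurable_one.indicator hAm).aemeasurable
    _ = (∑' i, b i ^ 2) ^ (1 / 2 : ℝ) * μ₁.prod μ₂ Ω ^ (1 / 2 : ℝ) := by
        have e : ∀ x, A.indicator (1 : X₁ × X₂ → ℝ≥0∞) x ^ (2 : ℝ) = A.indicator 1 x := by
          intro x
          by_cases hx : x ∈ A <;> simp [hx]
        simp_rw [e]
        rw [lintegral_indicator_one hAm, hA, measure_toMeasurable]
        simp_rw [ENNReal.rpow_two]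
        rw [lintegral_sqSum_sq h₁ h₂]

lemma h1Norm_haarSum_le [DecidableEq (H₁.Index × H₂.Index)] (a : H₁.Index × H₂.Index → 𝕜)
    {F : Finset (H₁.Index × H₂.Index)} {Ω : Set (X₁ × X₂)} (hF : ∀ i ∈ F, rect H₁ H₂ i ⊆ Ω) :
    h1Norm H₁ H₂ (haarSum H₁ H₂ a F) ≤
      (∑ i ∈ F, ‖a i‖ₑ ^ 2) ^ (1 / 2 : ℝ) * μ₁.prod μ₂ Ω ^ (1 / 2 : ℝ) := by
  rw [h1Norm, squareFn_haarSum h₁ h₂]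
  refine (lintegral_sqSum_le h₁ h₂ (Ω := Ω) fun i hi => hF i ?_).trans_eq ?_
  · by_contra h
    simp [h] at hi
  · congr 2
    rw [tsum_eq_sum (s := F) fun i hi => by simp [hi]]
    exact Finset.sum_congr rfl fun i hi => by rw [if_pos hi]

lemma haarSum_mem (a : H₁.Index × H₂.Index → 𝕜) (F : Finset (H₁.Index × H₂.Index)) :
    haarSum H₁ H₂ a F ∈ hardySpace 𝕜 H₁ H₂ ⊓ squareIntegrable 𝕜 μ₁ μ₂ := by
  classical
  refine ⟨⟨integrable_haarSum h₁ h₂ a F, ?_⟩, memLp_two_haarSum h₁ h₂ a F⟩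
  refine (h1Norm_haarSum_le h₁ h₂ a (Ω := ⋃ i ∈ F, rect H₁ H₂ i)
    fun i hi => subset_biUnion_of_mem (u := rect H₁ H₂) hi).trans_lt ?_
  have hfin : μ₁.prod μ₂ (⋃ i ∈ F, rect H₁ H₂ i) < ∞ :=
    measure_biUnion_lt_top F.finite_toSet fun i _ => (measure_rect_ne_top h₁ h₂ i).lt_top
  refine ENNReal.mul_lt_top (ENNReal.rpow_lt_top_of_nonneg (by norm_num) ?_)
    (ENNReal.rpow_lt_top_of_nonneg (by norm_num) hfin.ne)
  exact (ENNReal.sum_lt_top.2 fun i _ => ENNReal.pow_lt_top enorm_lt_top).ne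

omit [SigmaFinite μ₁] [SigmaFinite μ₂] in
/-- Finite Haar sums are admissible for every `φ`. -/
lemma isAdmissiblePair_haarSum (φ : X₁ × X₂ → 𝕜) (a : H₁.Index × H₂.Index → 𝕜)
    (F : Finset (H₁.Index × H₂.Index)) :
    IsAdmissiblePair ρ₁ ρ₂ μ₁ μ₂ φ (haarSum H₁ H₂ a F) := by
  refine ⟨Or.inr ⟨?_, ?_⟩, fun _ => Eventually.of_forall fun y => ?_,
    fun _ => Eventually.of_forall fun y => ?_⟩
  · obtain ⟨B, hB⟩ := exists_bound_haarSum (H₁ := H₁) (H₂ := H₂) a F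
    exact memLp_top_of_bound (measurable_haarSum a F).aestronglyMeasurable B
      (Eventually.of_forall hB)
  · have hev : ∀ᶠ n in atTop, ∀ i ∈ F, i.1 ∈ H₁.below T₁ n ∧ i.2 ∈ H₂.below T₂ n :=
      (Filter.eventually_all_finset F).2 fun i _ =>
        (h₁.eventually_mem_below i.1).and (h₂.eventually_mem_below i.2)
    obtain ⟨n, hn⟩ := hev.exists
    obtain ⟨y₁, r₁, hr₁⟩ := h₁.tower_subset n
    obtain ⟨y₂, r₂, hr₂⟩ := h₂.tower_subset n
    refine ⟨y₁, r₁, y₂, r₂, Eventually.of_forall fun x hx => Finset.sum_eq_zero fun i hi => ?_⟩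
    rw [prodHaar_eq_zero, mul_zero]
    exact fun hxi => hx ⟨hr₁ ((hn i hi).1.2 hxi.1), hr₂ ((hn i hi).2.2 hxi.2)⟩
  · have e : ∀ x, haarSum H₁ H₂ a F (x, y) =
        ∑ i ∈ F, a i * ((H₂.haar i.2 y : ℝ) : 𝕜) * ((H₁.haar i.1 x : ℝ) : 𝕜) := fun x => by
      refine Finset.sum_congr rfl fun i _ => ?_
      simp only [prodHaar, tensor]
      push_cast
      ring
    simp_rw [e]
    rw [integral_finsetSum _ fun i _ => (h₁.integrable_haar i.1).ofReal.const_mul _]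
    refine Finset.sum_eq_zero fun i _ => ?_
    rw [integral_const_mul, integral_ofReal, h₁.integral_haar, RCLike.ofReal_zero, mul_zero]
  · have e : ∀ x, haarSum H₁ H₂ a F (y, x) =
        ∑ i ∈ F, a i * ((H₁.haar i.1 y : ℝ) : 𝕜) * ((H₂.haar i.2 x : ℝ) : 𝕜) := fun x => by
      refine Finset.sum_congr rfl fun i _ => ?_
      simp only [prodHaar, tensor]
      push_cast
      ring
    simp_rw [e]
    rw [integral_finsetSum _ fun i _ => (h₂.integrable_haar i.2).ofReal.const_mul _]
    refine Finset.sum_eq_zero fun i _ => ?_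
    rw [integral_const_mul, integral_ofReal, h₂.integral_haar, RCLike.ofReal_zero, mul_zero]

/-- A bounded functional on a subspace of the Hardy space that contains the finite Haar sums is
determined by its values at these sums. -/
lemma eq_zero_of_haarSum {V : Submodule 𝕜 (X₁ × X₂ → 𝕜)} (hV : V ≤ hardySpace 𝕜 H₁ H₂)
    (hmem : ∀ (a : H₁.Index × H₂.Index → 𝕜) F, haarSum H₁ H₂ a F ∈ V) {M : V →ₗ[𝕜] 𝕜} {K : ℝ≥0∞}
    (hK : K ≠ ∞) (hM : ∀ f : V, ‖M f‖ₑ ≤ K * h1Norm H₁ H₂ (f : X₁ × X₂ → 𝕜))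
    (h0 : ∀ (a : H₁.Index × H₂.Index → 𝕜) F, M ⟨haarSum H₁ H₂ a F, hmem a F⟩ = 0) : M = 0 := by
  refine LinearMap.ext fun f => ?_
  obtain ⟨hfi, hfS⟩ := hV f.2
  have ht := ENNReal.Tendsto.const_mul (a := K) (tendsto_h1Norm_sub_haarSum h₁ h₂ hfi hfS)
    (Or.inr hK)
  rw [mul_zero] at ht
  have hle : ‖M f‖ₑ ≤ 0 := ge_of_tendsto' ht fun F => by
    have := hM (f - ⟨_, hmem (haarCoeff H₁ H₂ f) F⟩)
    rwa [map_sub, h0, sub_zero] at this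
  simpa using hle

lemma haarPairing_haarSum (φ : X₁ × X₂ → 𝕜) (a : H₁.Index × H₂.Index → 𝕜)
    (F : Finset (H₁.Index × H₂.Index)) :
    haarPairing H₁ H₂ φ (haarSum H₁ H₂ a F) = ∑ i ∈ F, haarCoeff H₁ H₂ φ i * a i := by
  classical
  simp only [haarPairing, haarCoeff_haarSum h₁ h₂]
  rw [tsum_eq_sum (s := F) fun i hi => by simp [hi]]
  exact Finset.sum_congr rfl fun i hi => by rw [if_pos hi]

omit [SigmaFinite μ₁] [SigmaFinite μ₂] h₁ h₂ in
/-- The case `μ(Ω) = 0`, in which `μ(Ω)⁻¹ = ∞`, is harmless because the sum vanishes as well. -/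
lemma bmoNorm_le [TopologicalSpace X₁] [TopologicalSpace X₂] {φ : X₁ × X₂ → 𝕜} {K : ℝ≥0∞}
    (h : ∀ Ω : Set (X₁ × X₂), μ₁.prod μ₂ Ω < ∞ →
      ∑' i : {i // rect H₁ H₂ i ⊆ Ω}, ‖haarCoeff H₁ H₂ φ i‖ₑ ^ 2 ≤ K ^ 2 * μ₁.prod μ₂ Ω) :
    bmoNorm H₁ H₂ φ ≤ K := by
  refine iSup_le fun Ω => iSup_le fun _ => iSup_le fun hfin => ?_
  have hle : (μ₁.prod μ₂ Ω)⁻¹ * ∑' i : {i // rect H₁ H₂ i ⊆ Ω},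
      ‖haarCoeff H₁ H₂ φ i‖ₑ ^ 2 ≤ K ^ 2 := by
    by_cases h0 : μ₁.prod μ₂ Ω = 0
    · have := h Ω hfin
      rw [h0, mul_zero] at this
      rw [le_antisymm this zero_le, mul_zero]
      exact zero_le
    · refine (mul_le_mul_right (h Ω hfin) _).trans_eq ?_
      rw [mul_left_comm, ENNReal.inv_mul_cancel h0 hfin.ne, mul_one]
  refine (ENNReal.rpow_le_rpow hle (by norm_num)).trans_eq ?_
  rw [← ENNReal.rpow_natCast, ← ENNReal.rpow_mul]
  norm_num

/-- The functional induced by a function in the BMO space. -/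
lemma IsBMO.exists_functional [TopologicalSpace X₁] [TopologicalSpace X₂]
    [(μ₁.prod μ₂).OuterRegular] {φ : X₁ × X₂ → 𝕜} (hφ : IsBMO H₁ H₂ φ) :
    (∀ f ∈ hardySpace 𝕜 H₁ H₂, Summable fun i => haarCoeff H₁ H₂ φ i * haarCoeff H₁ H₂ f i) ∧
    ∃ L : hardySpace 𝕜 H₁ H₂ →ₗ[𝕜] 𝕜, (∀ f, L f = haarPairing H₁ H₂ φ f) ∧
      ∀ f : hardySpace 𝕜 H₁ H₂,
        ‖L f‖ₑ ≤ 96 * bmoNorm H₁ H₂ φ * h1Norm H₁ H₂ (f : X₁ × X₂ → 𝕜) := by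
  have hle : ∀ f ∈ hardySpace 𝕜 H₁ H₂, ∑' i, ‖haarCoeff H₁ H₂ φ i * haarCoeff H₁ H₂ f i‖ₑ ≤
      96 * bmoNorm H₁ H₂ φ * h1Norm H₁ H₂ f := by
    intro f hf
    simp_rw [enorm_mul]
    exact tsum_mul_le_of_carleson h₁ h₂ (b := fun i => ‖haarCoeff H₁ H₂ f i‖ₑ)
      (fun Ω _ hfin => hφ.carleson h₁ h₂ hfin) hf.2.ne
  have hs : ∀ f ∈ hardySpace 𝕜 H₁ H₂,
      Summable fun i => haarCoeff H₁ H₂ φ i * haarCoeff H₁ H₂ f i := by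
    intro f hf
    have hne : ∑' i, ‖haarCoeff H₁ H₂ φ i * haarCoeff H₁ H₂ f i‖ₑ ≠ ∞ :=
      ((hle f hf).trans_lt (ENNReal.mul_lt_top (ENNReal.mul_lt_top (by norm_num)
        hφ.bmoNorm_lt_top) hf.2)).ne
    refine Summable.of_norm ((ENNReal.summable_toReal hne).congr fun i => ?_)
    rw [toReal_enorm]
  refine ⟨hs, ⟨⟨fun f => haarPairing H₁ H₂ φ f, fun f g => ?_⟩, fun c f => ?_⟩, fun f => rfl,
    fun f => ?_⟩
  · simp only [haarPairing, Submodule.coe_add, haarCoeff_add H₁ H₂ f.2.1 g.2.1, mul_add]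
    exact (hs f f.2).tsum_add (hs g g.2)
  · simp only [haarPairing, Submodule.coe_smul, haarCoeff_smul, mul_left_comm _ c,
      RingHom.id_apply, smul_eq_mul]
    exact tsum_mul_left
  · exact enorm_tsum_le_tsum_enorm.trans (hle f f.2)

/-- The values of a bounded functional at the Haar functions satisfy the Carleson condition, which
is seen by testing the functional on finite Haar sums. -/
lemma carleson_of_functional
    {ℓ : ↥(hardySpace 𝕜 H₁ H₂ ⊓ squareIntegrable 𝕜 μ₁ μ₂) →ₗ[𝕜] 𝕜} {K : ℝ≥0}
    (hℓ : ∀ f, ‖ℓ f‖ₑ ≤ K * h1Norm H₁ H₂ (f : X₁ × X₂ → 𝕜))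
    {c : H₁.Index × H₂.Index → 𝕜}
    (hc : ∀ a F, ℓ ⟨haarSum H₁ H₂ a F, haarSum_mem h₁ h₂ a F⟩ = ∑ i ∈ F, c i * a i)
    (Ω : Set (X₁ × X₂)) :
    ∑' i : {i // rect H₁ H₂ i ⊆ Ω}, ‖c i‖ₑ ^ 2 ≤ (K : ℝ≥0∞) ^ 2 * μ₁.prod μ₂ Ω := by
  classical
  rw [ENNReal.tsum_eq_iSup_sum]
  refine iSup_le fun G => ?_
  set F : Finset (H₁.Index × H₂.Index) := G.map (Function.Embedding.subtype _) with hF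
  have hFΩ : ∀ i ∈ F, rect H₁ H₂ i ⊆ Ω := by
    intro i hi
    obtain ⟨j, -, rfl⟩ := Finset.mem_map.1 hi
    exact j.2
  have hsum : ∑ i ∈ G, ‖c i‖ₑ ^ 2 = ∑ i ∈ F, ‖c i‖ₑ ^ 2 := by
    rw [hF, Finset.sum_map]; rfl
  rw [hsum]
  set S := ∑ i ∈ F, ‖c i‖ₑ ^ 2 with hS
  have hStop : S ≠ ∞ := (ENNReal.sum_lt_top.2 fun i _ => ENNReal.pow_lt_top enorm_lt_top).ne
  have hval : ‖ℓ ⟨haarSum H₁ H₂ (fun i => star (c i)) F, haarSum_mem h₁ h₂ _ F⟩‖ₑ = S := by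
    have e : ∑ i ∈ F, c i * star (c i) = ((∑ i ∈ F, ‖c i‖ ^ 2 : ℝ) : 𝕜) := by
      push_cast
      exact Finset.sum_congr rfl fun i _ => RCLike.mul_conj (c i)
    rw [hc, e, hS, ← ofReal_norm, RCLike.norm_ofReal,
      abs_of_nonneg (Finset.sum_nonneg fun i _ => sq_nonneg _),
      ENNReal.ofReal_sum_of_nonneg fun i _ => sq_nonneg _]
    refine Finset.sum_congr rfl fun i _ => ?_
    rw [ENNReal.ofReal_pow (norm_nonneg _), ofReal_norm]
  have hle : S ≤ K * (S ^ (1 / 2 : ℝ) * μ₁.prod μ₂ Ω ^ (1 / 2 : ℝ)) := by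
    calc S ≤ K * h1Norm H₁ H₂ (haarSum H₁ H₂ (fun i => star (c i)) F) := hval ▸ hℓ _
      _ ≤ _ := by
          gcongr
          refine (h1Norm_haarSum_le h₁ h₂ _ hFΩ).trans_eq ?_
          simp [hS]
  have hsq : ∀ t : ℝ≥0∞, (t ^ (1 / 2 : ℝ)) ^ 2 = t := fun t => by
    rw [← ENNReal.rpow_natCast, ← ENNReal.rpow_mul]
    norm_num
  by_cases hS0 : S = 0
  · rw [hS0]; exact zero_le
  set r := S ^ (1 / 2 : ℝ) with hr
  have hr0 : r ≠ 0 := by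
    rw [hr, Ne, ENNReal.rpow_eq_zero_iff]
    simp [hS0, hStop]
  have hrtop : r ≠ ∞ := (ENNReal.rpow_lt_top_of_nonneg (by norm_num) hStop).ne
  have hdiv : r ≤ K * μ₁.prod μ₂ Ω ^ (1 / 2 : ℝ) := by
    rw [← ENNReal.mul_le_mul_iff_right hr0 hrtop]
    calc r * r = S := by rw [← sq, hr, hsq]
      _ ≤ _ := hle
      _ = _ := by ring
  calc S = r ^ 2 := by rw [hr, hsq]
    _ ≤ (K * μ₁.prod μ₂ Ω ^ (1 / 2 : ℝ)) ^ 2 := by gcongr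
    _ = _ := by rw [mul_pow, hsq]

/-- Every bounded functional is induced by a function with the Haar coefficients `ℓ(h_i)`. -/
lemma exists_isBMO_of_functional [TopologicalSpace X₁] [TopologicalSpace X₂]
    [(μ₁.prod μ₂).OuterRegular]
    {ℓ : ↥(hardySpace 𝕜 H₁ H₂ ⊓ squareIntegrable 𝕜 μ₁ μ₂) →ₗ[𝕜] 𝕜} {K : ℝ≥0}
    (hℓ : ∀ f, ‖ℓ f‖ₑ ≤ K * h1Norm H₁ H₂ (f : X₁ × X₂ → 𝕜)) :
    ∃ φ : X₁ × X₂ → 𝕜, IsBMO H₁ H₂ φ ∧ bmoNorm H₁ H₂ φ ≤ K ∧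
      ∀ f : ↥(hardySpace 𝕜 H₁ H₂ ⊓ squareIntegrable 𝕜 μ₁ μ₂), ℓ f = haarPairing H₁ H₂ φ f := by
  classical
  set c : H₁.Index × H₂.Index → 𝕜 := fun i =>
    ℓ ⟨haarSum H₁ H₂ (fun _ => 1) {i}, haarSum_mem h₁ h₂ _ _⟩ with hcdef
  have hc : ∀ a F, ℓ ⟨haarSum H₁ H₂ a F, haarSum_mem h₁ h₂ a F⟩ = ∑ i ∈ F, c i * a i := by
    intro a F
    have e : (⟨haarSum H₁ H₂ a F, haarSum_mem h₁ h₂ a F⟩ :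
        ↥(hardySpace 𝕜 H₁ H₂ ⊓ squareIntegrable 𝕜 μ₁ μ₂)) = ∑ i ∈ F, a i •
        ⟨haarSum H₁ H₂ (fun _ => 1) {i}, haarSum_mem h₁ h₂ (fun _ => 1) {i}⟩ := by
      refine Subtype.ext ?_
      rw [Submodule.coe_sum]
      funext x
      simp [haarSum, Finset.sum_apply]
    rw [e, map_sum]
    refine Finset.sum_congr rfl fun i _ => ?_
    rw [map_smul, smul_eq_mul, mul_comm]
  have hcar := carleson_of_functional h₁ h₂ hℓ hc
  obtain ⟨φ, hφi, hφc⟩ := exists_haarCoeff_eq h₁ h₂ (c := c) fun n => by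
    have hRfin : μ₁.prod μ₂ (T₁ n ×ˢ T₂ n) < ∞ := by
      rw [Measure.prod_prod]
      exact ENNReal.mul_lt_top (h₁.measure_lt_top _ _ (h₁.tower_mem n))
        (h₂.measure_lt_top _ _ (h₂.tower_mem n))
    have hne : ∑' i : {i // rect H₁ H₂ i ⊆ T₁ n ×ˢ T₂ n}, ‖c i‖ₑ ^ 2 ≠ ∞ :=
      ((hcar _).trans_lt (ENNReal.mul_lt_top (by simp) hRfin)).ne
    have hs : Summable ({i | rect H₁ H₂ i ⊆ T₁ n ×ˢ T₂ n}.indicator fun i => ‖c i‖ ^ 2) := by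
      rw [← summable_subtype_iff_indicator]
      refine (ENNReal.summable_toReal hne).congr fun i => ?_
      simp
    refine hs.of_nonneg_of_le (fun i => indicator_nonneg (fun _ _ => sq_nonneg _) _) fun i =>
      indicator_le_indicator_of_subset (s := H₁.below T₁ n ×ˢ H₂.below T₂ n)
        (fun i hi => Set.prod_mono hi.1.2 hi.2.2) (fun _ => sq_nonneg _) i
  have hnorm : bmoNorm H₁ H₂ φ ≤ K := bmoNorm_le fun Ω _ => by
    simp_rw [hφc]
    exact hcar Ω
  have hφ : IsBMO H₁ H₂ φ := by
    refine ⟨fun y₁ r₁ y₂ r₂ => ?_, hnorm.trans_lt ENNReal.coe_lt_top⟩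
    obtain ⟨n₁, hn₁⟩ := h₁.exists_subset_tower y₁ r₁
    obtain ⟨n₂, hn₂⟩ := h₂.exists_subset_tower y₂ r₂
    exact (hφi (max n₁ n₂)).mono_set (prod_mono
      (hn₁.trans (h₁.monotone_tower (le_max_left _ _)))
      (hn₂.trans (h₂.monotone_tower (le_max_right _ _))))
  refine ⟨φ, hφ, hnorm, ?_⟩
  obtain ⟨-, L, hL, hLle⟩ := hφ.exists_functional h₁ h₂
  have hz : ℓ - L ∘ₗ Submodule.inclusion inf_le_left = 0 := by
    refine eq_zero_of_haarSum h₁ h₂ inf_le_left (haarSum_mem h₁ h₂)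
      (K := K + 96 * bmoNorm H₁ H₂ φ) ?_ (fun f => ?_) fun a F => ?_
    · exact (ENNReal.add_lt_top.2 ⟨ENNReal.coe_lt_top,
        ENNReal.mul_lt_top (by norm_num) hφ.bmoNorm_lt_top⟩).ne
    · rw [add_mul]
      exact (enorm_sub_le).trans (add_le_add (hℓ f) (hLle _))
    · rw [LinearMap.sub_apply, hc, LinearMap.comp_apply, hL, sub_eq_zero]
      refine Eq.trans ?_ (haarPairing_haarSum h₁ h₂ φ a F).symm
      simp_rw [hφc]
  intro f
  have := LinearMap.congr_fun hz f
  rw [LinearMap.sub_apply, LinearMap.zero_apply, sub_eq_zero] at this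
  rw [this, LinearMap.comp_apply, hL]
  rfl

end Duality

end ProductDyadic

theorem mainTheorem7 : ∃ C : ℝ≥0,
    ∀ (𝕜 X₁ X₂ : Type*) [RCLike 𝕜]
      [TopologicalSpace X₁] [MeasurableSpace X₁] [TopologicalSpace X₂] [MeasurableSpace X₂]
      (ρ₁ : X₁ → X₁ → ℝ) (ρ₂ : X₂ → X₂ → ℝ) (μ₁ : Measure X₁) (μ₂ : Measure X₂)
      (_ : IsHomogeneousType ρ₁ μ₁) (_ : IsHomogeneousType ρ₂ μ₂)
      (H₁ : HaarSystem ρ₁ μ₁) (H₂ : HaarSystem ρ₂ μ₂),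
      -- Each `φ ∈ BMO` induces a bounded functional.
      (∀ φ : X₁ × X₂ → 𝕜, IsBMO H₁ H₂ φ →
        (∀ f ∈ hardySpace 𝕜 H₁ H₂ ⊓ squareIntegrable 𝕜 μ₁ μ₂,
          Summable fun i => haarCoeff H₁ H₂ φ i * haarCoeff H₁ H₂ f i) ∧
        (∀ f ∈ hardySpace 𝕜 H₁ H₂ ⊓ squareIntegrable 𝕜 μ₁ μ₂, IsAdmissiblePair ρ₁ ρ₂ μ₁ μ₂ φ f →
          Integrable (fun x => φ x * f x) (μ₁.prod μ₂) ∧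
            haarPairing H₁ H₂ φ f = ∫ x, φ x * f x ∂(μ₁.prod μ₂)) ∧
        ∃ L : hardySpace 𝕜 H₁ H₂ →ₗ[𝕜] 𝕜,
          (∀ f : hardySpace 𝕜 H₁ H₂,
            ‖L f‖ₑ ≤ C * bmoNorm H₁ H₂ φ * h1Norm H₁ H₂ (f : X₁ × X₂ → 𝕜)) ∧
          (∀ f : hardySpace 𝕜 H₁ H₂, (f : X₁ × X₂ → 𝕜) ∈ squareIntegrable 𝕜 μ₁ μ₂ →
            L f = haarPairing H₁ H₂ φ f) ∧
          -- `L` is the only bounded functional that extends `f ↦ ∫ φ f`.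
          (∀ L' : hardySpace 𝕜 H₁ H₂ →ₗ[𝕜] 𝕜,
            (∃ K : ℝ≥0, ∀ f : hardySpace 𝕜 H₁ H₂,
              ‖L' f‖ₑ ≤ K * h1Norm H₁ H₂ (f : X₁ × X₂ → 𝕜)) →
            (∀ f : hardySpace 𝕜 H₁ H₂, (f : X₁ × X₂ → 𝕜) ∈ squareIntegrable 𝕜 μ₁ μ₂ →
              IsAdmissiblePair ρ₁ ρ₂ μ₁ μ₂ φ (f : X₁ × X₂ → 𝕜) →
              L' f = ∫ x, φ x * (f : X₁ × X₂ → 𝕜) x ∂(μ₁.prod μ₂)) →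
            L' = L)) ∧
      -- Each bounded functional is induced by some `φ ∈ BMO`.
      (∀ (ℓ : ↥(hardySpace 𝕜 H₁ H₂ ⊓ squareIntegrable 𝕜 μ₁ μ₂) →ₗ[𝕜] 𝕜) (K : ℝ≥0),
        (∀ f, ‖ℓ f‖ₑ ≤ K * h1Norm H₁ H₂ (f : X₁ × X₂ → 𝕜)) →
        ∃ φ : X₁ × X₂ → 𝕜, IsBMO H₁ H₂ φ ∧ bmoNorm H₁ H₂ φ ≤ C * K ∧
          (∀ f : ↥(hardySpace 𝕜 H₁ H₂ ⊓ squareIntegrable 𝕜 μ₁ μ₂),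
            (Summable fun i => haarCoeff H₁ H₂ φ i * haarCoeff H₁ H₂ (f : X₁ × X₂ → 𝕜) i) ∧
            ℓ f = haarPairing H₁ H₂ φ f) ∧
          (∀ f : ↥(hardySpace 𝕜 H₁ H₂ ⊓ squareIntegrable 𝕜 μ₁ μ₂),
            IsAdmissiblePair ρ₁ ρ₂ μ₁ μ₂ φ (f : X₁ × X₂ → 𝕜) →
            Integrable (fun x => φ x * (f : X₁ × X₂ → 𝕜) x) (μ₁.prod μ₂) ∧
              ℓ f = ∫ x, φ x * (f : X₁ × X₂ → 𝕜) x ∂(μ₁.prod μ₂))) := by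
  -- The constant is that of `tsum_mul_le_of_carleson`; the converse holds with constant `1`.
  refine ⟨96, fun 𝕜 X₁ X₂ _ _ _ _ _ ρ₁ ρ₂ μ₁ μ₂ hX₁ hX₂ H₁ H₂ => ?_⟩
  obtain ⟨T₁, x₁, h₁⟩ := hX₁.exists_regular H₁
  obtain ⟨T₂, x₂, h₂⟩ := hX₂.exists_regular H₂
  have := h₁.sigmaFinite
  have := h₂.sigmaFinite
  have := outerRegular_prod hX₁ hX₂ H₁.toDyadicSystem H₂.toDyadicSystem
  have hloc : ∀ φ : X₁ × X₂ → 𝕜, IsBMO H₁ H₂ φ →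
      ∀ n, IntegrableOn φ (T₁ n ×ˢ T₂ n) (μ₁.prod μ₂) := by
    intro φ hφ n
    obtain ⟨y₁, r₁, hr₁⟩ := h₁.tower_subset n
    obtain ⟨y₂, r₂, hr₂⟩ := h₂.tower_subset n
    exact (hφ.locallyIntegrable y₁ r₁ y₂ r₂).mono_set (prod_mono hr₁ hr₂)
  constructor
  · intro φ hφ
    obtain ⟨hs, L, hL, hLle⟩ := hφ.exists_functional h₁ h₂
    refine ⟨fun f hf => hs f hf.1, fun f hf hadm => haarPairing_eq_integral h₁ h₂ (hloc φ hφ)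
      hf.1.1 hf.1.2 hf.2 hadm (hs f hf.1), L, hLle, fun f _ => hL f, fun L' hL' hint => ?_⟩
    obtain ⟨K, hK⟩ := hL'
    rw [← sub_eq_zero]
    refine eq_zero_of_haarSum h₁ h₂ le_rfl (fun a F => (haarSum_mem h₁ h₂ a F).1)
      (K := K + 96 * bmoNorm H₁ H₂ φ) ?_ (fun f => ?_) fun a F => ?_
    · exact (ENNReal.add_lt_top.2 ⟨ENNReal.coe_lt_top,
        ENNReal.mul_lt_top (by norm_num) hφ.bmoNorm_lt_top⟩).ne
    · rw [add_mul]
      exact enorm_sub_le.trans (add_le_add (hK f) (hLle f))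
    · have hmem := haarSum_mem h₁ h₂ a F
      have hadm := isAdmissiblePair_haarSum h₁ h₂ φ a F
      rw [LinearMap.sub_apply, hL, hint _ hmem.2 hadm, sub_eq_zero]
      exact (haarPairing_eq_integral h₁ h₂ (hloc φ hφ) hmem.1.1 hmem.1.2 hmem.2 hadm
        (hs _ hmem.1)).2.symm
  · intro ℓ K hℓ
    obtain ⟨φ, hφ, hnorm, hpair⟩ := exists_isBMO_of_functional h₁ h₂ hℓ
    have hs := (hφ.exists_functional h₁ h₂).1
    refine ⟨φ, hφ, hnorm.trans (le_mul_of_one_le_left zero_le (by norm_num)),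
      fun f => ⟨hs f f.2.1, hpair f⟩, fun f hadm => ?_⟩
    rw [hpair f]
    exact haarPairing_eq_integral h₁ h₂ (hloc φ hφ) f.2.1.1 f.2.1.2 f.2.2 hadm (hs f f.2.1)
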